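/- **Definitions.** Let $E$ be a field. A *homogeneous algebraic branching program* (ABP) over $E$ in noncommuting variables $x_1,\dots,x_n$, of degree $d$ and width $r$, is a layered directed graph with layers $0,\dots,d$, each having at most $r$ vertices, with edges only from layer $i$ to layer $i+1$, a source in layer $0$ and a sink in layer $d$, every edge being labeled by a homogeneous linear form $\sum_i a_i x_i$ ($a_i\in E$). It computes the sum, over all source-to-sink paths, of the ordered product of the edge labels, an element of $E\langle x_1,\dots,x_n\rangle$. For a finite cyclic Galois extension $K/F$ of degree $\ell$ whose Galois group is generated by $\sigma$, and $0\ne a\in F$, the *cyclic algebra* $(K/F,\sigma,a)$ is $K\oplus Kx\oplus\dots\oplus Kx^{\ell-1}$ with $x^\ell=a$ and $xb=\sigma(b)x$ for $b\in K$; it is regarded as a subalgebra of $\mathrm{Mat}_\ell(K)$ through its usual matrix representation ($b\mapsto \mathrm{diag}(b,\sigma b,\dots,\sigma^{\ell-1}b)$, and $x\mapsto$ the matrix with ones on the superdiagonal and $a$ in the lower left corner). If it is a division algebra, it is called a cyclic division algebra of index $\ell$. **Theorem.** There are an absolute constant $C$ and one deterministic algorithm such that the following holds for every prime $p$ and all integers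 $n,r,\tilde d\ge 1$. Put $m=\max(2,\tilde d\log_2 n)$ and $s=\max(2,nr\tilde d)$ (so $m=\tilde d\log_2 n$ and $s=nr\tilde d$ whenever $n,\tilde d\ge2$). There is an integer $L\ge 0$, depending only on $p$, $n$ and $\tilde d$ (not on the width $r$), with $$L\le C\,p\log_p m ,$$ such that on input $(p,n,r,\tilde d)$ the algorithm outputs, in time at most $s^{C p\log_2 m}$, integers $N\ge 1$ and $k$ and an explicitly written list $\mathcal H$ of at most $s^{C p\log_2 m}$ $n$-tuples, with the following properties. Let $K=\mathbb Q(\omega,z)$, where $\omega=e^{2\pi \mathrm{i}/N}$ and $z$ is an indeterminate. There are a subfield $F\subseteq K$ containing $z$ and an automorphism $\sigma$ of $K/F$ with $\sigma(\omega)=\omega^k$ such that 1. $D_2=(K/F,\sigma,z)$ is a cyclic division algebra of index $p^L$; 2. $\mathcal H\subseteq D_2^n$, each component of a tuple being written as $\sum_j b_jx^j$ with $b_j\in\mathbb Q[\omega,z]$ given by its list of rational coefficients; 3. $\mathcal H$ is a hitting set for homogeneous $n$-variate degree-$\tilde d$ noncommutative ABPs of width $r$: for every extension field $E$ of $K$ (for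 instance $E=K$, which covers coefficients in $\mathbb Q$, $F$ or $K$) and every such ABP over $E$ that computes a nonzero polynomial $f$, there is a tuple $q\in\mathcal H$ with $f(q)\neq 0$ in $\mathrm{Mat}_{p^L}(E)$. Thus the hitting set has size, and is constructed in time, $(nr\tilde d)^{O(p\log(\tilde d\log n))}$, and $L=O(p\log_p(\tilde d\log n))$. Time is measured on a random access machine with logarithmic cost, all inputs and outputs being natural numbers in binary. -/

import Mathlib

namespace HittingSet

/-! ## Homogeneous noncommutative algebraic branching programs -/

/-- A homogeneous algebraic branching program of width (at most) `r` with layers `0, …, d` over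
the field `E` in the noncommuting variables indexed by `Fin n`. Every layer has the vertex set
`Fin r`; a smaller layer is padded with isolated vertices, which changes neither the polynomial
nor the bound `r` on the width. `label i a b` is the coefficient vector of the homogeneous linear
form on the edge from vertex `a` of layer `i` to vertex `b` of layer `i + 1` (the zero form stands
for a missing edge). The source lies in layer `0` and the sink in layer `d`. -/
structure HomABP (E : Type*) (n r d : ℕ) where
  label : Fin d → Fin r → Fin r → Fin n → E
  source : Fin r
  sink : Fin r

/-- The linear form `∑ i, c i • x i` in the free algebra. -/
noncomputable def linForm {E : Type*} [Field E] {n : ℕ} (c : Fin n → E) : FreeAlgebra E (Fin n) :=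
  ∑ i, c i • FreeAlgebra.ι E i

/-- The noncommutative polynomial computed by a homogeneous ABP: the sum over all source-to-sink
paths of the ordered product of the labels along the path. -/
noncomputable def HomABP.poly {E : Type*} [Field E] {n r d : ℕ} (A : HomABP E n r d) :
    FreeAlgebra E (Fin n) :=
  ∑ π : Fin (d + 1) → Fin r with π 0 = A.source ∧ π (Fin.last d) = A.sink,
    (List.ofFn fun i : Fin d => linForm (A.label i (π i.castSucc) (π i.succ))).prod

/-! ## Cyclic division algebras -/

section Cyclic

variable {F K : Type*} [Field F] [Field K] [Algebra F K]

/-- The matrix of `b ∈ K` in the cyclic algebra `(K/F, σ, a)`: the diagonal matrix with entries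
`b, σ b, …, σ ^ (ℓ - 1) b`. -/
def cyclicDiag (ℓ : ℕ) (σ : K ≃ₐ[F] K) (b : K) : Matrix (Fin ℓ) (Fin ℓ) K :=
  Matrix.diagonal fun i => (σ ^ (i : ℕ)) b

/-- The matrix of the generator `x` (with `x ^ ℓ = a`) in the cyclic algebra `(K/F, σ, a)`:
ones on the superdiagonal and `a` in the lower left corner. -/
def cyclicShift (ℓ : ℕ) (a : K) : Matrix (Fin ℓ) (Fin ℓ) K :=
  Matrix.of fun i j =>
    if (j : ℕ) = i + 1 then 1 else if (i : ℕ) + 1 = ℓ ∧ (j : ℕ) = 0 then a else 0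

/-- The cyclic algebra `(K/F, σ, a) = K ⊕ K x ⊕ ⋯ ⊕ K x ^ (ℓ - 1)`, with `x ^ ℓ = a` and
`x b = σ b x`, in its matrix representation over `K`. -/
def cyclicAlgebra (ℓ : ℕ) (σ : K ≃ₐ[F] K) (a : F) : Subalgebra F (Matrix (Fin ℓ) (Fin ℓ) K) :=
  Algebra.adjoin F (Set.range (cyclicDiag ℓ σ) ∪ {cyclicShift ℓ (algebraMap F K a)})

/-- `(K/F, σ, a)` is a cyclic division algebra of index `ℓ`: the extension `K/F` is finite Galois
of degree `ℓ`, its Galois group is generated by `σ`, `a` is nonzero, and every nonzero element of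
the cyclic algebra has an inverse in it. -/
structure IsCyclicDivisionAlgebra (ℓ : ℕ) (σ : K ≃ₐ[F] K) (a : F) : Prop where
  finiteDimensional : FiniteDimensional F K
  isGalois : IsGalois F K
  finrank_eq : Module.finrank F K = ℓ
  generates : ∀ τ : K ≃ₐ[F] K, τ ∈ Subgroup.zpowers σ
  ne_zero : a ≠ 0
  exists_inverse : ∀ u ∈ cyclicAlgebra ℓ σ a, u ≠ 0 →
    ∃ v ∈ cyclicAlgebra ℓ σ a, u * v = 1 ∧ v * u = 1

end Cyclic

/-! ## The field `ℚ(ω, z)` and explicit descriptions of algebra elements -/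

/-- The primitive `N`-th root of unity `e ^ (2 π i / N)`. -/
noncomputable def rootC (N : ℕ) : ℂ := Complex.exp (2 * Real.pi * Complex.I / N)

/-- The field `ℚ(ω, z)`, where `ω = e ^ (2 π i / N)` and `z` is a commuting indeterminate. -/
abbrev CycFun (N : ℕ) : Type := RatFunc (IntermediateField.adjoin ℚ {rootC N})

/-- The primitive `N`-th root of unity `ω` in `ℚ(ω, z)`. -/
noncomputable def omega (N : ℕ) : CycFun N :=
  RatFunc.C (IntermediateField.AdjoinSimple.gen ℚ (rootC N))

/-- The indeterminate `z` in `ℚ(ω, z)`. -/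
noncomputable def zvar (N : ℕ) : CycFun N := RatFunc.X

/-- `∑ i, l[i] * x ^ i`. -/
def powSum {R : Type*} [Semiring R] (x : R) (l : List R) : R :=
  ∑ i : Fin l.length, l.get i * x ^ (i : ℕ)

/-- Explicit description of an element of `ℚ[ω, z]`: the rational coefficients `c[j][i]` of
`ω ^ i z ^ j`. -/
abbrev FieldData : Type := List (List ℚ)

/-- The element `∑ j, (∑ i, c[j][i] ω ^ i) z ^ j` of `ℚ(ω, z)`. -/
noncomputable def FieldData.val (N : ℕ) (c : FieldData) : CycFun N :=
  powSum (zvar N) (c.map fun row => powSum (omega N) (row.map fun c : ℚ => (c : CycFun N)))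

/-- Explicit description of an element of a cyclic algebra: the list of the coefficients `b j` in
`∑ j, b j * x ^ j`. -/
abbrev AlgData : Type := List FieldData

/-- The element `∑ j, b j * x ^ j` of the cyclic algebra `(ℚ(ω, z)/F, σ, z)`, as an
`ℓ × ℓ` matrix over `ℚ(ω, z)`. -/
noncomputable def AlgData.val (N : ℕ) {F : Subfield (CycFun N)} (ℓ : ℕ)
    (σ : CycFun N ≃ₐ[F] CycFun N) (b : AlgData) : Matrix (Fin ℓ) (Fin ℓ) (CycFun N) :=
  powSum (cyclicShift ℓ (zvar N)) (b.map fun c => cyclicDiag ℓ σ (FieldData.val N c))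

/-- Encoding of a list by natural numbers: each entry is preceded by `1`, the end is marked
by `0`. -/
def encList {α : Type*} (f : α → List ℕ) (l : List α) : List ℕ :=
  l.flatMap (fun a => 1 :: f a) ++ [0]

/-- Encoding of a rational number by its sign bit, and its numerator and denominator in lowest
terms. -/
def encRat (q : ℚ) : List ℕ := [if q < 0 then 1 else 0, q.num.natAbs, q.den]

/-- Encoding of an explicit element of `ℚ[ω, z]`. -/
def encField (c : FieldData) : List ℕ := encList (encList encRat) c

/-- Encoding of an explicit element of a cyclic algebra. -/
def encAlg (b : AlgData) : List ℕ := encList encField b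

/-- Encoding of the order `N` of `ω`, the exponent `k` with `σ ω = ω ^ k`, and a list of
`n`-tuples of explicit elements of the cyclic algebra. -/
def encOutput {n : ℕ} (N k : ℕ) (H : List (Fin n → AlgData)) : List ℕ :=
  N :: k :: encList (fun q => encList encAlg (List.ofFn q)) H

/-! ## Random access machines with logarithmic cost -/

/-- A memory: every natural number is the address of a cell that holds a natural number. -/
abbrev Mem : Type := ℕ → ℕ

/-- Expressions: constants, the content of the cell with a given address, addition, truncated
subtraction, multiplication and division with rounding down (division by zero gives zero). -/
inductive Expr : Type
  | lit (c : ℕ)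
  | deref (addr : Expr)
  | add (e₁ e₂ : Expr)
  | sub (e₁ e₂ : Expr)
  | mul (e₁ e₂ : Expr)
  | div (e₁ e₂ : Expr)

/-- The value of an expression. -/
def Expr.eval (m : Mem) : Expr → ℕ
  | .lit c => c
  | .deref a => m (a.eval m)
  | .add e₁ e₂ => e₁.eval m + e₂.eval m
  | .sub e₁ e₂ => e₁.eval m - e₂.eval m
  | .mul e₁ e₂ => e₁.eval m * e₂.eval m
  | .div e₁ e₂ => e₁.eval m / e₂.eval m

/-- The cost of evaluating an expression: every node costs one plus the binary length of its
value (addresses and operands are nodes themselves and are charged as such). -/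
def Expr.cost (m : Mem) : Expr → ℕ
  | .lit c => 1 + Nat.size c
  | .deref a => a.cost m + (1 + Nat.size (Expr.eval m (.deref a)))
  | .add e₁ e₂ => e₁.cost m + e₂.cost m + (1 + Nat.size (Expr.eval m (.add e₁ e₂)))
  | .sub e₁ e₂ => e₁.cost m + e₂.cost m + (1 + Nat.size (Expr.eval m (.sub e₁ e₂)))
  | .mul e₁ e₂ => e₁.cost m + e₂.cost m + (1 + Nat.size (Expr.eval m (.mul e₁ e₂)))
  | .div e₁ e₂ => e₁.cost m + e₂.cost m + (1 + Nat.size (Expr.eval m (.div e₁ e₂)))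

/-- Programs of a random access machine: `store a e` puts the value of `e` into the cell with
address `a`, `write e` appends the value of `e` to the output; a condition is true if its value is
not `0`. -/
inductive Prog : Type
  | skip
  | store (a e : Expr)
  | write (e : Expr)
  | seq (P Q : Prog)
  | ifelse (e : Expr) (P Q : Prog)
  | loop (e : Expr) (P : Prog)

/-- `Exec P m out t m'`: started on memory `m`, the program `P` halts with memory `m'` after having
written `out`, in time `t` (logarithmic cost: every command costs one plus the cost of the
expressions that it evaluates). -/
inductive Exec : Prog → Mem → List ℕ → ℕ → Mem → Prop
  | skip (m : Mem) : Exec .skip m [] 1 m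
  | store (a e : Expr) (m : Mem) :
      Exec (.store a e) m [] (1 + a.cost m + e.cost m) (Function.update m (a.eval m) (e.eval m))
  | write (e : Expr) (m : Mem) : Exec (.write e) m [e.eval m] (1 + e.cost m) m
  | seq {P Q : Prog} {m m₁ m₂ : Mem} {o₁ o₂ : List ℕ} {t₁ t₂ : ℕ} :
      Exec P m o₁ t₁ m₁ → Exec Q m₁ o₂ t₂ m₂ → Exec (.seq P Q) m (o₁ ++ o₂) (t₁ + t₂) m₂
  | ifTrue {e : Expr} {P Q : Prog} {m m₁ : Mem} {o : List ℕ} {t : ℕ} :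
      e.eval m ≠ 0 → Exec P m o t m₁ → Exec (.ifelse e P Q) m o (1 + e.cost m + t) m₁
  | ifFalse {e : Expr} {P Q : Prog} {m m₁ : Mem} {o : List ℕ} {t : ℕ} :
      e.eval m = 0 → Exec Q m o t m₁ → Exec (.ifelse e P Q) m o (1 + e.cost m + t) m₁
  | loopDone {e : Expr} {P : Prog} {m : Mem} :
      e.eval m = 0 → Exec (.loop e P) m [] (1 + e.cost m) m
  | loopStep {e : Expr} {P : Prog} {m m₁ m₂ : Mem} {o₁ o₂ : List ℕ} {t₁ t₂ : ℕ} :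
      e.eval m ≠ 0 → Exec P m o₁ t₁ m₁ → Exec (.loop e P) m₁ o₂ t₂ m₂ →
      Exec (.loop e P) m (o₁ ++ o₂) (1 + e.cost m + t₁ + t₂) m₂

/-- The initial memory: the inputs `p, n, r, d` are in the cells `0, 1, 2, 3`, all other cells
hold `0`. -/
def inputMem (p n r d : ℕ) : Mem := fun i =>
  if i = 0 then p else if i = 1 then n else if i = 2 then r else if i = 3 then d else 0

/-- The program halts on input `(p, n, r, d)` with output `out` in time `t`. -/
def RunsTo (P : Prog) (p n r d : ℕ) (out : List ℕ) (t : ℕ) : Prop :=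
  ∃ m, Exec P (inputMem p n r d) out t m

/-! ## Hitting sets and the bounds -/

/-- `H` hits all nonzero polynomials computed by homogeneous `n`-variate degree-`d` width-`r`
ABPs over the extension field `E` of `K`. -/
def Hits {K : Type*} [Field K] (E : Type*) [Field E] [Algebra K E] {n ℓ : ℕ} (r d : ℕ)
    (H : Set (Fin n → Matrix (Fin ℓ) (Fin ℓ) K)) : Prop :=
  ∀ A : HomABP E n r d, A.poly ≠ 0 →
    ∃ q ∈ H, FreeAlgebra.lift E (fun i => (q i).map (algebraMap K E)) A.poly ≠ 0

/-- `max(2, d log₂ n)`: this is `d log₂ n` as soon as `n, d ≥ 2`. -/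
noncomputable def degLog (n d : ℕ) : ℝ := max 2 (d * Real.logb 2 n)

/-- `max(2, n r d) ^ (C p log₂ (max(2, d log₂ n)))`. -/
noncomputable def quasiBound (C : ℝ) (p n r d : ℕ) : ℝ :=
  (max 2 ((n : ℝ) * r * d)) ^ (C * p * Real.logb 2 (degLog n d))

end HittingSet

namespace HittingSet

/-! An ABP computes the source–sink entry of $\prod_{j<d}\sum_i A_{j,i}x_i$. Send $x_i$ to a
diagonal matrix with entries $\beta_i(0),\dots,\beta_i(\ell-1)$ times the cyclic shift, where
$\ell>d$. The shift moves one step per letter, so the $(0,d)$ entry of the value is the source–sink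
entry of $\prod_j\sum_i\beta_i(j)A_{j,i}$ (`lift_poly_apply`). With $\beta_i(j)=u_j^i$ this is a
commutative read-once program in $u_0,\dots,u_{d-1}$, in which distinct words give distinct
monomials.

The variables $u_j$ are collapsed to a single parameter $t$ along a binary tree of height
$h=\lceil\log_2 d\rceil$: the left half receives $t^r$, the right half $t^r(1+t)$. At each node the
polynomial is $\sum_{k<r}f_k(x)g_k(y)$, with coefficient array of rank at most $r$. Its lowest
homogeneous part has at most $r$ terms, because the matching minor is triangular; a sum of $r$
monomials cannot vanish to order $r$ at $1$ in characteristic zero, so this part survives the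
substitution and the terms of higher degree cannot cancel it (`sum_comp_mul_comp_ne_zero`). The
resulting degree is at most $(n-1)(2r+1)^h$, hence fewer than $T=n(2r+1)^h$ integers $t$ need to be
excluded.

Diagonals in the cyclic algebra are not free: they are $b,\sigma b,\sigma^2b,\dots$ for one $b\in
K$. Take $b_i(v)=\sum_c\sum_j u_j^i\,v^{(k^j\bmod N)c}\,\omega^c$. At $v=\omega^{-1}$ orthogonality
of the powers of $\omega$ gives $\sigma^j b_i=N u_j^i$ for $j<d$, since the residues $k^j$ are
distinct. The value is a polynomial in $v$ of degree at most $dN^2$, nonzero at $\omega^{-1}$, hence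
nonzero at some integer $v\le dN^2$ (`exists_point_ne_zero`). These points have natural number
coefficients.

For the algebra, $N=p^{L+2}$ and $k=1+p^2$ has order $p^L$ modulo $N$, with $L$ least such that
$p^L>d$. The automorphism $\omega\mapsto\omega^k$, $z\mapsto z$ has order $p^L$, and $F$ is its
fixed field. Up to a denominator in $z$, a nonzero element is a twisted polynomial $\sum a_jx^j$
with $a_j\in\mathbb Q(\omega)$; after a power of $x$ is split off, setting $z=0$ makes its matrix
triangular with nonzero diagonal (`det_twisted_ne_zero`).

For $n=1$ the bound on $L$ does not involve the degree, so the points are built for degree $1$; the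
polynomial is $c\,x^d$, and the generator of the algebra is itself one of the points. The running
time follows from a Hoare-style calculus that counts commands and bounds the bit length of all
memory cells. -/

/-! ### Sparse polynomials and bivariate polynomials of bounded rank -/

open Polynomial in
/-- A nonzero polynomial with at most `r` terms over a field of characteristic zero does not vanish
to order `r` at `1`. -/
theorem not_X_sub_one_pow_dvd_of_card_support_le {E : Type*} [Field E] [CharZero E] :
    ∀ (r : ℕ) (c : E[X]), c ≠ 0 → c.support.card ≤ r → ¬ (X - 1) ^ r ∣ c := by
  intro r
  induction r with
  | zero =>
    intro c hc h
    simp at h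
    exact absurd h hc
  | succ r ih =>
    intro c hc hcard hdvd
    obtain ⟨a, ha⟩ : c.support.Nonempty := by simpa [Finset.nonempty_iff_ne_empty] using hc
    -- The operator $X\,\frac{d}{dX}-a$ scales $X^j$ by $j-a$: it removes exactly the term $X^a$ and
    -- lowers the order of vanishing at $1$ by at most one.
    set g : E[X] := X * derivative c - C (a : E) * c with hg
    have hcoeff : ∀ j, g.coeff j = ((j : E) - a) * c.coeff j := by
      intro j
      rw [hg, coeff_sub, coeff_C_mul]
      cases j with
      | zero => simp
      | succ j => rw [coeff_X_mul, coeff_derivative]; push_cast; ring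
    have hsupp : g.support = c.support.erase a := by
      ext j
      simp [hcoeff, sub_eq_zero]
    have hcard' : g.support.card ≤ r := by
      rw [hsupp, Finset.card_erase_of_mem ha]; omega
    have hdvd' : (X - 1) ^ r ∣ g := by
      obtain ⟨q, hq⟩ := hdvd
      refine dvd_sub (Dvd.dvd.mul_left ?_ _) (Dvd.dvd.mul_left ⟨(X - 1) * q, by rw [hq]; ring⟩ _)
      rw [hq, derivative_mul, derivative_pow]
      refine dvd_add ?_ ⟨(X - 1) * derivative q, by ring⟩
      simp only [Nat.add_sub_cancel]
      exact ⟨C ((r + 1 : ℕ) : E) * derivative (X - 1) * q, by ring⟩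
    by_cases hg0 : g = 0
    · have hsub : ∀ j, j ≠ a → c.coeff j = 0 := by
        intro j hj
        have := hcoeff j
        rw [hg0, coeff_zero, eq_comm, mul_eq_zero, sub_eq_zero] at this
        exact this.resolve_left fun h => hj (by exact_mod_cast h)
      have hmono : c = monomial a (c.coeff a) := by
        ext j
        by_cases hj : j = a
        · simp [hj]
        · rw [hsub j hj, coeff_monomial, if_neg (Ne.symm hj)]
      have h1 : (X - 1 : E[X]) ∣ c := (dvd_pow_self _ (Nat.succ_ne_zero r)).trans hdvd
      obtain ⟨q, hq⟩ := h1
      have : c.eval 1 = 0 := by rw [hq]; simp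
      rw [hmono, eval_monomial] at this
      simp at this
      exact (mem_support_iff.mp ha) this
    · exact ih g hg0 hcard' hdvd'

open Polynomial in
/-- If the coefficient array of a bivariate polynomial of rank at most `r` vanishes below
total degree `D`, then at most `r` coefficients of total degree `D` are nonzero. -/
theorem card_antidiagonal_le {E : Type*} [Field E] {r : ℕ} (f g : Fin r → ℕ → E) (D : ℕ)
    (hlow : ∀ i j, i + j < D → ∑ k, f k i * g k j = 0) (S : Finset ℕ)
    (hS : ∀ j ∈ S, j ≤ D ∧ ∑ k, f k (D - j) * g k j ≠ 0) : S.card ≤ r := by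
  classical
  -- Rows are indexed by the $x$-exponent $D-a$, columns by the $y$-exponent $b$. For $b<a$ the
  -- total degree is below $D$, so the minor is upper triangular with nonzero diagonal, yet it
  -- factors through dimension $r$.
  let M : Matrix S S E := Matrix.of fun a b => ∑ k, f k (D - a) * g k b
  have hfac : M = (Matrix.of fun (a : S) (k : Fin r) => f k (D - a)) *
      (Matrix.of fun (k : Fin r) (b : S) => g k b) := by
    ext a b; simp [M, Matrix.mul_apply]
  have htri : M.BlockTriangular id := by
    intro a b hab
    have h1 := (hS a a.2).1
    have h2 : (b : ℕ) < a := hab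
    exact hlow _ _ (by omega)
  have hdet : M.det ≠ 0 := by
    rw [Matrix.det_of_isUpperTriangular htri]
    exact Finset.prod_ne_zero_iff.mpr fun a _ => (hS a a.2).2
  have hrank : M.rank = Fintype.card S := Matrix.rank_of_isUnit M
    ((Matrix.isUnit_iff_isUnit_det M).mpr (isUnit_iff_ne_zero.mpr hdet))
  have hle : M.rank ≤ Fintype.card (Fin r) := by
    rw [hfac]
    exact (Matrix.rank_mul_le_left _ _).trans (Matrix.rank_le_card_width _)
  rw [hrank] at hle
  simpa using hle

open Polynomial in
/-- A bivariate polynomial `∑ k, f k (x) * g k (y)` with `r` summands, over a field of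
characteristic zero, does not vanish on the curve `(t ^ r, t ^ r * (1 + t))`. -/
theorem sum_comp_mul_comp_ne_zero {E : Type*} [Field E] [CharZero E] {r : ℕ} (f g : Fin r → E[X])
    (i₀ j₀ : ℕ) (h : ∑ k, (f k).coeff i₀ * (g k).coeff j₀ ≠ 0) :
    ∑ k, (f k).comp (X ^ r) * (g k).comp (X ^ r * (1 + X)) ≠ 0 := by
  classical
  set c : ℕ → ℕ → E := fun i j => ∑ k, (f k).coeff i * (g k).coeff j with hc
  have hex : ∃ D, ∃ i j, i + j = D ∧ c i j ≠ 0 := ⟨_, i₀, j₀, rfl, h⟩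
  set D := Nat.find hex with hD
  obtain ⟨i₁, j₁, hij, hne⟩ := Nat.find_spec hex
  have hlow : ∀ i j, i + j < D → c i j = 0 := by
    intro i j hlt
    by_contra hcon
    exact Nat.find_min hex hlt ⟨i, j, rfl, hcon⟩
  -- The lowest homogeneous part, dehomogenized at $x=1$; under the substitution it becomes
  -- $t^{rD}q(1+t)$.
  set q : E[X] := ∑ j ∈ Finset.range (D + 1), C (c (D - j) j) * X ^ j with hq
  have hqc : ∀ j, q.coeff j = if j ≤ D then c (D - j) j else 0 := by
    intro j
    rw [hq, finsetSum_coeff]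
    simp [coeff_X_pow]
  have hq0 : q ≠ 0 := by
    intro h0
    have h1 := hqc j₁
    rw [h0, coeff_zero, if_pos (by omega), show D - j₁ = i₁ by omega] at h1
    exact hne h1.symm
  have hqcard : q.support.card ≤ r := by
    refine card_antidiagonal_le (fun k => (f k).coeff) (fun k => (g k).coeff) D hlow _ ?_
    intro j hj
    have := mem_support_iff.mp hj
    rw [hqc] at this
    by_cases hjD : j ≤ D
    · rw [if_pos hjD] at this; exact ⟨hjD, this⟩
    · rw [if_neg hjD] at this; exact absurd rfl this
  set B := D + 1 + ∑ k, ((f k).natDegree + (g k).natDegree + 1) with hB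
  have hdeg : ∀ k, (f k).natDegree < B ∧ (g k).natDegree < B := by
    intro k
    have := Finset.single_le_sum (f := fun k => (f k).natDegree + (g k).natDegree + 1)
      (fun _ _ => Nat.zero_le _) (Finset.mem_univ k)
    omega
  have hexp : ∑ k, (f k).comp (X ^ r) * (g k).comp (X ^ r * (1 + X)) =
      ∑ j ∈ Finset.range B, ∑ i ∈ Finset.range B,
        C (c i j) * ((X : E[X]) ^ (r * (i + j)) * (1 + X) ^ j) := by
    have hk : ∀ k, (f k).comp (X ^ r) * (g k).comp (X ^ r * (1 + X)) =
        ∑ j ∈ Finset.range B, ∑ i ∈ Finset.range B,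
          C ((f k).coeff i * (g k).coeff j) * ((X : E[X]) ^ (r * (i + j)) * (1 + X) ^ j) := by
      intro k
      rw [comp, comp, eval₂_eq_sum_range' C (hdeg k).1, eval₂_eq_sum_range' C (hdeg k).2,
        Finset.sum_mul_sum, Finset.sum_comm]
      refine Finset.sum_congr rfl fun j _ => Finset.sum_congr rfl fun i _ => ?_
      rw [C_mul, mul_pow, ← pow_mul, ← pow_mul, mul_add, pow_add]; ring
    simp_rw [hk]
    rw [Finset.sum_comm]
    refine Finset.sum_congr rfl fun j _ => ?_
    rw [Finset.sum_comm]
    refine Finset.sum_congr rfl fun i _ => ?_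
    rw [← Finset.sum_mul, hc, map_sum]
  -- A monomial of total degree $e$ becomes divisible by $t^{re}$, so degrees above $D$ only
  -- contribute from order $r(D+1)$ on.
  have hdiv : (X : E[X]) ^ (r * (D + 1)) ∣
      (∑ k, (f k).comp (X ^ r) * (g k).comp (X ^ r * (1 + X))) - X ^ (r * D) * q.comp (1 + X) := by
    have hqx : X ^ (r * D) * q.comp (1 + X) = ∑ j ∈ Finset.range B,
        if j ≤ D then C (c (D - j) j) * ((X : E[X]) ^ (r * D) * (1 + X) ^ j) else 0 := by
      have hqB : q.natDegree < B := by
        have : q.natDegree ≤ D := by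
          rw [natDegree_le_iff_coeff_eq_zero]
          intro j hj
          rw [hqc, if_neg (by omega)]
        omega
      rw [comp, eval₂_eq_sum_range' C hqB, Finset.mul_sum]
      refine Finset.sum_congr rfl fun j _ => ?_
      rw [hqc]
      split_ifs
      · ring
      · simp
    rw [hexp, hqx, ← Finset.sum_sub_distrib]
    refine Finset.dvd_sum fun j _ => ?_
    by_cases hjD : j ≤ D
    · rw [if_pos hjD, ← Finset.add_sum_erase _ _ (Finset.mem_range.mpr (by omega : D - j < B)),
        show D - j + j = D by omega, add_sub_cancel_left]
      refine Finset.dvd_sum fun i hi => ?_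
      have hne' : i ≠ D - j := Finset.ne_of_mem_erase hi
      rcases lt_or_ge (i + j) D with hlt | hge
      · rw [hlow i j hlt]; simp
      · exact Dvd.dvd.mul_left (Dvd.dvd.mul_right
          (pow_dvd_pow _ (Nat.mul_le_mul_left r (by omega))) _) _
    · rw [if_neg hjD, sub_zero]
      refine Finset.dvd_sum fun i _ => ?_
      exact Dvd.dvd.mul_left (Dvd.dvd.mul_right
          (pow_dvd_pow _ (Nat.mul_le_mul_left r (by omega))) _) _
  intro hzero
  rw [hzero, zero_sub, dvd_neg, mul_add, pow_add, mul_one,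
    mul_dvd_mul_iff_left (pow_ne_zero _ X_ne_zero)] at hdiv
  obtain ⟨s, hs⟩ := hdiv
  -- After cancelling $t^{rD}$, vanishing would mean $t^r\mid q(1+t)$; translating by $-1$ turns
  -- this into $(X-1)^r\mid q$.
  refine not_X_sub_one_pow_dvd_of_card_support_le r q hq0 hqcard ⟨s.comp (X - 1), ?_⟩
  have := congrArg (fun p => p.comp (X - 1)) hs
  simpa [comp_assoc] using this

/-! ## Read-once products along a binary tree -/

section Tree

open Polynomial

variable {E : Type*} [Field E] {n r : ℕ}

/-- The product of the coefficient matrices along the word `w`, over the positions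
`off, …, off + 2 ^ h - 1`. -/
def wordMat (A : ℕ → Fin n → Matrix (Fin r) (Fin r) E) (w : ℕ → Fin n) :
    ℕ → ℕ → Matrix (Fin r) (Fin r) E
  | 0, off => A off (w off)
  | h + 1, off => wordMat A w h off * wordMat A w h (off + 2 ^ h)

/-- The univariate matrix obtained from the read-once product by the recursive substitution
`(t ^ r, t ^ r * (1 + t))` for the two halves. -/
noncomputable def treeMat (A : ℕ → Fin n → Matrix (Fin r) (Fin r) E) :
    ℕ → ℕ → Matrix (Fin r) (Fin r) E[X]
  | 0, off => Matrix.of fun a b => ∑ i, C (A off i a b) * X ^ (i : ℕ)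
  | h + 1, off => (treeMat A h off).map (compRingHom (X ^ r)) *
      (treeMat A h (off + 2 ^ h)).map (compRingHom (X ^ r * (1 + X)))

/-- The bilinear form `u M v`. -/
noncomputable def treeForm (u v : Fin r → E) (M : Matrix (Fin r) (Fin r) E[X]) : E[X] :=
  (fun a => C (u a)) ⬝ᵥ M.mulVec fun b => C (v b)

theorem exists_eval_ne_zero [CharZero E] {p : E[X]} (hp : p ≠ 0) : ∃ t, p.eval t ≠ 0 := by
  by_contra! h
  exact hp (funext fun t => by simpa using h t)

theorem treeForm_eval (u v : Fin r → E) (M : Matrix (Fin r) (Fin r) E[X]) (t : E) :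
    (treeForm u v M).eval t = u ⬝ᵥ (M.map (eval t)).mulVec v := by
  simp [treeForm, eval_finsetSum, dotProduct, Matrix.mulVec]

/-- One nonvanishing coefficient is enough to survive all substitutions. Arbitrary boundary vectors
`u`, `v` make the induction work: each half is treated with the other half, as a word matrix or an
evaluated tree, absorbed into a boundary vector. -/
theorem treeForm_ne_zero [CharZero E] (A : ℕ → Fin n → Matrix (Fin r) (Fin r) E) (w : ℕ → Fin n) :
    ∀ (h off : ℕ) (u v : Fin r → E), u ⬝ᵥ (wordMat A w h off).mulVec v ≠ 0 →
      treeForm u v (treeMat A h off) ≠ 0 := by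
  intro h
  induction h with
  | zero =>
    intro off u v hw h0
    apply hw
    have h1 := congrArg (fun p => p.coeff (w off : ℕ)) h0
    simp only [treeForm, dotProduct, Matrix.mulVec, treeMat, Matrix.of_apply, finsetSum_coeff,
      coeff_zero, coeff_mul_C, coeff_C_mul, coeff_X_pow] at h1
    simpa [dotProduct, Matrix.mulVec, wordMat, Fin.val_inj] using h1
  | succ h ih =>
    intro off u v hw
    simp only [wordMat, ← Matrix.mulVec_mulVec] at hw
    -- The left half is handled with right vector $W_2v$, where $W_2$ is the word matrix of the
    -- right half. Evaluation at $t_1$ then yields the left vector for the right half, so the two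
    -- halves in independent variables give a nonzero bivariate polynomial.
    obtain ⟨t₁, ht₁⟩ := exists_eval_ne_zero (ih _ _ _ hw)
    rw [treeForm_eval, Matrix.dotProduct_mulVec] at ht₁
    obtain ⟨t₂, ht₂⟩ := exists_eval_ne_zero (ih _ _ _ ht₁)
    rw [treeForm_eval] at ht₂
    set f : Fin r → E[X] := Matrix.vecMul (fun a => C (u a)) (treeMat A h off) with hf
    set g : Fin r → E[X] := (treeMat A h (off + 2 ^ h)).mulVec (fun b => C (v b)) with hg
    have hne : ∑ k, (f k).eval t₁ * (g k).eval t₂ ≠ 0 := by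
      convert ht₂ using 1
      simp [f, g, eval_finsetSum, dotProduct, Matrix.mulVec, Matrix.vecMul]
    have hcoef : ∃ i j, ∑ k, (f k).coeff i * (g k).coeff j ≠ 0 := by
      by_contra! hall
      apply hne
      set B := 1 + ∑ k, ((f k).natDegree + (g k).natDegree + 1) with hB
      have hdeg : ∀ k, (f k).natDegree < B ∧ (g k).natDegree < B := by
        intro k
        have := Finset.single_le_sum (f := fun k => (f k).natDegree + (g k).natDegree + 1)
          (fun _ _ => Nat.zero_le _) (Finset.mem_univ k)
        omega
      have : ∀ k, (f k).eval t₁ * (g k).eval t₂ = ∑ i ∈ Finset.range B, ∑ j ∈ Finset.range B,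
          (f k).coeff i * (g k).coeff j * (t₁ ^ i * t₂ ^ j) := by
        intro k
        rw [eval_eq_sum_range' (hdeg k).1, eval_eq_sum_range' (hdeg k).2, Finset.sum_mul_sum]
        exact Finset.sum_congr rfl fun i _ => Finset.sum_congr rfl fun j _ => by ring
      simp_rw [this]
      rw [Finset.sum_comm]
      refine Finset.sum_eq_zero fun i _ => ?_
      rw [Finset.sum_comm]
      refine Finset.sum_eq_zero fun j _ => ?_
      rw [← Finset.sum_mul, hall, zero_mul]
    obtain ⟨i, j, hij⟩ := hcoef
    have := sum_comp_mul_comp_ne_zero f g i j hij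
    convert this using 1
    rw [treeForm, treeMat, ← Matrix.mulVec_mulVec, Matrix.dotProduct_mulVec, dotProduct]
    refine Finset.sum_congr rfl fun k _ => ?_
    rw [← coe_compRingHom_apply, ← coe_compRingHom_apply, hf, hg, RingHom.map_vecMul,
      RingHom.map_mulVec]
    simp [Function.comp_def]

/-- Each level multiplies the degree by $\deg t^r+\deg t^r(1+t)=2r+1$. -/
theorem natDegree_treeMat_le (A : ℕ → Fin n → Matrix (Fin r) (Fin r) E) :
    ∀ (h off : ℕ) (a b : Fin r), (treeMat A h off a b).natDegree ≤ (n - 1) * (2 * r + 1) ^ h := by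
  intro h
  induction h with
  | zero =>
    intro off a b
    simp only [treeMat, Matrix.of_apply, pow_zero, mul_one]
    refine natDegree_sum_le_of_forall_le _ _ fun i _ => ?_
    exact (natDegree_C_mul_X_pow_le _ _).trans (by omega)
  | succ h ih =>
    intro off a b
    simp only [treeMat, Matrix.mul_apply, Matrix.map_apply, coe_compRingHom]
    refine natDegree_sum_le_of_forall_le _ _ fun k _ => ?_
    refine natDegree_mul_le.trans ?_
    rw [natDegree_comp, natDegree_comp, natDegree_X_pow]
    have h1 : (X ^ r * (1 + X) : E[X]).natDegree ≤ r + 1 := by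
      refine natDegree_mul_le.trans ?_
      rw [natDegree_X_pow]
      gcongr
      rw [add_comm]
      exact natDegree_X_add_C (1 : E) |>.le
    calc _ ≤ (n - 1) * (2 * r + 1) ^ h * r + (n - 1) * (2 * r + 1) ^ h * (r + 1) :=
          add_le_add (Nat.mul_le_mul_right _ (ih _ _ _)) (Nat.mul_le_mul (ih _ _ _) h1)
      _ = _ := by ring

/-- The value of the `j`-th of `2 ^ h` variables under the recursive substitution. -/
def leaf (r : ℕ) : ℕ → ℕ → ℕ → ℕ
  | 0, _, t => t
  | h + 1, j, t => leaf r h (j % 2 ^ h) (t ^ r * (1 + j / 2 ^ h * t))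

/-- Evaluation runs top-down while `treeMat` is built bottom-up: the leading binary digit of $j$
decides whether $t$ is replaced by $t^r$ or by $t^r(1+t)$ before descending, which is the recursion
of `leaf`. -/
theorem eval_treeMat (A : ℕ → Fin n → Matrix (Fin r) (Fin r) E) :
    ∀ (h off t : ℕ), (treeMat A h off).map (eval (t : E)) =
      ((List.range (2 ^ h)).map fun j => 
        ∑ i : Fin n, ((leaf r h j t : ℕ) : E) ^ (i : ℕ) • A (off + j) i).prod := by
  intro h
  induction h with
  | zero =>
    intro off t
    ext a b
    simp only [treeMat, Matrix.map_apply, Matrix.of_apply, eval_finsetSum]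
    simp only [pow_zero, List.range_one, List.map_cons, List.map_nil, List.prod_singleton, leaf,
      add_zero, Matrix.sum_apply, Matrix.smul_apply, smul_eq_mul, eval_mul, eval_C, eval_pow, eval_X]
    exact Finset.sum_congr rfl fun i _ => mul_comm _ _
  | succ h ih =>
    intro off t
    have h1 : ∀ (M : Matrix (Fin r) (Fin r) E[X]) (p : E[X]),
        (M.map (compRingHom p)).map (eval (t : E)) = M.map (eval (p.eval (t : E))) := by
      intro M p; ext a b; simp
    have hmul : ∀ M M' : Matrix (Fin r) (Fin r) E[X],
        (M * M').map (eval (t : E)) = M.map (eval (t : E)) * M'.map (eval (t : E)) :=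
      fun M M' => Matrix.map_mul (f := evalRingHom (t : E))
    rw [treeMat, hmul, h1, h1, pow_succ, mul_two, List.range_add, List.map_append, List.prod_append]
    congr 1
    · have : eval (t : E) (X ^ r) = ((t ^ r : ℕ) : E) := by simp
      rw [this, ih]
      congr 1
      refine List.map_congr_left fun j hj => ?_
      have hj := List.mem_range.mp hj
      simp [leaf, Nat.div_eq_of_lt hj, Nat.mod_eq_of_lt hj]
    · have : eval (t : E) (X ^ r * (1 + X)) = ((t ^ r * (1 + t) : ℕ) : E) := by simp
      rw [this, ih, List.map_map]
      congr 1
      refine List.map_congr_left fun j hj => ?_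
      have hj := List.mem_range.mp hj
      simp [leaf, Nat.div_eq_of_lt hj, Nat.mod_eq_of_lt hj, add_assoc]

end Tree

/-! ### The generator of a cyclic algebra and twisted polynomials in it -/

section Shift

/-- The matrix of the generator of a cyclic algebra, over an arbitrary semiring. -/
def shiftMat {R : Type*} [CommSemiring R] (ℓ : ℕ) (z : R) : Matrix (Fin ℓ) (Fin ℓ) R :=
  Matrix.of fun i j =>
    if (j : ℕ) = i + 1 then 1 else if (i : ℕ) + 1 = ℓ ∧ (j : ℕ) = 0 then z else 0

theorem shiftMat_pow_apply {R : Type*} [CommSemiring R] {ℓ : ℕ} (z : R) :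
    ∀ j ≤ ℓ, ∀ a b : Fin ℓ, (shiftMat ℓ z ^ j) a b =
      if (b : ℕ) = a + j then 1 else if (b : ℕ) + ℓ = a + j then z else 0 := by
  intro j
  induction j with
  | zero =>
    intro _ a b
    have h2 := a.2
    rw [pow_zero, Matrix.one_apply]
    by_cases h : a = b
    · simp [h]
    · have h' : (b : ℕ) ≠ a := fun hb => h (Fin.ext hb.symm)
      rw [if_neg h, if_neg (by omega), if_neg (by omega)]
  | succ j ih =>
    intro hj a b
    have ha := a.2
    have hb := b.2
    rw [pow_succ', Matrix.mul_apply]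
    by_cases h : (a : ℕ) + 1 < ℓ
    · rw [Finset.sum_eq_single ⟨a + 1, h⟩]
      · rw [ih (by omega)]
        simp only [shiftMat, Matrix.of_apply, if_true, one_mul]
        congr 1
        · exact propext ⟨fun h => by omega, fun h => by omega⟩
        · congr 1
          exact propext ⟨fun h => by omega, fun h => by omega⟩
      · intro c _ hc
        have hc' : (c : ℕ) ≠ a + 1 := fun h => hc (Fin.ext h)
        simp only [shiftMat, Matrix.of_apply]
        rw [if_neg hc', if_neg (by omega), zero_mul]
      · simp
    · rw [Finset.sum_eq_single ⟨0, by omega⟩]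
      · rw [ih (by omega)]
        simp only [shiftMat, Matrix.of_apply]
        rw [if_neg (by omega), if_pos ⟨by omega, trivial⟩]
        by_cases hbj : (b : ℕ) = j
        · rw [if_pos (by omega), if_neg (by omega), if_pos (by omega), mul_one]
        · rw [if_neg (by omega), if_neg (by omega), if_neg (by omega), if_neg (by omega), mul_zero]
      · intro c _ hc
        have hc' : (c : ℕ) ≠ 0 := fun h => hc (Fin.ext h)
        have := c.2
        simp only [shiftMat, Matrix.of_apply]
        rw [if_neg (by omega), if_neg (by omega), zero_mul]
      · simp

theorem shiftMat_pow_self {R : Type*} [CommSemiring R] (ℓ : ℕ) (z : R) :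
    shiftMat ℓ z ^ ℓ = z • (1 : Matrix (Fin ℓ) (Fin ℓ) R) := by
  ext a b
  have := b.2
  rw [shiftMat_pow_apply z ℓ le_rfl, Matrix.smul_apply, Matrix.one_apply, if_neg (by omega)]
  by_cases h : a = b
  · simp [h]
  · have h' : (b : ℕ) ≠ a := fun hb => h (Fin.ext hb.symm)
    rw [if_neg (by omega), if_neg h]; simp

theorem shiftMat_map {R S : Type*} [CommSemiring R] [CommSemiring S] (f : R →+* S) (ℓ : ℕ) (z : R) :
    (shiftMat ℓ z).map f = shiftMat ℓ (f z) := by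
  ext a b
  simp only [shiftMat, Matrix.map_apply, Matrix.of_apply]
  split_ifs <;> simp

theorem shiftMat_zero_pow_apply {R : Type*} [CommSemiring R] {ℓ : ℕ} (j : ℕ) (a b : Fin ℓ) :
    (shiftMat ℓ (0 : R) ^ j) a b = if (b : ℕ) = a + j then 1 else 0 := by
  have hb := b.2
  rcases le_or_gt j ℓ with h | h
  · rw [shiftMat_pow_apply 0 j h]; simp
  · rw [← Nat.sub_add_cancel h.le, pow_add, shiftMat_pow_self, if_neg (by omega)]
    simp

open Polynomial in
/-- A nonzero twisted polynomial `∑ a j * x ^ j` in the generator of a cyclic algebra with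
parameter an indeterminate is an invertible matrix. -/
theorem det_twisted_ne_zero {k : Type*} [Field k] (τ : k ≃+* k) (ℓ : ℕ) :
    ∀ (J : ℕ) (a : ℕ → k), (∃ j < J, a j ≠ 0) →
      (∑ j ∈ Finset.range J, Matrix.diagonal (fun i : Fin ℓ => C ((τ ^ (i : ℕ)) (a j))) *
        shiftMat ℓ (X : k[X]) ^ j).det ≠ 0 := by
  intro J
  induction J with
  | zero => intro a h; simp at h
  | succ J ih =>
    intro a h
    -- A vanishing constant term lets one factor $x$ split off on the right; $x$ has nonzero
    -- determinant because $x^\ell=z$.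
    by_cases h0 : a 0 = 0
    · rw [Finset.sum_range_succ', h0]
      simp only [map_zero, Matrix.diagonal_zero, zero_mul, add_zero]
      have : ∀ j, Matrix.diagonal (fun i : Fin ℓ => C ((τ ^ (i : ℕ)) (a (j + 1)))) *
          shiftMat ℓ (X : k[X]) ^ (j + 1) =
          Matrix.diagonal (fun i : Fin ℓ => C ((τ ^ (i : ℕ)) (a (j + 1)))) *
          shiftMat ℓ (X : k[X]) ^ j * shiftMat ℓ (X : k[X]) := fun j => by
        rw [pow_succ, mul_assoc]
      simp_rw [this]
      rw [← Finset.sum_mul, Matrix.det_mul]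
      refine mul_ne_zero (ih (fun j => a (j + 1)) ?_) ?_
      · obtain ⟨j, hj, hne⟩ := h
        cases j with
        | zero => exact absurd h0 hne
        | succ j => exact ⟨j, by omega, hne⟩
      · intro hd
        have h1 := congrArg Matrix.det (shiftMat_pow_self ℓ (X : k[X]))
        rw [Matrix.det_pow, hd, Matrix.det_smul, Matrix.det_one, mul_one, Fintype.card_fin] at h1
        rcases Nat.eq_zero_or_pos ℓ with rfl | hpos
        · simp at hd
        · rw [zero_pow hpos.ne'] at h1
          exact pow_ne_zero ℓ X_ne_zero h1.symm
    · intro hd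
      -- At $z=0$ the shift loses its corner entry and becomes strictly upper triangular, so only
      -- the constant term $a_0$ contributes to the diagonal, with entries $\tau^i(a_0)\ne0$.
      have h1 := congrArg (evalRingHom (0 : k)) hd
      rw [map_zero, RingHom.map_det] at h1
      have hentry : ∀ x y : Fin ℓ, ((evalRingHom (0 : k)).mapMatrix
          (∑ j ∈ Finset.range (J + 1), Matrix.diagonal (fun i : Fin ℓ => C ((τ ^ (i : ℕ)) (a j))) *
            shiftMat ℓ (X : k[X]) ^ j)) x y =
          ∑ j ∈ Finset.range (J + 1), (τ ^ (x : ℕ)) (a j) * if (y : ℕ) = x + j then 1 else 0 := by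
        intro x y
        rw [map_sum, Matrix.sum_apply]
        refine Finset.sum_congr rfl fun j _ => ?_
        rw [map_mul, map_pow, RingHom.mapMatrix_apply, RingHom.mapMatrix_apply, shiftMat_map,
          Matrix.diagonal_map (map_zero _), Matrix.diagonal_mul]
        simp only [coe_evalRingHom, eval_X, eval_C]
        rw [shiftMat_zero_pow_apply]
      rw [Matrix.det_of_isUpperTriangular] at h1
      · obtain ⟨x, -, hx⟩ := Finset.prod_eq_zero_iff.mp h1
        rw [hentry, Finset.sum_eq_single 0] at hx
        · rw [if_pos (by omega), mul_one] at hx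
          exact h0 ((map_eq_zero_iff _ (τ ^ (x : ℕ)).injective).mp hx)
        · intro j _ hj; rw [if_neg (by omega), mul_zero]
        · simp
      · intro x y hxy
        have hxy' : (y : ℕ) < x := hxy
        rw [hentry]
        refine Finset.sum_eq_zero fun j _ => ?_
        rw [if_neg (by omega), mul_zero]

end Shift

/-! ### Relations in the matrix model of a cyclic algebra -/

section Cyclic

theorem cyclicShift_eq {K : Type*} [Field K] (ℓ : ℕ) (a : K) : cyclicShift ℓ a = shiftMat ℓ a := rfl

variable {F K : Type*} [Field F] [Field K] [Algebra F K]

theorem cyclicDiag_mul (ℓ : ℕ) (σ : K ≃ₐ[F] K) (b c : K) :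
    cyclicDiag ℓ σ (b * c) = cyclicDiag ℓ σ b * cyclicDiag ℓ σ c := by
  simp [cyclicDiag, Matrix.diagonal_mul_diagonal]

theorem cyclicDiag_add (ℓ : ℕ) (σ : K ≃ₐ[F] K) (b c : K) :
    cyclicDiag ℓ σ (b + c) = cyclicDiag ℓ σ b + cyclicDiag ℓ σ c := by
  simp [cyclicDiag]

theorem cyclicDiag_zero (ℓ : ℕ) (σ : K ≃ₐ[F] K) : cyclicDiag ℓ σ 0 = 0 := by
  simp only [cyclicDiag, map_zero, Matrix.diagonal_zero]

theorem cyclicDiag_algebraMap (ℓ : ℕ) (σ : K ≃ₐ[F] K) (a : F) :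
    cyclicDiag ℓ σ (algebraMap F K a) = algebraMap F (Matrix (Fin ℓ) (Fin ℓ) K) a := by
  rw [Matrix.algebraMap_eq_diagonal, cyclicDiag]
  congr 1
  ext i
  exact (σ ^ (i : ℕ)).commutes a

theorem shift_mul_cyclicDiag {ℓ : ℕ} {σ : K ≃ₐ[F] K} (hσ : σ ^ ℓ = 1) (a b : K) :
    shiftMat ℓ a * cyclicDiag ℓ σ b = cyclicDiag ℓ σ (σ b) * shiftMat ℓ a := by
  ext i j
  rw [cyclicDiag, cyclicDiag, Matrix.mul_diagonal, Matrix.diagonal_mul]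
  have h1 : (σ ^ (i : ℕ)) (σ b) = (σ ^ ((i : ℕ) + 1)) b := by rw [pow_succ]; rfl
  rw [h1]
  simp only [shiftMat, Matrix.of_apply]
  split_ifs with h h'
  · rw [h, mul_comm]
  · rw [h'.1, h'.2, hσ]; simp [mul_comm]
  · simp

/-- The inverse matrix lies in the subalgebra itself: left multiplication by `u` is injective on a
finite-dimensional space, hence hits `1`. -/
theorem exists_inverse_of_det_ne_zero [FiniteDimensional F K] {ℓ : ℕ}
    (D : Subalgebra F (Matrix (Fin ℓ) (Fin ℓ) K)) {u : Matrix (Fin ℓ) (Fin ℓ) K} (hu : u ∈ D)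
    (hdet : u.det ≠ 0) : ∃ v ∈ D, u * v = 1 ∧ v * u = 1 := by
  have hunit : IsUnit u := (Matrix.isUnit_iff_isUnit_det u).mpr (isUnit_iff_ne_zero.mpr hdet)
  have hinj : Function.Injective (LinearMap.mulLeft F (⟨u, hu⟩ : D)) := by
    intro x y hxy
    have := congrArg Subtype.val hxy
    simp only [LinearMap.mulLeft_apply, MulMemClass.coe_mul] at this
    exact Subtype.ext (hunit.mul_left_cancel this)
  obtain ⟨v, hv⟩ := LinearMap.injective_iff_surjective.mp hinj 1
  have h1 : u * v = 1 := congrArg Subtype.val hv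
  exact ⟨v, v.2, h1, mul_eq_one_comm.mp h1⟩

end Cyclic

/-! ### Invertibility in the cyclic algebra with parameter an indeterminate -/

section Division

variable {k : Type*} [Field k] {F : Type*} [Field F] [Algebra F (RatFunc k)]

/-- The additive monoid of all sums `∑ a j * x ^ j` with `a j ∈ k` in a cyclic algebra over
`k(z)`. -/
noncomputable def twisted (ℓ : ℕ) (σ : RatFunc k ≃ₐ[F] RatFunc k) :
    AddSubmonoid (Matrix (Fin ℓ) (Fin ℓ) (RatFunc k)) :=
  AddSubmonoid.closure {u | ∃ (a : k) (j : ℕ),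
    u = cyclicDiag ℓ σ (RatFunc.C a) * shiftMat ℓ (RatFunc.X : RatFunc k) ^ j}

theorem exists_sum_of_mem_twisted {ℓ : ℕ} {σ : RatFunc k ≃ₐ[F] RatFunc k}
    {u : Matrix (Fin ℓ) (Fin ℓ) (RatFunc k)} (hu : u ∈ twisted ℓ σ) :
    ∃ (J : ℕ) (a : ℕ → k), (∀ j, J ≤ j → a j = 0) ∧ u = ∑ j ∈ Finset.range J,
      cyclicDiag ℓ σ (RatFunc.C (a j)) * shiftMat ℓ (RatFunc.X : RatFunc k) ^ j := by
  induction hu using AddSubmonoid.closure_induction with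
  | mem u hu =>
    obtain ⟨a, j, rfl⟩ := hu
    refine ⟨j + 1, fun i => if i = j then a else 0, fun i hi => if_neg (by omega), ?_⟩
    rw [Finset.sum_eq_single j]
    · simp only [if_true]
    · intro i _ hij
      simp only [if_neg hij]
      rw [map_zero, cyclicDiag_zero, zero_mul]
    · simp
  | zero => exact ⟨0, fun _ => 0, fun _ _ => rfl, by simp⟩
  | add u v _ _ hu hv =>
    obtain ⟨J, a, ha, rfl⟩ := hu
    obtain ⟨J', a', ha', rfl⟩ := hv
    have hext : ∀ (J J' : ℕ) (a : ℕ → k), (∀ j, J ≤ j → a j = 0) → J ≤ J' →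
        ∑ j ∈ Finset.range J,
          cyclicDiag ℓ σ (RatFunc.C (a j)) * shiftMat ℓ (RatFunc.X : RatFunc k) ^ j =
        ∑ j ∈ Finset.range J',
          cyclicDiag ℓ σ (RatFunc.C (a j)) * shiftMat ℓ (RatFunc.X : RatFunc k) ^ j := by
      intro J J' a ha hJ
      refine Finset.sum_subset (Finset.range_mono hJ) fun j _ hj => ?_
      rw [ha j (by simpa using hj), map_zero, cyclicDiag_zero, zero_mul]
    refine ⟨max J J', fun j => a j + a' j, fun j hj => ?_, ?_⟩
    · simp only
      rw [ha j (le_trans (le_max_left _ _) hj), ha' j (le_trans (le_max_right _ _) hj), add_zero]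
    · rw [hext J (max J J') a ha (le_max_left _ _), hext J' (max J J') a' ha' (le_max_right _ _),
        ← Finset.sum_add_distrib]
      refine Finset.sum_congr rfl fun j _ => ?_
      rw [map_add, cyclicDiag_add, add_mul]

theorem det_ne_zero_of_mem_twisted {ℓ : ℕ} {σ : RatFunc k ≃ₐ[F] RatFunc k} {τ : k ≃+* k}
    (hC : ∀ a, σ (RatFunc.C a) = RatFunc.C (τ a))
    {u : Matrix (Fin ℓ) (Fin ℓ) (RatFunc k)} (hu : u ∈ twisted ℓ σ) (hne : u ≠ 0) : u.det ≠ 0 := by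
  obtain ⟨J, a, -, rfl⟩ := exists_sum_of_mem_twisted hu
  have hex : ∃ j < J, a j ≠ 0 := by
    by_contra! h
    apply hne
    refine Finset.sum_eq_zero fun j hj => ?_
    rw [h j (Finset.mem_range.mp hj), map_zero, cyclicDiag_zero, zero_mul]
  have hpow : ∀ (i : ℕ) (a : k), (σ ^ i) (RatFunc.C a) = RatFunc.C ((τ ^ i) a) := by
    intro i
    induction i with
    | zero => intro a; rfl
    | succ i ih =>
      intro a
      rw [pow_succ, pow_succ, AlgEquiv.mul_apply, hC, ih]; rfl
  have hmap : (∑ j ∈ Finset.range J,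
      cyclicDiag ℓ σ (RatFunc.C (a j)) * shiftMat ℓ (RatFunc.X : RatFunc k) ^ j) =
      (algebraMap (Polynomial k) (RatFunc k)).mapMatrix (∑ j ∈ Finset.range J,
        Matrix.diagonal (fun i : Fin ℓ => Polynomial.C ((τ ^ (i : ℕ)) (a j))) *
        shiftMat ℓ (Polynomial.X : Polynomial k) ^ j) := by
    rw [map_sum]
    refine Finset.sum_congr rfl fun j _ => ?_
    rw [map_mul, map_pow, RingHom.mapMatrix_apply, RingHom.mapMatrix_apply, shiftMat_map,
      Matrix.diagonal_map (map_zero _), RatFunc.algebraMap_X, cyclicDiag]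
    simp only [hpow, RatFunc.algebraMap_C]
  rw [hmap, ← RingHom.map_det]
  exact fun h => det_twisted_ne_zero τ ℓ J a hex
    ((map_eq_zero_iff _ (IsFractionRing.injective (Polynomial k) (RatFunc k))).mp h)

/-- Since $z=x^\ell$ in the algebra, multiplying by a polynomial in $z$ only changes the constants
and raises powers of $x$ by multiples of $\ell$. -/
theorem cyclicDiag_algebraMap_mul_mem_twisted {ℓ : ℕ} {σ : RatFunc k ≃ₐ[F] RatFunc k}
    (hX : σ RatFunc.X = RatFunc.X) (p : Polynomial k)
    {u : Matrix (Fin ℓ) (Fin ℓ) (RatFunc k)} (hu : u ∈ twisted ℓ σ) :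
    cyclicDiag ℓ σ (algebraMap _ _ p) * u ∈ twisted ℓ σ := by
  have hXp : ∀ i : ℕ, (σ ^ i) (RatFunc.X : RatFunc k) = RatFunc.X := by
    intro i
    induction i with
    | zero => rfl
    | succ i ih => rw [pow_succ, AlgEquiv.mul_apply, hX, ih]
  have hdX : ∀ i : ℕ, cyclicDiag ℓ σ ((RatFunc.X : RatFunc k) ^ i) =
      shiftMat ℓ (RatFunc.X : RatFunc k) ^ (ℓ * i) := by
    intro i
    rw [pow_mul, shiftMat_pow_self, smul_pow, one_pow, cyclicDiag]
    simp only [map_pow, hXp]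
    rw [← Matrix.smul_one_eq_diagonal]
  induction hu using AddSubmonoid.closure_induction with
  | mem u hu =>
    obtain ⟨a, j, rfl⟩ := hu
    induction p using Polynomial.induction_on' with
    | add p q hp hq =>
      rw [map_add, cyclicDiag_add, add_mul]
      exact add_mem hp hq
    | monomial i c =>
      refine AddSubmonoid.subset_closure ⟨a * c, ℓ * i + j, ?_⟩
      rw [← Polynomial.C_mul_X_pow_eq_monomial, map_mul, map_pow, RatFunc.algebraMap_X,
        RatFunc.algebraMap_C, ← mul_assoc, ← cyclicDiag_mul, map_mul, pow_add, ← hdX, ← mul_assoc,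
        ← cyclicDiag_mul]
      congr 2
      ring
  | zero => rw [mul_zero]; exact zero_mem _
  | add u v _ _ hu hv => rw [mul_add]; exact add_mem hu hv

theorem shift_mul_mem_twisted {ℓ : ℕ} {σ : RatFunc k ≃ₐ[F] RatFunc k} {τ : k ≃+* k}
    (hC : ∀ a, σ (RatFunc.C a) = RatFunc.C (τ a)) (hσ : σ ^ ℓ = 1)
    {u : Matrix (Fin ℓ) (Fin ℓ) (RatFunc k)} (hu : u ∈ twisted ℓ σ) :
    shiftMat ℓ RatFunc.X * u ∈ twisted ℓ σ := by
  induction hu using AddSubmonoid.closure_induction with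
  | mem u hu =>
    obtain ⟨a, j, rfl⟩ := hu
    refine AddSubmonoid.subset_closure ⟨τ a, j + 1, ?_⟩
    rw [← mul_assoc, shift_mul_cyclicDiag hσ, hC, mul_assoc, ← pow_succ']
  | zero => rw [mul_zero]; exact zero_mem _
  | add u v _ _ hu hv => rw [mul_add]; exact add_mem hu hv

/-- Every nonzero element of the cyclic algebra `(k(z)/F, σ, z)` is invertible if `σ` extends an
automorphism of `k` and fixes `z`. -/
theorem det_ne_zero_of_mem_cyclicAlgebra {ℓ : ℕ} {σ : RatFunc k ≃ₐ[F] RatFunc k} {τ : k ≃+* k}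
    (hC : ∀ a, σ (RatFunc.C a) = RatFunc.C (τ a)) (hX : σ RatFunc.X = RatFunc.X) (hσ : σ ^ ℓ = 1)
    (a : F) (ha : algebraMap F (RatFunc k) a = RatFunc.X)
    {u : Matrix (Fin ℓ) (Fin ℓ) (RatFunc k)} (hu : u ∈ cyclicAlgebra ℓ σ a) (hne : u ≠ 0) :
    u.det ≠ 0 := by
  -- Elements that become twisted polynomials after clearing a denominator on the left. Closure
  -- under left multiplication by generators suffices to reach the whole algebra from `1`.
  set Q : Matrix (Fin ℓ) (Fin ℓ) (RatFunc k) → Prop := fun u => ∃ c : Polynomial k, c ≠ 0 ∧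
    cyclicDiag ℓ σ (algebraMap _ _ c) * u ∈ twisted ℓ σ with hQ
  have hQadd : ∀ u v, Q u → Q v → Q (u + v) := by
    rintro u v ⟨c, hc, hcu⟩ ⟨c', hc', hcv⟩
    refine ⟨c * c', mul_ne_zero hc hc', ?_⟩
    rw [mul_add]
    refine add_mem ?_ ?_
    · rw [mul_comm, map_mul, cyclicDiag_mul, mul_assoc]
      exact cyclicDiag_algebraMap_mul_mem_twisted hX _ hcu
    · rw [map_mul, cyclicDiag_mul, mul_assoc]
      exact cyclicDiag_algebraMap_mul_mem_twisted hX _ hcv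
  have hQdiag : ∀ b u, Q u → Q (cyclicDiag ℓ σ b * u) := by
    rintro b u ⟨c, hc, hcu⟩
    obtain ⟨p, q, hq, rfl⟩ := IsFractionRing.div_surjective (A := Polynomial k) b
    have hq0 : q ≠ 0 := nonZeroDivisors.ne_zero hq
    refine ⟨c * q, mul_ne_zero hc hq0, ?_⟩
    have hq1 : algebraMap (Polynomial k) (RatFunc k) q ≠ 0 := by
      simpa using hq0
    have : algebraMap (Polynomial k) (RatFunc k) (c * q) *
        (algebraMap (Polynomial k) (RatFunc k) p / algebraMap (Polynomial k) (RatFunc k) q) =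
        algebraMap (Polynomial k) (RatFunc k) p * algebraMap (Polynomial k) (RatFunc k) c := by
      rw [map_mul]; field_simp
    rw [← mul_assoc, ← cyclicDiag_mul, this, cyclicDiag_mul, mul_assoc]
    exact cyclicDiag_algebraMap_mul_mem_twisted hX _ hcu
  have hQshift : ∀ u, Q u → Q (shiftMat ℓ RatFunc.X * u) := by
    rintro u ⟨c, hc, hcu⟩
    -- Because $xc=\sigma(c)x$, the denominator has to be conjugated when it passes the generator.
    refine ⟨c.map (τ : k →+* k), (Polynomial.map_ne_zero_iff τ.injective).mpr hc, ?_⟩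
    have hσc : σ (algebraMap _ _ c) = algebraMap (Polynomial k) (RatFunc k) (c.map (τ : k →+* k)) := by
      clear hcu hc
      induction c using Polynomial.induction_on' with
      | add p q hp hq => rw [Polynomial.map_add, map_add, map_add, map_add, hp, hq]
      | monomial i c =>
        rw [Polynomial.map_monomial, ← Polynomial.C_mul_X_pow_eq_monomial,
          ← Polynomial.C_mul_X_pow_eq_monomial]
        simp only [map_mul, map_pow, RatFunc.algebraMap_X, RatFunc.algebraMap_C, hC, hX]
        rfl
    rw [← hσc, ← mul_assoc, ← shift_mul_cyclicDiag hσ, mul_assoc]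
    exact shift_mul_mem_twisted hC hσ hcu
  have hmul : ∀ g ∈ cyclicAlgebra ℓ σ a, ∀ u, Q u → Q (g * u) := by
    intro g hg
    induction hg using Algebra.adjoin_induction with
    | mem g hg =>
      rcases hg with ⟨b, rfl⟩ | hg
      · exact hQdiag b
      · rw [Set.mem_singleton_iff.mp hg, ha]
        exact hQshift
    | algebraMap f =>
      rw [← cyclicDiag_algebraMap ℓ σ f]
      exact hQdiag _
    | add g g' _ _ hg hg' =>
      intro u hu
      rw [add_mul]
      exact hQadd _ _ (hg u hu) (hg' u hu)
    | mul g g' _ _ hg hg' =>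
      intro u hu
      rw [mul_assoc]
      exact hg _ (hg' u hu)
  have hone : Q 1 := by
    refine ⟨1, one_ne_zero, AddSubmonoid.subset_closure ⟨1, 0, ?_⟩⟩
    simp
  obtain ⟨c, hc, hcu⟩ := hmul u hu 1 hone
  rw [mul_one] at hcu
  have hcdet : (cyclicDiag ℓ σ (algebraMap (Polynomial k) (RatFunc k) c)).det ≠ 0 := by
    rw [cyclicDiag, Matrix.det_diagonal]
    refine Finset.prod_ne_zero_iff.mpr fun i _ => ?_
    exact (map_ne_zero_iff _ (σ ^ (i : ℕ)).injective).mpr (by simpa using hc)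
  have hcu0 : cyclicDiag ℓ σ (algebraMap (Polynomial k) (RatFunc k) c) * u ≠ 0 := by
    intro h
    apply hne
    have hun : IsUnit (cyclicDiag ℓ σ (algebraMap (Polynomial k) (RatFunc k) c)) :=
      (Matrix.isUnit_iff_isUnit_det _).mpr (isUnit_iff_ne_zero.mpr hcdet)
    exact hun.mul_left_cancel (h.trans (mul_zero _).symm)
  have := det_ne_zero_of_mem_twisted hC hcu hcu0
  rw [Matrix.det_mul] at this
  exact right_ne_zero_of_mul this

end Division

/-! ### The automorphism of ℚ(ω, z) and its cyclic division algebra -/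

section CyclotomicFunctionField

theorem isPrimitiveRoot_rootC {N : ℕ} (hN : N ≠ 0) : IsPrimitiveRoot (rootC N) N := by
  have := Complex.isPrimitiveRoot_exp N hN
  exact this

theorem isPrimitiveRoot_gen {N : ℕ} (hN : N ≠ 0) :
    IsPrimitiveRoot (IntermediateField.AdjoinSimple.gen ℚ (rootC N)) N :=
  IsPrimitiveRoot.of_map_of_injective
    (f := (IntermediateField.adjoin ℚ {rootC N}).val)
    (by simpa using isPrimitiveRoot_rootC hN) Subtype.val_injective

theorem isPrimitiveRoot_omega {N : ℕ} (hN : N ≠ 0) : IsPrimitiveRoot (omega N) N :=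
  (isPrimitiveRoot_gen hN).map_of_injective (f := RatFunc.C) RatFunc.C_injective

theorem isCyclotomicExtension_adjoin_rootC {N : ℕ} (hN : N ≠ 0) :
    IsCyclotomicExtension {N} ℚ (IntermediateField.adjoin ℚ {rootC N}) := by
  have : NeZero N := ⟨hN⟩
  have hint : IsAlgebraic ℚ (rootC N) :=
    ((isPrimitiveRoot_rootC hN).isIntegral (Nat.pos_of_ne_zero hN)).tower_top.isAlgebraic
  change IsCyclotomicExtension {N} ℚ (IntermediateField.adjoin ℚ {rootC N}).toSubalgebra
  rw [IntermediateField.adjoin_simple_toSubalgebra_of_isAlgebraic hint]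
  exact (isPrimitiveRoot_rootC hN).adjoin_isCyclotomicExtension ℚ

theorem exists_algEquiv_gen {N k : ℕ} (hN : N ≠ 0) (hk : k.Coprime N) :
    ∃ τ : IntermediateField.adjoin ℚ {rootC N} ≃ₐ[ℚ] IntermediateField.adjoin ℚ {rootC N},
      τ (IntermediateField.AdjoinSimple.gen ℚ (rootC N)) =
        IntermediateField.AdjoinSimple.gen ℚ (rootC N) ^ k := by
  have : NeZero N := ⟨hN⟩
  have : IsCyclotomicExtension {N} ℚ (IntermediateField.adjoin ℚ {rootC N}) :=
    isCyclotomicExtension_adjoin_rootC hN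
  have hirr := Polynomial.cyclotomic.irreducible_rat (Nat.pos_of_ne_zero hN)
  have hζ := IsCyclotomicExtension.zeta_spec N ℚ (IntermediateField.adjoin ℚ {rootC N})
  refine ⟨IsCyclotomicExtension.fromZetaAut (hζ.pow_of_coprime k hk) hirr, ?_⟩
  -- The automorphism is specified on the chosen root `zeta`; the given generator is a power of it,
  -- so it is raised to the `k`-th power as well.
  obtain ⟨i, -, hi⟩ := hζ.eq_pow_of_pow_eq_one (isPrimitiveRoot_gen hN).pow_eq_one
  rw [← hi, map_pow, IsCyclotomicExtension.fromZetaAut_spec, ← pow_mul, ← pow_mul, mul_comm]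

theorem ringEquiv_ratFunc_ext {k : Type*} [Field k] {s t : RatFunc k ≃+* RatFunc k}
    (hC : ∀ a, s (RatFunc.C a) = t (RatFunc.C a)) (hX : s RatFunc.X = t RatFunc.X) : s = t := by
  have hpoly : ∀ q : Polynomial k, s (algebraMap _ _ q) = t (algebraMap _ _ q) := by
    intro q
    induction q using Polynomial.induction_on' with
    | add p q hp hq => rw [map_add, map_add, map_add, hp, hq]
    | monomial i c =>
      rw [← Polynomial.C_mul_X_pow_eq_monomial]
      simp only [map_mul, map_pow, RatFunc.algebraMap_X, RatFunc.algebraMap_C, hC, hX]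
  ext x
  obtain ⟨p, q, -, rfl⟩ := IsFractionRing.div_surjective (A := Polynomial k) x
  rw [map_div₀, map_div₀, hpoly, hpoly]

/-- An automorphism fixing `z` and stabilizing the constants is determined by its effect on `ω`; the
last clause thereby identifies its order with that of `k` modulo `N`. -/
theorem exists_ringEquiv_cycFun {N k : ℕ} (hN : N ≠ 0) (hk : k.Coprime N) :
    ∃ (s : CycFun N ≃+* CycFun N)
      (τ : IntermediateField.adjoin ℚ {rootC N} ≃+* IntermediateField.adjoin ℚ {rootC N}),
      (∀ a, s (RatFunc.C a) = RatFunc.C (τ a)) ∧ s (zvar N) = zvar N ∧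
      s (omega N) = omega N ^ k ∧
      ∀ i : ℕ, s ^ i = 1 ↔ k ^ i ≡ 1 [MOD N] := by
  obtain ⟨τ, hτ⟩ := exists_algEquiv_gen hN hk
  set s : CycFun N ≃+* CycFun N :=
    IsFractionRing.ringEquivOfRingEquiv (Polynomial.mapEquiv τ.toRingEquiv) with hs
  have hC : ∀ a, s (RatFunc.C a) = RatFunc.C (τ.toRingEquiv a) := by
    intro a
    rw [hs, ← RatFunc.algebraMap_C, IsFractionRing.ringEquivOfRingEquiv_algebraMap]
    simp
  have hX : s (zvar N) = zvar N := by
    rw [hs, zvar, ← RatFunc.algebraMap_X, IsFractionRing.ringEquivOfRingEquiv_algebraMap]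
    simp
  have hω : s (omega N) = omega N ^ k := by
    rw [omega, hC, ← map_pow, ← hτ]; rfl
  have hωi : ∀ i : ℕ, (s ^ i) (omega N) = omega N ^ k ^ i := by
    intro i
    induction i with
    | zero => simp
    | succ i ih => rw [pow_succ', RingAut.mul_apply, ih, map_pow, hω, ← pow_mul, pow_succ']
  have hCi : ∀ (i : ℕ) a, (s ^ i) (RatFunc.C a) = RatFunc.C ((τ ^ i) a) := by
    intro i
    induction i with
    | zero => intro a; rfl
    | succ i ih => intro a; rw [pow_succ, RingAut.mul_apply, hC, ih, pow_succ]; rfl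
  have hXi : ∀ i : ℕ, (s ^ i) (zvar N) = zvar N := by
    intro i
    induction i with
    | zero => rfl
    | succ i ih => rw [pow_succ, RingAut.mul_apply, hX, ih]
  refine ⟨s, τ.toRingEquiv, hC, hX, hω, fun i => ?_⟩
  have hprim := isPrimitiveRoot_omega hN
  have hkey : omega N ^ k ^ i = omega N ^ 1 ↔ k ^ i ≡ 1 [MOD N] := by
    have hfin : IsOfFinOrder (omega N) :=
      orderOf_pos_iff.mp (hprim.eq_orderOf ▸ Nat.pos_of_ne_zero hN)
    rw [hfin.pow_eq_pow_iff_modEq, ← hprim.eq_orderOf]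
  rw [← hkey, pow_one]
  constructor
  · intro h
    rw [← hωi, h]; rfl
  · intro h
    have hτi : τ ^ i = 1 := by
      have h1 : (τ ^ i) (IntermediateField.AdjoinSimple.gen ℚ (rootC N)) =
          IntermediateField.AdjoinSimple.gen ℚ (rootC N) := by
        apply RatFunc.C_injective
        rw [← hCi]
        exact (hωi i).trans h
      have h2 : (τ ^ i).toAlgHom = AlgHom.id ℚ _ := by
        refine IntermediateField.algHom_ext_of_eq_adjoin _ rfl ?_
        rintro x hx
        rw [Set.mem_singleton_iff] at hx
        subst hx
        exact h1
      ext x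
      exact congrArg Subtype.val (DFunLike.congr_fun h2 x)
    refine ringEquiv_ratFunc_ext (fun a => ?_) (hXi i)
    rw [hCi, hτi]; rfl

/-- Artin's theorem: a field is Galois over the fixed field of a finite group of automorphisms, with
that group as Galois group. Here the group is generated by `σ`, so the degree is its order, and `z`
is fixed. -/
theorem exists_cyclicDivisionAlgebra {N k ℓ : ℕ} (hN : N ≠ 0) (hℓ : 0 < ℓ) (hk : k.Coprime N)
    (hord : orderOf (k : ZMod N) = ℓ) :
    ∃ (F : Subfield (CycFun N)) (hz : zvar N ∈ F) (σ : CycFun N ≃ₐ[F] CycFun N),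
      σ (omega N) = omega N ^ k ∧
      IsCyclicDivisionAlgebra ℓ σ (⟨zvar N, hz⟩ : F) := by
  obtain ⟨s, τ, hC, hX, hω, hs⟩ := exists_ringEquiv_cycFun hN hk
  have hsord : orderOf s = ℓ := by
    rw [← hord]
    refine orderOf_eq_orderOf_iff.mpr fun i => ?_
    rw [hs, ← ZMod.natCast_eq_natCast_iff]
    simp
  let G : Subgroup (RingAut (CycFun N)) := Subgroup.zpowers s
  have hfin : Finite G := by
    have : IsOfFinOrder s := orderOf_pos_iff.mp (hsord ▸ hℓ)
    exact this.finite_zpowers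
  have : Fintype G := Fintype.ofFinite G
  let g : G := ⟨s, Subgroup.mem_zpowers s⟩
  let F := FixedPoints.subfield G (CycFun N)
  have hz : zvar N ∈ F := by
    rintro ⟨t, i, rfl⟩
    have : ∀ t ∈ Subgroup.zpowers s, t (zvar N) = zvar N := by
      intro t ht
      have hle : Subgroup.zpowers s ≤ MulAction.stabilizer (RingAut (CycFun N)) (zvar N) := by
        rw [Subgroup.zpowers_le]; exact hX
      exact hle ht
    exact this _ ⟨i, rfl⟩
  let σ : CycFun N ≃ₐ[F] CycFun N := MulSemiringAction.toAlgAut G F (CycFun N) g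
  have hσs : ∀ x, σ x = s x := fun x => rfl
  have hgord : orderOf g = ℓ := by rw [← hsord]; exact Subgroup.orderOf_mk _ _
  have hσ : σ ^ ℓ = 1 := by
    rw [← map_pow, ← hgord, pow_orderOf_eq_one, map_one]
  refine ⟨F, hz, σ, (hσs _).trans hω, ?_⟩
  have hfd : FiniteDimensional F (CycFun N) := inferInstance
  refine ⟨hfd, ⟨⟩, ?_, ?_, ?_, ?_⟩
  · rw [FixedPoints.finrank_eq_card, ← hsord, ← Nat.card_eq_fintype_card]
    exact Nat.card_zpowers s
  · intro t
    obtain ⟨⟨u, i, rfl⟩, rfl⟩ := FixedPoints.toAlgAut_surjective G (CycFun N) t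
    refine ⟨i, ?_⟩
    simp only [σ]
    rw [← map_zpow]
    congr 1
  · intro h
    exact RatFunc.X_ne_zero (congrArg Subtype.val h)
  · intro u hu hne
    exact exists_inverse_of_det_ne_zero _ hu
      (det_ne_zero_of_mem_cyclicAlgebra (fun a => (hσs _).trans (hC a)) ((hσs _).trans hX) hσ
        (⟨zvar N, hz⟩ : F) rfl hu hne)

/-- The base $1+p^2$ rather than $1+p$ keeps the formula uniform at $p=2$, where $3$ modulo a power
of $2$ behaves differently. -/
theorem orderOf_one_add_sq {p : ℕ} (hp : p.Prime) (L : ℕ) :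
    orderOf ((1 + p ^ 2 : ℕ) : ZMod (p ^ (L + 2))) = p ^ L := by
  have := ZMod.orderOf_one_add_mul_prime_pow hp 2 two_ne_zero (by have := hp.two_le; omega) 1
    (by
      intro h
      have := Int.le_of_dvd one_pos h
      have := hp.two_le
      omega) L
  rw [← this]
  congr 1
  push_cast
  ring

theorem coprime_one_add_sq {p : ℕ} (L : ℕ) : (1 + p ^ 2).Coprime (p ^ (L + 2)) := by
  apply Nat.Coprime.pow_right
  rw [add_comm, pow_two]
  exact (Nat.coprime_mul_right_add_left 1 p p).mpr (Nat.coprime_one_left p)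

end CyclotomicFunctionField

/-! ### Matrix products behind path sums, words and the cyclic shift -/

section MatrixProducts

theorem ofFn_eq_range_map {α : Type*} (d : ℕ) (g : ℕ → α) :
    List.ofFn (fun j : Fin d => g j) = (List.range d).map g := by
  apply List.ext_getElem <;> simp

/-- The sum over all paths is the corresponding entry of the product of the matrices. -/
theorem sum_paths_eq_prod {S : Type*} [Semiring S] {r : ℕ} :
    ∀ (d : ℕ) (M : Fin d → Matrix (Fin r) (Fin r) S) (s t : Fin r),
      ∑ π : Fin (d + 1) → Fin r with π 0 = s ∧ π (Fin.last d) = t,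
        (List.ofFn fun i : Fin d => M i (π i.castSucc) (π i.succ)).prod =
      (List.ofFn M).prod s t := by
  intro d
  induction d with
  | zero =>
    intro M s t
    simp only [List.ofFn_zero, List.prod_nil, Matrix.one_apply]
    split_ifs with h
    · subst h
      rw [Finset.sum_const, nsmul_one]
      have : (Finset.univ.filter fun π : Fin 1 → Fin r => π 0 = s ∧ π (Fin.last 0) = s) =
          {fun _ => s} := by
        ext π
        simp only [Finset.mem_filter, Finset.mem_univ, true_and, Finset.mem_singleton]
        constructor
        · intro h; funext i; rw [Subsingleton.elim i 0]; exact h.1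
        · rintro rfl; exact ⟨rfl, rfl⟩
      rw [this]; simp
    · refine Finset.sum_eq_zero fun π hπ => ?_
      obtain ⟨h1, h2⟩ := (Finset.mem_filter.mp hπ).2
      exact absurd (h1.symm.trans h2) h
  | succ d ih =>
    intro M s t
    rw [List.ofFn_succ, List.prod_cons, Matrix.mul_apply]
    simp_rw [← ih, Finset.mul_sum]
    -- A path is split into its first vertex, forced to be `s`, and the remaining path.
    rw [Finset.sum_filter, ← (Fin.consEquiv fun _ => Fin r).sum_comp, Fintype.sum_prod_type,
      Finset.sum_eq_single s]
    · have hre : ∀ x : Fin r, (∑ π : Fin (d + 1) → Fin r with π 0 = x ∧ π (Fin.last d) = t,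
          M 0 s x * (List.ofFn fun i : Fin d => M i.succ (π i.castSucc) (π i.succ)).prod) =
          ∑ π : Fin (d + 1) → Fin r, if π 0 = x then (if π (Fin.last d) = t then
          M 0 s x * (List.ofFn fun i : Fin d => M i.succ (π i.castSucc) (π i.succ)).prod
          else 0) else 0 := by
        intro x
        rw [Finset.sum_filter]
        refine Finset.sum_congr rfl fun π _ => ?_
        rw [ite_and]
      simp_rw [hre]
      rw [Finset.sum_comm]
      refine Finset.sum_congr rfl fun π _ => ?_
      rw [Finset.sum_ite_eq, if_pos (Finset.mem_univ _)]
      have hlast : (Fin.consEquiv fun _ => Fin r) (s, π) (Fin.last (d + 1)) = π (Fin.last d) := by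
        rw [← Fin.succ_last]; rfl
      rw [hlast]
      have h0 : (Fin.consEquiv fun _ => Fin r) (s, π) 0 = s := rfl
      rw [h0]
      simp only [true_and]
      split_ifs
      · rw [List.ofFn_succ, List.prod_cons]
        rfl
      · rfl
    · intro x _ hx
      refine Finset.sum_eq_zero fun π _ => ?_
      have h0 : (Fin.consEquiv fun _ => Fin r) (x, π) 0 = x := rfl
      rw [h0, if_neg (fun h => hx h.1)]
    · simp

/-- If all coefficients vanish, so does the noncommutative polynomial. -/
theorem prod_linear_eq_zero {E S : Type*} [Field E] [Ring S] [Algebra E S] {n r : ℕ}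
    (e : Fin n → S) (t : Fin r) :
    ∀ (d : ℕ) (B : Fin d → Fin n → Matrix (Fin r) (Fin r) E) (u : Fin r → E),
      (∀ w : Fin d → Fin n, Matrix.vecMul u (List.ofFn fun j => B j (w j)).prod t = 0) →
      Matrix.vecMul (fun a => algebraMap E S (u a))
        (List.ofFn fun j => (Matrix.of fun a b => ∑ i, B j i a b • e i :
          Matrix (Fin r) (Fin r) S)).prod t = 0 := by
  intro d
  induction d with
  | zero =>
    intro B u h
    have := h Fin.elim0
    simp only [List.ofFn_zero, List.prod_nil, Matrix.vecMul_one] at this ⊢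
    rw [this, map_zero]
  | succ d ih =>
    intro B u h
    rw [List.ofFn_succ, List.prod_cons, ← Matrix.vecMul_vecMul]
    -- The first letter `e i` is pulled out to the left; the remaining row is again a scalar vector,
    -- to which the induction hypothesis applies.
    have hrow : Matrix.vecMul (fun a => algebraMap E S (u a))
        (Matrix.of fun a b => ∑ i, B 0 i a b • e i : Matrix (Fin r) (Fin r) S) =
        ∑ i, e i • (fun b => algebraMap E S (Matrix.vecMul u (B 0 i) b)) := by
      ext b
      simp only [Matrix.vecMul, dotProduct, Matrix.of_apply, Finset.sum_apply, Pi.smul_apply,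
        smul_eq_mul, map_sum, map_mul, Finset.mul_sum]
      rw [Finset.sum_comm]
      refine Finset.sum_congr rfl fun i _ => Finset.sum_congr rfl fun a _ => ?_
      rw [Algebra.smul_def, ← mul_assoc, ← map_mul, Algebra.commutes]
    rw [hrow, Matrix.sum_vecMul, Finset.sum_apply]
    refine Finset.sum_eq_zero fun i _ => ?_
    rw [Matrix.smul_vecMul, Pi.smul_apply, ih (fun j => B j.succ) _ ?_, smul_zero]
    intro w
    have := h (Fin.cons i w)
    rw [List.ofFn_succ, List.prod_cons, ← Matrix.vecMul_vecMul] at this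
    simpa using this

theorem wordMat_eq_prod {E : Type*} [Field E] {n r : ℕ}
    (A : ℕ → Fin n → Matrix (Fin r) (Fin r) E) (w : ℕ → Fin n) : ∀ h off : ℕ,
      wordMat A w h off = ((List.range (2 ^ h)).map fun j => A (off + j) (w (off + j))).prod := by
  intro h
  induction h with
  | zero => intro off; simp [wordMat]
  | succ h ih =>
    intro off
    rw [wordMat, ih, ih, pow_succ, mul_two, List.range_add, List.map_append, List.prod_append,
      List.map_map]
    simp [Function.comp_def, add_assoc]

theorem prod_range_map_of_one {R : Type*} [Monoid R] (f : ℕ → R) {d D : ℕ} (h : d ≤ D)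
    (hf : ∀ j, d ≤ j → f j = 1) :
    ((List.range D).map f).prod = ((List.range d).map f).prod := by
  obtain ⟨c, rfl⟩ := Nat.exists_eq_add_of_le h
  rw [List.range_add, List.map_append, List.prod_append, List.map_map,
    List.prod_eq_one (l := List.map (f ∘ _) (List.range c)), mul_one]
  intro x hx
  obtain ⟨j, -, rfl⟩ := List.mem_map.mp hx
  exact hf _ (Nat.le_add_right _ _)

open Polynomial in
theorem exists_natCast_eval_ne_zero {E : Type*} [Field E] [CharZero E] {p : E[X]} (hp : p ≠ 0)
    {T : ℕ} (hT : p.natDegree < T) : ∃ t < T, p.eval (t : E) ≠ 0 := by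
  by_contra! h
  apply hp
  refine eq_zero_of_natDegree_lt_card_of_eval_eq_zero p (f := fun t : Fin T => ((t : ℕ) : E)) ?_
    (fun t => h t t.2) (by simpa using hT)
  intro a b hab
  exact Fin.ext (Nat.cast_injective (R := E) hab)

open Polynomial in
theorem natDegree_prod_matrix_le {E : Type*} [Field E] {r : ℕ} (B : ℕ) :
    ∀ (l : List (Matrix (Fin r) (Fin r) E[X])), (∀ M ∈ l, ∀ a b, (M a b).natDegree ≤ B) →
      ∀ a b, (l.prod a b).natDegree ≤ l.length * B := by
  intro l
  induction l with
  | nil =>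
    intro _ a b
    rw [List.prod_nil, Matrix.one_apply]
    split_ifs <;> simp
  | cons M l ih =>
    intro h a b
    rw [List.prod_cons, Matrix.mul_apply, List.length_cons, Nat.succ_mul, add_comm]
    refine natDegree_sum_le_of_forall_le _ _ fun c _ => natDegree_mul_le.trans ?_
    exact add_le_add (h M (by simp) a c) (ih (fun M' hM' => h M' (by simp [hM'])) c b)

/-- The entry of a product of diagonal matrices times the cyclic shift. -/
theorem prod_diagonal_mul_shift {R : Type*} [CommRing R] {ℓ : ℕ} (z : R) (g : ℕ → Fin ℓ → R) :
    ∀ (d off : ℕ) (a c : Fin ℓ), (c : ℕ) = a + d →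
      ((List.range d).map fun j => Matrix.diagonal (g (off + j)) * shiftMat ℓ z).prod a c =
        ((List.range d).map fun j =>
          if h : (a : ℕ) + j < ℓ then g (off + j) ⟨a + j, h⟩ else 0).prod := by
  intro d
  induction d with
  | zero =>
    intro off a c hc
    have : a = c := Fin.ext (by omega)
    simp [this]
  | succ d ih =>
    intro off a c hc
    have h2 := c.2
    have ha : (a : ℕ) + 1 < ℓ := by omega
    rw [List.range_succ_eq_map, List.map_cons, List.prod_cons, List.map_cons, List.prod_cons,
      List.map_map, List.map_map, Matrix.mul_apply, Finset.sum_eq_single ⟨a + 1, ha⟩]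
    · have := ih (off + 1) ⟨a + 1, ha⟩ c (by simp only; omega)
      simp only [Function.comp_def, Nat.succ_eq_add_one] at this ⊢
      simp only [add_assoc, add_comm 1] at this ⊢
      rw [this, Matrix.diagonal_mul]
      simp [shiftMat]
    · intro x _ hx
      have hx' : (x : ℕ) ≠ a + 1 := fun h => hx (Fin.ext h)
      rw [Matrix.diagonal_mul]
      simp only [shiftMat, Matrix.of_apply]
      rw [if_neg hx', if_neg (by omega)]; simp
    · simp

end MatrixProducts

/-! ## The points of the hitting set -/

/-- The coefficient of `ω ^ b` in the `i`-th component of the point with parameters `t`, `v`. -/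
def pointCoeff (N k d h r t v i b : ℕ) : ℕ :=
  ∑ j ∈ Finset.range d, leaf r h j t ^ i * v ^ (k ^ j % N * b)

/-- The point of the hitting set with parameters `t`, `v`. -/
def point (N k d h r : ℕ) {n : ℕ} (t v : ℕ) : Fin n → AlgData := fun i =>
  [[], [(List.range N).map fun b => (pointCoeff N k d h r t v i b : ℚ)]]

/-- The coefficient of `x` in the `i`-th component of the point with parameters `t`, `v`. -/
noncomputable def pointElem (N k d h r t v i : ℕ) : CycFun N :=
  ∑ b ∈ Finset.range N, (pointCoeff N k d h r t v i b : CycFun N) * omega N ^ b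

theorem powSum_range_map {R : Type*} [Semiring R] (x : R) (N : ℕ) (f : ℕ → R) :
    powSum x ((List.range N).map f) = ∑ b ∈ Finset.range N, f b * x ^ b := by
  rw [powSum]
  have h : ∀ i : Fin ((List.range N).map f).length,
      ((List.range N).map f).get i * x ^ (i : ℕ) = (fun b => f b * x ^ b) i := by
    intro i; simp
  simp_rw [h]
  rw [Fin.sum_univ_eq_sum_range (fun b => f b * x ^ b)]
  simp

theorem powSum_nil {R : Type*} [Semiring R] (x : R) : powSum x [] = 0 := Fin.sum_univ_zero _

theorem powSum_singleton {R : Type*} [Semiring R] (x a : R) : powSum x [a] = a :=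
  (Fin.sum_univ_one _).trans (by simp)

theorem powSum_pair {R : Type*} [Semiring R] (x a b : R) : powSum x [a, b] = a + b * x :=
  (Fin.sum_univ_two _).trans (by simp)

theorem algData_val_point {N : ℕ} {F : Subfield (CycFun N)} (ℓ : ℕ) (σ : CycFun N ≃ₐ[F] CycFun N)
    (k d h r t v : ℕ) {n : ℕ} (i : Fin n) :
    AlgData.val N ℓ σ (point N k d h r t v i) =
      cyclicDiag ℓ σ (pointElem N k d h r t v i) * cyclicShift ℓ (zvar N) := by
  have h1 : FieldData.val N [] = 0 := powSum_nil _
  have h2 : FieldData.val N [(List.range N).map fun b => (pointCoeff N k d h r t v i b : ℚ)] =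
      pointElem N k d h r t v i := by
    rw [FieldData.val, List.map_cons, List.map_map, powSum_range_map, List.map_nil,
      powSum_singleton]
    simp [pointElem]
  rw [AlgData.val, point, List.map_cons, List.map_cons, List.map_nil, h1, h2, cyclicDiag_zero,
    powSum_pair, zero_add]

theorem algData_val_point_mem {N : ℕ} {F : Subfield (CycFun N)} (ℓ : ℕ)
    (σ : CycFun N ≃ₐ[F] CycFun N) (hz : zvar N ∈ F) (k d h r t v : ℕ) {n : ℕ} (i : Fin n) :
    AlgData.val N ℓ σ (point N k d h r t v i) ∈ cyclicAlgebra ℓ σ (⟨zvar N, hz⟩ : F) := by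
  rw [algData_val_point]
  exact mul_mem (Algebra.subset_adjoin (Or.inl ⟨_, rfl⟩)) (Algebra.subset_adjoin (Or.inr rfl))

/-! ### From a nonzero ABP to a nonzero value -/

section Evaluation

variable {E : Type*} [Field E] {n r d : ℕ}

/-- The coefficient matrices of an ABP, extended beyond its last layer by the identity. -/
def abpMat (A : HomABP E n r d) (j : ℕ) (i : Fin n) : Matrix (Fin r) (Fin r) E :=
  if h : j < d then Matrix.of fun a b => A.label ⟨j, h⟩ a b i else if (i : ℕ) = 0 then 1 else 0

/-- The source–sink entries of the word matrices are the coefficients of the polynomial, so they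
cannot all vanish. -/
theorem exists_wordMat_ne_zero [NeZero n] (A : HomABP E n r d) (hA : A.poly ≠ 0) {h : ℕ}
    (hd : d ≤ 2 ^ h) : ∃ w : ℕ → Fin n, wordMat (abpMat A) w h 0 A.source A.sink ≠ 0 := by
  by_contra! hall
  apply hA
  have hpoly : A.poly = (List.ofFn fun j => (Matrix.of fun a b =>
      linForm (A.label j a b) : Matrix (Fin r) (Fin r) (FreeAlgebra E (Fin n)))).prod
        A.source A.sink := by
    rw [← sum_paths_eq_prod, HomABP.poly]
    simp only [Matrix.of_apply]
  have hzero := prod_linear_eq_zero (FreeAlgebra.ι E (X := Fin n)) A.sink d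
    (fun j i => Matrix.of fun a b => A.label j a b i) (Pi.single A.source 1) ?_
  · rw [hpoly]
    convert hzero using 1
    have : (fun a => algebraMap E (FreeAlgebra E (Fin n)) ((Pi.single A.source 1 : Fin r → E) a)) =
        Pi.single A.source 1 := by
      ext a
      by_cases ha : a = A.source
      · subst ha; simp
      · simp [Pi.single_eq_of_ne ha]
    rw [this, Matrix.single_one_vecMul]
    simp only [Matrix.of_apply, linForm]
    rfl
  · intro w
    rw [Matrix.single_one_vecMul]
    -- Words are padded to length $2^h$ by the letter `0`, whose matrix is the identity beyond the
    -- last layer.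
    have := hall fun j => if h : j < d then w ⟨j, h⟩ else 0
    rw [wordMat_eq_prod, prod_range_map_of_one _ hd, ← ofFn_eq_range_map] at this
    · simpa [abpMat] using this
    · intro j hj
      simp [abpMat, hj]

theorem exists_leaf_prod_ne_zero [CharZero E] [NeZero n] (A : HomABP E n r d) (hA : A.poly ≠ 0)
    {h T : ℕ} (hd : d ≤ 2 ^ h) (hT : (n - 1) * (2 * r + 1) ^ h < T) :
    ∃ t < T, ((List.range d).map fun j =>
      ∑ i : Fin n, ((leaf r h j t : ℕ) : E) ^ (i : ℕ) • abpMat A j i).prod A.source A.sink ≠ 0 := by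
  obtain ⟨w, hw⟩ := exists_wordMat_ne_zero A hA hd
  have hform := treeForm_ne_zero (abpMat A) w h 0 (Pi.single A.source 1) (Pi.single A.sink 1)
    (by simpa using hw)
  have heq : treeForm (Pi.single A.source 1) (Pi.single A.sink 1) (treeMat (abpMat A) h 0) =
      treeMat (abpMat A) h 0 A.source A.sink := by
    have : ∀ s : Fin r, (fun a => Polynomial.C ((Pi.single s 1 : Fin r → E) a)) =
        Pi.single s 1 := by
      intro s
      ext1 a
      by_cases ha : a = s
      · subst ha; simp
      · simp [Pi.single_eq_of_ne ha]
    rw [treeForm, this, this]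
    simp
  rw [heq] at hform
  obtain ⟨t, ht, hne⟩ := exists_natCast_eval_ne_zero hform
    ((natDegree_treeMat_le (abpMat A) h 0 A.source A.sink).trans_lt hT)
  refine ⟨t, ht, ?_⟩
  have := congrFun (congrFun (eval_treeMat (abpMat A) h 0 t) A.source) A.sink
  rw [Matrix.map_apply] at this
  rw [this, prod_range_map_of_one _ hd] at hne
  · simpa using hne
  · intro j hj
    -- On padding layers only $i=0$ contributes, with weight $u^0=1$, whatever the leaf value is;
    -- these factors are identities.
    rw [Finset.sum_eq_single 0]
    · simp [abpMat, hj]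
    · intro i _ hi
      have : (i : ℕ) ≠ 0 := fun h => hi (Fin.ext (by simpa using h))
      simp [abpMat, Nat.not_lt.mpr hj, this]
    · simp

/-- The value of an ABP at matrices of the form "diagonal times cyclic shift". -/
theorem lift_poly_apply (A : HomABP E n r d) {ℓ : ℕ} (hd : d < ℓ) (z : E)
    (β : Fin n → ℕ → E) :
    FreeAlgebra.lift E (fun i => Matrix.diagonal (fun a : Fin ℓ => β i a) * shiftMat ℓ z) A.poly
        ⟨0, by omega⟩ ⟨d, hd⟩ =
      ((List.range d).map fun j => ∑ i : Fin n, β i j • abpMat A j i).prod A.source A.sink := by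
  rw [← ofFn_eq_range_map, ← sum_paths_eq_prod, HomABP.poly, map_sum, Matrix.sum_apply]
  refine Finset.sum_congr rfl fun π _ => ?_
  rw [map_list_prod, List.map_ofFn]
  -- Along a fixed path each label becomes a diagonal matrix times the shift. Since $d<\ell$, going
  -- from row $0$ to column $d$ in $d$ steps never uses the corner entry, so `z` does not appear.
  set c : ℕ → Fin n → E := fun j i =>
    if h : j < d then A.label ⟨j, h⟩ (π (Fin.castSucc ⟨j, h⟩)) (π (Fin.succ ⟨j, h⟩)) i else 0 with hc
  have h1 : ∀ j : Fin d, (FreeAlgebra.lift E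
      (fun i => Matrix.diagonal (fun a : Fin ℓ => β i a) * shiftMat ℓ z))
      (linForm (A.label j (π j.castSucc) (π j.succ))) =
      Matrix.diagonal (fun a : Fin ℓ => ∑ i, c j i * β i a) * shiftMat ℓ z := by
    intro j
    rw [linForm, map_sum]
    simp only [map_smul, FreeAlgebra.lift_ι_apply]
    simp_rw [← smul_mul_assoc]
    rw [← Finset.sum_mul]
    congr 1
    ext a b
    rw [Matrix.sum_apply]
    by_cases hab : a = b
    · subst hab
      simp [c]
      rfl
    · simp [hab]
  have h2 : (List.ofFn fun j : Fin d => (FreeAlgebra.lift E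
      (fun i => Matrix.diagonal (fun a : Fin ℓ => β i a) * shiftMat ℓ z))
      (linForm (A.label j (π j.castSucc) (π j.succ)))) = (List.range d).map fun j =>
      Matrix.diagonal (fun a : Fin ℓ => ∑ i, c (0 + j) i * β i a) * shiftMat ℓ z := by
    rw [← ofFn_eq_range_map]
    simp only [h1, zero_add]
  refine (congrArg (fun l : List (Matrix (Fin ℓ) (Fin ℓ) E) =>
    l.prod ⟨0, by omega⟩ ⟨d, hd⟩) h2).trans ?_
  rw [prod_diagonal_mul_shift z (fun j a => ∑ i, c j i * β i a) d 0 _ _ (by simp),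
    ← ofFn_eq_range_map]
  congr 1
  congr 1
  ext j
  have hj : (j : ℕ) < ℓ := j.2.trans hd
  simp only [zero_add, hj, dif_pos, Matrix.sum_apply, Matrix.smul_apply, smul_eq_mul]
  refine Finset.sum_congr rfl fun i _ => ?_
  simp only [c, abpMat, Fin.is_lt, dif_pos, Matrix.of_apply, Fin.eta]
  exact mul_comm _ _

/-! ### Conjugates of the points and the choice of the integer parameter -/

section Hitting

variable {N k : ℕ} {F : Subfield (CycFun N)} (σ : CycFun N ≃ₐ[F] CycFun N)

theorem algEquiv_pow_omega (hω : σ (omega N) = omega N ^ k) (j : ℕ) :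
    (σ ^ j) (omega N) = omega N ^ k ^ j := by
  induction j with
  | zero => simp
  | succ j ih => rw [pow_succ', AlgEquiv.mul_apply, ih, map_pow, hω, ← pow_mul, pow_succ']

theorem algEquiv_pow_pointElem (hω : σ (omega N) = omega N ^ k) (d h r t v i j : ℕ) :
    (σ ^ j) (pointElem N k d h r t v i) =
      ∑ b ∈ Finset.range N, (pointCoeff N k d h r t v i b : CycFun N) * (omega N ^ k ^ j) ^ b := by
  rw [pointElem, map_sum]
  refine Finset.sum_congr rfl fun b _ => ?_
  rw [map_mul, map_natCast, map_pow, algEquiv_pow_omega σ hω]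

/-- The orthogonality relations for powers of a primitive root of unity. -/
theorem sum_root_pow_orthogonal {E : Type*} [Field E] {w : E} (hw : IsPrimitiveRoot w N)
    (hN : N ≠ 0) (a b : ℕ) :
    ∑ c ∈ Finset.range N, (w⁻¹ ^ (a % N * c)) * (w ^ b) ^ c = if b ≡ a [MOD N] then (N : E) else 0 := by
  have hw0 : w ≠ 0 := hw.ne_zero hN
  have hfin : IsOfFinOrder w := orderOf_pos_iff.mp (hw.eq_orderOf ▸ Nat.pos_of_ne_zero hN)
  set ζ : E := w⁻¹ ^ (a % N) * w ^ b with hζ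
  have hsum : ∑ c ∈ Finset.range N, (w⁻¹ ^ (a % N * c)) * (w ^ b) ^ c =
      ∑ c ∈ Finset.range N, ζ ^ c :=
    Finset.sum_congr rfl fun c _ => by rw [hζ, mul_pow, pow_mul]
  have hζ1 : ζ = 1 ↔ b ≡ a [MOD N] := by
    rw [hζ, inv_pow, inv_mul_eq_one₀ (pow_ne_zero _ hw0), hfin.pow_eq_pow_iff_modEq,
      ← hw.eq_orderOf]
    exact ⟨fun h => h.symm.trans (Nat.mod_modEq a N), fun h => (Nat.mod_modEq a N).trans h.symm⟩
  have hζN : ζ ^ N = 1 := by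
    rw [hζ, mul_pow, ← pow_mul, ← pow_mul, mul_comm _ N, mul_comm b N, pow_mul, pow_mul, inv_pow,
      hw.pow_eq_one]; simp
  rw [hsum]
  split_ifs with h
  · rw [hζ1.mpr h]; simp
  · have h1 := mul_neg_geom_sum ζ N
    rw [hζN, sub_self, mul_eq_zero] at h1
    exact h1.resolve_left fun h2 => h (hζ1.mp (sub_eq_zero.mp h2).symm)

-- The inverse root of unity would be an ideal parameter `v`: it isolates the prescribed leaf value
-- in every conjugate at once. Polynomial dependence on `v` then allows an integer in its place, so
-- the coefficients of the point are natural numbers.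
open Polynomial in
theorem exists_point_ne_zero [CharZero E] {w : E} (hw : IsPrimitiveRoot w N) (hN : N ≠ 0)
    (A : HomABP E n r d) (h t : ℕ)
    (hinj : ∀ j < d, ∀ j' < d, k ^ j ≡ k ^ j' [MOD N] → j = j')
    (hne : ((List.range d).map fun j =>
      ∑ i : Fin n, ((leaf r h j t : ℕ) : E) ^ (i : ℕ) • abpMat A j i).prod A.source A.sink ≠ 0) :
    ∃ v < d * N * N + 1, ((List.range d).map fun j => ∑ i : Fin n,
      (∑ b ∈ Finset.range N, (pointCoeff N k d h r t v i b : E) * (w ^ k ^ j) ^ b) •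
        abpMat A j i).prod A.source A.sink ≠ 0 := by
  set B : ℕ → Fin n → E[X] := fun j i => ∑ b ∈ Finset.range N,
    (∑ j' ∈ Finset.range d, C ((leaf r h j' t : E) ^ (i : ℕ)) * X ^ (k ^ j' % N * b)) *
      C ((w ^ k ^ j) ^ b) with hB
  set M : ℕ → Matrix (Fin r) (Fin r) E[X] := fun j =>
    Matrix.of fun a b => ∑ i, B j i * C (abpMat A j i a b) with hM
  have heval : ∀ x : E, eval x (((List.range d).map M).prod A.source A.sink) =
      ((List.range d).map fun j => ∑ i : Fin n, eval x (B j i) • abpMat A j i).prod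
        A.source A.sink := by
    intro x
    have h1 : (evalRingHom x).mapMatrix ((List.range d).map M).prod =
        ((List.range d).map fun j => ∑ i : Fin n, eval x (B j i) • abpMat A j i).prod := by
      rw [map_list_prod, List.map_map]
      congr 2
      ext j a b
      simp [M, eval_finsetSum, Matrix.sum_apply]
    rw [← h1]; rfl
  have hdeg : (((List.range d).map M).prod A.source A.sink).natDegree ≤ d * (N * N) := by
    refine (natDegree_prod_matrix_le (N * N) _ ?_ _ _).trans (by simp)
    intro M' hM' a b
    obtain ⟨j, -, rfl⟩ := List.mem_map.mp hM'
    simp only [M, Matrix.of_apply]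
    refine natDegree_sum_le_of_forall_le _ _ fun i _ => ?_
    refine (natDegree_mul_C_le _ _).trans ?_
    refine natDegree_sum_le_of_forall_le _ _ fun c hc => ?_
    refine (natDegree_mul_C_le _ _).trans ?_
    refine natDegree_sum_le_of_forall_le _ _ fun j' _ => ?_
    refine (natDegree_C_mul_X_pow_le _ _).trans ?_
    exact Nat.mul_le_mul (Nat.mod_lt _ (Nat.pos_of_ne_zero hN)).le (Finset.mem_range.mp hc).le
  -- By orthogonality each weight equals $N$ times the intended one, so the product is $N^d$ times
  -- the value known to be nonzero.
  have hroot : eval w⁻¹ (((List.range d).map M).prod A.source A.sink) ≠ 0 := by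
    rw [heval]
    have hB1 : ∀ j < d, ∀ i : Fin n, eval w⁻¹ (B j i) = N * (leaf r h j t : E) ^ (i : ℕ) := by
      intro j hj i
      simp only [B, eval_finsetSum, eval_mul, eval_C, eval_pow, eval_X, Finset.sum_mul]
      rw [Finset.sum_comm]
      simp_rw [mul_assoc, ← Finset.mul_sum, sum_root_pow_orthogonal hw hN]
      rw [Finset.sum_eq_single j]
      · rw [if_pos (Nat.ModEq.refl _), mul_comm]
      · intro j' hj' hne
        rw [if_neg, mul_zero]
        intro hcon
        exact hne (hinj j hj j' (Finset.mem_range.mp hj') hcon).symm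
      · intro h; exact absurd (Finset.mem_range.mpr hj) h
    have h2 : ∀ m ≤ d, ((List.range m).map fun j =>
        ∑ i : Fin n, eval w⁻¹ (B j i) • abpMat A j i).prod = (N : E) ^ m •
        ((List.range m).map fun j =>
          ∑ i : Fin n, ((leaf r h j t : ℕ) : E) ^ (i : ℕ) • abpMat A j i).prod := by
      intro m
      induction m with
      | zero => intro _; simp
      | succ m ih =>
        intro hm
        rw [List.range_succ, List.map_append, List.prod_append, ih (by omega), List.map_append,
          List.prod_append, List.map_singleton, List.prod_singleton, List.map_singleton,
          List.prod_singleton]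
        simp_rw [hB1 m (by omega), mul_smul]
        rw [← Finset.smul_sum, smul_mul_assoc, mul_smul_comm, smul_smul, pow_succ]
    rw [h2 d le_rfl, Matrix.smul_apply]
    exact smul_ne_zero (pow_ne_zero _ (Nat.cast_ne_zero.mpr hN)) hne
  have hp : ((List.range d).map M).prod A.source A.sink ≠ 0 := by
    intro h0; rw [h0, eval_zero] at hroot; exact hroot rfl
  obtain ⟨v, hv, hval⟩ := exists_natCast_eval_ne_zero hp
    (T := d * N * N + 1) (by rw [mul_assoc]; exact Nat.lt_succ_of_le hdeg)
  refine ⟨v, hv, ?_⟩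
  rw [heval] at hval
  convert hval using 7
  simp [B, eval_finsetSum, pointCoeff]

/-- The points with small parameters hit all nonzero ABPs over every extension field. -/
theorem exists_point_lift_ne_zero [Algebra (CycFun N) E] [NeZero n] (hN : N ≠ 0)
    (hω : σ (omega N) = omega N ^ k) {ℓ h T : ℕ} (hℓ : d < ℓ) (hd : d ≤ 2 ^ h)
    (hT : (n - 1) * (2 * r + 1) ^ h < T)
    (hinj : ∀ j < d, ∀ j' < d, k ^ j ≡ k ^ j' [MOD N] → j = j')
    (A : HomABP E n r d) (hA : A.poly ≠ 0) :
    ∃ t < T, ∃ v < d * N * N + 1, FreeAlgebra.lift E (fun i =>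
      (AlgData.val N ℓ σ (point N k d h r t v i)).map (algebraMap (CycFun N) E)) A.poly ≠ 0 := by
  have : CharZero (CycFun N) := charZero_of_injective_algebraMap (algebraMap ℚ (CycFun N)).injective
  have : CharZero E := charZero_of_injective_algebraMap (algebraMap (CycFun N) E).injective
  obtain ⟨t, ht, hne⟩ := exists_leaf_prod_ne_zero A hA hd hT
  have hw : IsPrimitiveRoot (algebraMap (CycFun N) E (omega N)) N :=
    (isPrimitiveRoot_omega hN).map_of_injective (algebraMap (CycFun N) E).injective
  obtain ⟨v, hv, hne'⟩ := exists_point_ne_zero hw hN A h t hinj hne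
  refine ⟨t, ht, v, hv, fun h0 => hne' ?_⟩
  set β : Fin n → ℕ → E := fun i j =>
    ∑ b ∈ Finset.range N, (pointCoeff N k d h r t v i b : E) *
      (algebraMap (CycFun N) E (omega N) ^ k ^ j) ^ b with hβ
  have hval : (fun i : Fin n => (AlgData.val N ℓ σ (point N k d h r t v i)).map
      (algebraMap (CycFun N) E)) = fun i =>
      Matrix.diagonal (fun a : Fin ℓ => β i a) * shiftMat ℓ (algebraMap (CycFun N) E (zvar N)) := by
    ext1 i
    rw [algData_val_point, Matrix.map_mul, cyclicShift_eq, shiftMat_map, cyclicDiag,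
      Matrix.diagonal_map (map_zero _)]
    congr 2
    ext a
    rw [algEquiv_pow_pointElem σ hω]
    simp [β]
  rw [hval] at h0
  rw [← lift_poly_apply A hℓ (algebraMap (CycFun N) E (zvar N)) β, h0]
  rfl

end Hitting

end Evaluation

/-! ## Execution of programs with bounded memory contents -/

/-- The content of the cell with address `x`. -/
abbrev reg (x : ℕ) : Expr := .deref (.lit x)

/-- The number of nodes of an expression. -/
def Expr.nodes : Expr → ℕ
  | .lit _ => 1
  | .deref a => a.nodes + 1
  | .add a b => a.nodes + b.nodes + 1
  | .sub a b => a.nodes + b.nodes + 1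
  | .mul a b => a.nodes + b.nodes + 1
  | .div a b => a.nodes + b.nodes + 1

/-- The largest constant in an expression. -/
def Expr.maxLit : Expr → ℕ
  | .lit c => c
  | .deref a => a.maxLit
  | .add a b => max a.maxLit b.maxLit
  | .sub a b => max a.maxLit b.maxLit
  | .mul a b => max a.maxLit b.maxLit
  | .div a b => max a.maxLit b.maxLit

/-- The expression has at most `20` nodes and constants below `32`. -/
def Expr.Small (e : Expr) : Prop := e.nodes ≤ 20 ∧ e.maxLit < 32

instance (e : Expr) : Decidable e.Small := inferInstanceAs (Decidable (_ ∧ _))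

/-- All cells hold numbers of at most `β` bits. -/
def Bdd (β : ℕ) (m : Mem) : Prop := 5 ≤ β ∧ ∀ i, m i < 2 ^ β

/-- Each node accounts for `β` bits: bit lengths add under multiplication, and the carry of an
addition is paid for by its own node. Constants below $32=2^5$ fit because `5 ≤ β`. -/
theorem Expr.eval_lt {β : ℕ} {m : Mem} (hm : Bdd β m) :
    ∀ e : Expr, e.maxLit < 32 → e.eval m < 2 ^ (β * e.nodes) := by
  obtain ⟨hβ, hm⟩ := hm
  have hmono : ∀ a b : ℕ, a ≤ b → 2 ^ (β * a) ≤ 2 ^ (β * b) := fun a b h =>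
    Nat.pow_le_pow_right two_pos (Nat.mul_le_mul_left β h)
  intro e
  induction e with
  | lit c =>
    intro h
    calc c < 2 ^ 5 := h
      _ ≤ _ := by simpa [nodes] using Nat.pow_le_pow_right two_pos hβ
  | deref a _ =>
    intro _
    exact (hm _).trans_le (by simpa [nodes] using hmono 1 (a.nodes + 1) (by omega))
  | add a b ha hb =>
    intro h
    obtain ⟨h1, h2⟩ := max_lt_iff.mp h
    have h1 := (ha h1).trans_le (hmono a.nodes (a.nodes + b.nodes) (by omega))
    have h2 := (hb h2).trans_le (hmono b.nodes (a.nodes + b.nodes) (by omega))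
    calc a.eval m + b.eval m < 2 ^ (β * (a.nodes + b.nodes)) * 2 := by omega
      _ = 2 ^ (β * (a.nodes + b.nodes) + 1) := (pow_succ _ _).symm
      _ ≤ _ := Nat.pow_le_pow_right two_pos (by simp only [nodes]; rw [Nat.mul_succ]; omega)
  | sub a b ha hb =>
    intro h
    exact (Nat.sub_le _ _).trans_lt ((ha (max_lt_iff.mp h).1).trans_le (hmono _ _ (by
      simp only [nodes]; omega)))
  | mul a b ha hb =>
    intro h
    obtain ⟨h1, h2⟩ := max_lt_iff.mp h
    calc a.eval m * b.eval m < 2 ^ (β * a.nodes) * 2 ^ (β * b.nodes) :=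
          Nat.mul_lt_mul'' (ha h1) (hb h2)
      _ = 2 ^ (β * (a.nodes + b.nodes)) := by rw [← pow_add, mul_add]
      _ ≤ _ := hmono _ _ (by simp only [nodes]; omega)
  | div a b ha hb =>
    intro h
    exact (Nat.div_le_self _ _).trans_lt ((ha (max_lt_iff.mp h).1).trans_le (hmono _ _ (by
      simp only [nodes]; omega)))

theorem Expr.cost_le {β : ℕ} {m : Mem} (hm : Bdd β m) :
    ∀ e : Expr, e.maxLit < 32 → e.cost m ≤ e.nodes * (1 + β * e.nodes) := by
  have hnode : ∀ e : Expr, e.maxLit < 32 → 1 + Nat.size (e.eval m) ≤ 1 + β * e.nodes := fun e he =>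
    Nat.add_le_add_left (Nat.size_le.mpr (Expr.eval_lt hm e he)) 1
  have hbin : ∀ a b c x y z : ℕ, x ≤ a * (1 + β * a) → y ≤ b * (1 + β * b) →
      z ≤ 1 + β * (a + b + 1) → x + y + z ≤ (a + b + 1) * (1 + β * (a + b + 1)) := by
    intro a b c x y z hx hy hz
    calc x + y + z ≤ a * (1 + β * (a + b + 1)) + b * (1 + β * (a + b + 1)) +
          1 * (1 + β * (a + b + 1)) := by
          gcongr
          · exact hx.trans (by gcongr; omega)
          · exact hy.trans (by gcongr; omega)
          · omega
      _ = _ := by ring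
  intro e
  induction e with
  | lit c => intro h; simpa [cost, nodes, eval] using hnode (.lit c) h
  | deref a ha =>
    intro h
    have := hbin a.nodes 0 0 _ 0 _ (ha h) (by omega) (hnode (.deref a) h)
    simpa [cost, nodes] using this
  | add a b ha hb =>
    intro h
    exact hbin _ _ 0 _ _ _ (ha (max_lt_iff.mp h).1) (hb (max_lt_iff.mp h).2) (hnode (.add a b) h)
  | sub a b ha hb =>
    intro h
    exact hbin _ _ 0 _ _ _ (ha (max_lt_iff.mp h).1) (hb (max_lt_iff.mp h).2) (hnode (.sub a b) h)
  | mul a b ha hb =>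
    intro h
    exact hbin _ _ 0 _ _ _ (ha (max_lt_iff.mp h).1) (hb (max_lt_iff.mp h).2) (hnode (.mul a b) h)
  | div a b ha hb =>
    intro h
    exact hbin _ _ 0 _ _ _ (ha (max_lt_iff.mp h).1) (hb (max_lt_iff.mp h).2) (hnode (.div a b) h)

theorem Expr.Small.cost_le {e : Expr} (he : e.Small) {β : ℕ} {m : Mem} (hm : Bdd β m) :
    e.cost m ≤ 420 * β := by
  refine (Expr.cost_le hm e he.2).trans ?_
  calc e.nodes * (1 + β * e.nodes) ≤ 20 * (1 + β * 20) := by gcongr <;> exact he.1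
    _ ≤ 420 * β := by have := hm.1; omega

/-- Started on `m`, the program writes `o` and halts in time at most `c * (500 * β)` with all cells
below `2 ^ β`, in a memory with property `Post`. -/
def Ok (β : ℕ) (P : Prog) (o : List ℕ) (c : ℕ) (m : Mem) (Post : Mem → Prop) : Prop :=
  Bdd β m → ∃ m' t, Exec P m o t m' ∧ t ≤ c * (500 * β) ∧ Bdd β m' ∧ Post m'

section Rules

variable {β : ℕ} {P Q : Prog} {o o' : List ℕ} {c c' : ℕ} {m : Mem} {Post Post' : Mem → Prop}

theorem Ok.weaken (h : Ok β P o c m Post) (ho : o = o') (hc : c ≤ c') (hP : ∀ m', Post m' → Post' m') :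
    Ok β P o' c' m Post' := by
  intro hm
  obtain ⟨m', t, h1, h2, h3, h4⟩ := h hm
  exact ⟨m', t, ho ▸ h1, h2.trans (Nat.mul_le_mul_right _ hc), h3, hP _ h4⟩

theorem Ok.skip (h : Post m) : Ok β .skip [] 1 m Post := fun hm =>
  ⟨m, 1, .skip m, by have := hm.1; omega, hm, h⟩

theorem Ok.seq (h : Ok β P o c m fun m' => Ok β Q o' c' m' Post) :
    Ok β (.seq P Q) (o ++ o') (c + c') m Post := by
  intro hm
  obtain ⟨m₁, t₁, h1, h2, h3, h4⟩ := h hm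
  obtain ⟨m₂, t₂, h5, h6, h7, h8⟩ := h4 h3
  exact ⟨m₂, t₁ + t₂, .seq h1 h5, by rw [add_mul]; exact add_le_add h2 h6, h7, h8⟩

theorem Ok.bind {o'' : List ℕ} {c'' : ℕ} (h : Ok β P o c m Post')
    (h' : ∀ m', Post' m' → Ok β Q o' c' m' Post) (ho : o ++ o' = o'') (hc : c + c' ≤ c'') :
    Ok β (.seq P Q) o'' c'' m Post :=
  (Ok.seq (h.weaken rfl le_rfl h')).weaken ho hc fun _ => id

theorem Bdd.update (hm : Bdd β m) (x : ℕ) {v : ℕ} (hv : v < 2 ^ β) :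
    Bdd β (Function.update m x v) := by
  refine ⟨hm.1, fun i => ?_⟩
  rw [Function.update_apply]
  split_ifs
  · exact hv
  · exact hm.2 i

theorem Ok.store {x : ℕ} {e : Expr} (v : ℕ) (hx : x < 32) (he : e.Small) (hev : e.eval m = v)
    (hv : v < 2 ^ β) (h : Post (Function.update m x v)) :
    Ok β (.store (.lit x) e) [] 1 m Post := by
  intro hm
  subst hev
  refine ⟨_, _, .store (.lit x) e m, ?_, hm.update x hv, h⟩
  -- The expression costs at most $420\beta$, the literal address at most $6$ and the command $1$;
  -- `5 ≤ β` puts the total below $500\beta$.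
  have h1 := he.cost_le hm
  have h2 : (Expr.lit x).cost m ≤ 6 := by
    have : Nat.size x ≤ 5 := Nat.size_le.mpr hx
    simp only [Expr.cost]; omega
  have := hm.1
  omega

theorem Ok.store_seq {x : ℕ} {e : Expr} (v : ℕ) (hx : x < 32) (he : e.Small) (hev : e.eval m = v)
    (hv : v < 2 ^ β) (h : Ok β Q o c (Function.update m x v) Post) :
    Ok β (.seq (.store (.lit x) e) Q) o (c + 1) m Post :=
  (Ok.seq (o := []) (Ok.store v hx he hev hv h)).weaken rfl (Nat.add_comm 1 c).le fun _ => id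

theorem Ok.write {e : Expr} (v : ℕ) (he : e.Small) (hev : e.eval m = v) (h : Post m) :
    Ok β (.write e) [v] 1 m Post := by
  intro hm
  subst hev
  refine ⟨_, _, .write e m, ?_, hm, h⟩
  have h1 := he.cost_le hm
  have := hm.1
  omega

theorem Ok.write_seq {e : Expr} (v : ℕ) (he : e.Small) (hev : e.eval m = v)
    (h : Ok β Q o c m Post) : Ok β (.seq (.write e) Q) (v :: o) (c + 1) m Post :=
  (Ok.seq (o := [v]) (Ok.write v he hev h)).weaken rfl (Nat.add_comm 1 c).le fun _ => id

theorem Ok.ifelse_pos {e : Expr} (he : e.Small) (hev : e.eval m ≠ 0) (h : Ok β P o c m Post) :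
    Ok β (.ifelse e P Q) o (c + 1) m Post := by
  intro hm
  obtain ⟨m', t, h1, h2, h3, h4⟩ := h hm
  refine ⟨m', _, .ifTrue hev h1, ?_, h3, h4⟩
  have h1 := he.cost_le hm
  have := hm.1
  rw [add_mul]
  omega

theorem Ok.ifelse_neg {e : Expr} (he : e.Small) (hev : e.eval m = 0) (h : Ok β Q o c m Post) :
    Ok β (.ifelse e P Q) o (c + 1) m Post := by
  intro hm
  obtain ⟨m', t, h1, h2, h3, h4⟩ := h hm
  refine ⟨m', _, .ifFalse hev h1, ?_, h3, h4⟩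
  have h1 := he.cost_le hm
  have := hm.1
  rw [add_mul]
  omega

/-- The invariant `I` is indexed by the number of completed rounds; peeling off the first round
shifts both `I` and the output `o`. Each guard test is charged one unit. -/
theorem Ok.loop {e : Expr} (he : e.Small) (c : ℕ) : ∀ (B : ℕ) (I : ℕ → Mem → Prop) (o : ℕ → List ℕ),
    (∀ k < B, ∀ m, I k m → e.eval m ≠ 0 ∧ Ok β P (o k) c m (I (k + 1))) →
    (∀ m, I B m → e.eval m = 0) → ∀ m, I 0 m →
    Ok β (.loop e P) ((List.range B).flatMap o) (B * (c + 1) + 1) m (I B) := by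
  intro B
  induction B with
  | zero =>
    intro I o _ hB m hI hm
    refine ⟨m, _, .loopDone (hB m hI), ?_, hm, hI⟩
    have h1 := he.cost_le hm
    have := hm.1
    omega
  | succ B ih =>
    intro I o hstep hB m hI hm
    obtain ⟨hne, hok⟩ := hstep 0 (by omega) m hI
    obtain ⟨m₁, t₁, h1, h2, h3, h4⟩ := hok hm
    obtain ⟨m₂, t₂, h5, h6, h7, h8⟩ := ih (fun k => I (k + 1)) (fun k => o (k + 1))
      (fun k hk => hstep (k + 1) (by omega)) hB m₁ h4 h3
    refine ⟨m₂, 1 + e.cost m + t₁ + t₂, ?_, ?_, h7, h8⟩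
    · rw [List.range_succ_eq_map, List.flatMap_cons, List.flatMap_map]
      exact .loopStep hne h1 h5
    · have h9 := he.cost_le hm
      have := hm.1
      calc 1 + e.cost m + t₁ + t₂ ≤ 500 * β + c * (500 * β) + (B * (c + 1) + 1) * (500 * β) := by
            omega
        _ = _ := by ring

end Rules

/-- The memories agree outside the cells in `S`. -/
def Frame (S : List ℕ) (m m' : Mem) : Prop := ∀ i, i ∉ S → m' i = m i

theorem Frame.refl (S : List ℕ) (m : Mem) : Frame S m m := fun _ _ => rfl

theorem Frame.trans {S : List ℕ} {m m' m'' : Mem} (h : Frame S m m') (h' : Frame S m' m'') :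
    Frame S m m'' := fun i hi => (h' i hi).trans (h i hi)

theorem Frame.mono {S S' : List ℕ} {m m' : Mem} (h : Frame S m m') (hS : S ⊆ S') :
    Frame S' m m' := fun i hi => h i fun hi' => hi (hS hi')

theorem Frame.update {S : List ℕ} {m m' : Mem} (h : Frame S m m') {x : ℕ} (hx : x ∈ S) (v : ℕ) :
    Frame S m (Function.update m' x v) := by
  intro i hi
  rw [Function.update_of_ne (fun h => hi (by rwa [h]))]
  exact h i hi

/-- Multiply the cell `x` by the power of the cell `b` with exponent `e`. -/
def powProg (x b : ℕ) (e : Expr) : Prog :=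
  .seq (.store (.lit 21) (.lit 0)) (.loop (.sub e (reg 21))
    (.seq (.store (.lit x) (.mul (reg x) (reg b)))
      (.store (.lit 21) (.add (reg 21) (.lit 1)))))

theorem ok_powProg {β x b : ℕ} {e : Expr} {m : Mem} (a y B : ℕ) (hx : x < 21) (hb : b < 21)
    (hxb : b ≠ x) (he : (Expr.sub e (reg 21)).Small)
    (hB : ∀ m', Frame [x, 21] m m' → e.eval m' = B) (hma : m x = a) (hmy : m b = y)
    (hlt : ∀ k ≤ B, a * y ^ k < 2 ^ β) (hBβ : B < 2 ^ β) :
    Ok β (powProg x b e) [] (3 * B + 2) m fun m' => m' x = a * y ^ B ∧ Frame [x, 21] m m' := by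
  refine Ok.store_seq 0 (by norm_num) (by decide) rfl (by positivity) ?_
  refine (Ok.loop he 2 B (fun k m' => m' x = a * y ^ k ∧ m' 21 = k ∧ Frame [x, 21] m m')
    (fun _ => []) ?_ ?_ _ ?_).weaken (by simp) (by omega) fun m' h => ⟨h.1, h.2.2⟩
  · rintro k hk m' ⟨h1, h2, h3⟩
    have h4 : m' b = y := by rw [h3 b (by simp [hxb]; omega), hmy]
    refine ⟨by simp [Expr.eval, hB m' h3, h2]; omega, ?_⟩
    refine Ok.store_seq (a * y ^ (k + 1)) (by omega) ?_ ?_ (hlt _ hk) ?_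
    · exact ⟨by simp [Expr.nodes], by simp [Expr.maxLit]; omega⟩
    · simp [Expr.eval, h1, h4, pow_succ, mul_assoc]
    refine Ok.store (k + 1) (by norm_num) (by decide) ?_ (by omega) ⟨?_, ?_, ?_⟩
    · simp only [Expr.eval]; rw [Function.update_of_ne (by omega), h2]
    · rw [Function.update_of_ne (by omega), Function.update_self]
    · simp
    · exact (h3.update (by simp) _).update (by simp) _
  · rintro m' ⟨_, h2, h3⟩
    simp [Expr.eval, hB m' h3, h2]
  · refine ⟨?_, by simp, (Frame.refl _ _).update (by simp) _⟩
    rw [Function.update_of_ne (by omega), hma]; simp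

/-! ## The program

Cells: `1`: `n`, `2`: `r`, `3`: `d`, `5`: `N`, `6`: `k`, `7`: `2 ^ h`, `8`: number of points,
`9`: bound for `v`, `10`: index of the point, `11`: `t`, `12`: `v`, `13`: `i`, `14`: `b`, `15`: `j`,
`16`: `k ^ j % N`, `17`: the value of the `j`-th variable, `22`: the coefficient;
the other cells are auxiliary. -/

/-- Computes `leaf r h j t` in cell `17`. -/
def leafProg : Prog :=
  .seq (.store (.lit 17) (reg 11)) <| .seq (.store (.lit 18) (reg 7)) <|
  .seq (.store (.lit 19) (reg 15)) <| .loop (.sub (reg 18) (.lit 1)) <|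
    .seq (.store (.lit 18) (.div (reg 18) (.lit 2))) <|
    .seq (.store (.lit 20) (.lit 1)) <|
    .seq (powProg 20 17 (reg 2)) <|
    .seq (.store (.lit 17) (.mul (reg 20) (.add (.lit 1) (.mul (.div (reg 19) (reg 18)) (reg 17))))) <|
    .store (.lit 19) (.sub (reg 19) (.mul (.div (reg 19) (reg 18)) (reg 18)))

/-- Computes a coefficient of a point in cell `22`. -/
def coeffProg : Prog :=
  .seq (.store (.lit 22) (.lit 0)) <| .seq (.store (.lit 16) (.lit 1)) <|
  .seq (.store (.lit 15) (.lit 0)) <| .loop (.sub (reg 3) (reg 15)) <|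
    .seq leafProg <|
    .seq (.store (.lit 4) (.lit 1)) <|
    .seq (powProg 4 17 (reg 13)) <|
    .seq (powProg 4 12 (.mul (reg 16) (reg 14))) <|
    .seq (.store (.lit 22) (.add (reg 22) (reg 4))) <|
    .seq (.store (.lit 16) (.mul (reg 16) (reg 6))) <|
    .seq (.store (.lit 16) (.sub (reg 16) (.mul (.div (reg 16) (reg 5)) (reg 5)))) <|
    .store (.lit 15) (.add (reg 15) (.lit 1))

/-- Writes the coefficients of one component of a point. -/
def rowProg : Prog :=
  .seq (.store (.lit 14) (.lit 0)) <| .loop (.sub (reg 5) (reg 14)) <|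
    .seq coeffProg <|
    .seq (.write (.lit 1)) <| .seq (.write (.lit 0)) <| .seq (.write (reg 22)) <|
    .seq (.write (.lit 1)) <| .store (.lit 14) (.add (reg 14) (.lit 1))

/-- Writes a point. -/
def pointProg : Prog :=
  .seq (.store (.lit 13) (.lit 0)) <| .loop (.sub (reg 1) (reg 13)) <|
    .seq (.write (.lit 1)) <| .seq (.write (.lit 1)) <| .seq (.write (.lit 0)) <|
    .seq (.write (.lit 1)) <| .seq (.write (.lit 1)) <| .seq rowProg <|
    .seq (.write (.lit 0)) <| .seq (.write (.lit 0)) <| .seq (.write (.lit 0)) <|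
    .store (.lit 13) (.add (reg 13) (.lit 1))

/-- Writes all points. -/
def listProg : Prog :=
  .seq (.store (.lit 10) (.lit 0)) <| .seq (.loop (.sub (reg 8) (reg 10)) <|
    .seq (.write (.lit 1)) <|
    .seq (.store (.lit 11) (.div (reg 10) (reg 9))) <|
    .seq (.store (.lit 12) (.sub (reg 10) (.mul (reg 11) (reg 9)))) <|
    .seq pointProg <|
    .seq (.write (.lit 0)) <|
    .store (.lit 10) (.add (reg 10) (.lit 1))) <| .write (.lit 0)

/-! ### Correctness and command counts of the subprograms -/

/-- `β` bits suffice for all numbers that occur. -/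
structure Fits (β N k n d h r T M : ℕ) : Prop where
  one_le_r : 1 ≤ r
  d_le : d ≤ 2 ^ h
  one_lt_N : 1 < N
  one_le_M : 1 ≤ M
  pow_lt : 2 ^ h < 2 ^ β
  r_lt : r < 2 ^ β
  n_lt : n < 2 ^ β
  d_lt : d < 2 ^ β
  T_lt : T < 2 ^ β
  TM_lt : T * M < 2 ^ β
  Nk_lt : N * k < 2 ^ β
  NN_lt : N * N < 2 ^ β
  leaf_le : (2 + T) ^ (r + 1) ^ h ≤ 2 ^ β
  coeff_lt : d * (((2 + T) ^ (r + 1) ^ h) ^ n * M ^ (N * N)) < 2 ^ β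

theorem sub_div_mul_eq_mod (a b : ℕ) : a - a / b * b = a % b := by
  have := Nat.div_add_mod a b
  rw [mul_comm b] at this
  omega

/-- The offset $2$ makes one level of the substitution cost exactly a power $r+1$, so that iteration
gives $(2+T)^{(r+1)^h}$. -/
theorem two_add_step_le {r y b : ℕ} (hr : 1 ≤ r) (hb : b ≤ 1) :
    2 + y ^ r * (1 + b * y) ≤ (2 + y) ^ (r + 1) := by
  have h1 : y ^ r * (1 + b * y) ≤ (2 + y) ^ r * (1 + y) := by
    gcongr
    · omega
    · nlinarith
  have h2 : 2 ≤ (2 + y) ^ r := by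
    calc 2 ≤ 2 + y := by omega
      _ ≤ (2 + y) ^ r := Nat.le_self_pow (by omega) _
  calc _ ≤ (2 + y) ^ r + (2 + y) ^ r * (1 + y) := add_le_add h2 h1
    _ = _ := by ring

theorem ok_leafProg {β N k n d h r T M : ℕ} (hf : Fits β N k n d h r T M) {m : Mem} {t j : ℕ}
    (h2 : m 2 = r) (h7 : m 7 = 2 ^ h) (h11 : m 11 = t) (h15 : m 15 = j) (ht : t ≤ T)
    (hj : j < 2 ^ h) :
    Ok β leafProg [] (h * (3 * r + 7) + 4) m fun m' => m' 17 = leaf r h j t ∧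
      2 + m' 17 ≤ (2 + T) ^ (r + 1) ^ h ∧ Frame [17, 18, 19, 20, 21] m m' := by
  have hpβ := hf.pow_lt
  refine Ok.store_seq t (by norm_num) (by decide) h11 (ht.trans_lt hf.T_lt) ?_
  refine Ok.store_seq (2 ^ h) (by norm_num) (by decide) (by simpa [Expr.eval] using h7) hpβ ?_
  refine Ok.store_seq j (by norm_num) (by decide) (by simpa [Expr.eval] using h15) (by omega) ?_
  -- After $i$ levels, cells `17` and `19` hold the current argument and the remaining index; the
  -- leaf of height $h-i$ at these data is invariant.
  refine (Ok.loop (by decide) (3 * r + 6) h (fun i m' => ∃ y e, m' 17 = y ∧ m' 18 = 2 ^ (h - i) ∧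
    m' 19 = e ∧ e < 2 ^ (h - i) ∧ leaf r (h - i) e y = leaf r h j t ∧
    2 + y ≤ (2 + T) ^ (r + 1) ^ i ∧ Frame [17, 18, 19, 20, 21] m m')
    (fun _ => []) ?_ ?_ _ ?_).weaken (by simp) (by ring_nf; omega) ?_
  · rintro i hi m' ⟨y, e, h17, h18, h19, he, hleaf, hy, hF⟩
    obtain ⟨g, hg⟩ : ∃ g, h - i = g + 1 := ⟨h - i - 1, by omega⟩
    have hgi : h - (i + 1) = g := by omega
    rw [hg] at h18 he hleaf
    have hpow : 2 ^ (g + 1) = 2 * 2 ^ g := by rw [pow_succ, mul_comm]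
    have hgpos : 0 < 2 ^ g := by positivity
    have hgh : 2 ^ (g + 1) ≤ 2 ^ h := Nat.pow_le_pow_right two_pos (by omega)
    have hb : e / 2 ^ g ≤ 1 := by
      have : e / 2 ^ g < 2 := Nat.div_lt_of_lt_mul (by omega)
      omega
    have hstep : (2 + y) ^ (r + 1) ≤ (2 + T) ^ (r + 1) ^ (i + 1) := by
      rw [pow_succ (r + 1) i, pow_mul]; gcongr
    have htop : (2 + T) ^ (r + 1) ^ (i + 1) ≤ 2 ^ β :=
      le_trans (Nat.pow_le_pow_right (by omega) (Nat.pow_le_pow_right (by omega) hi)) hf.leaf_le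
    have hnew := two_add_step_le (y := y) hf.one_le_r hb
    refine ⟨by simp [Expr.eval, h18]; omega, ?_⟩
    refine Ok.store_seq (2 ^ g) (by norm_num) (by decide) (by simp [Expr.eval, h18]; omega)
      (by omega) ?_
    refine Ok.store_seq 1 (by norm_num) (by decide) rfl (by omega) ?_
    refine Ok.bind (c' := 2) (o' := []) (ok_powProg 1 y r (by norm_num) (by norm_num)
      (by norm_num) (by decide) ?_ (by simp) (by simpa using h17) ?_ hf.r_lt)
      (fun m₂ hm₂ => ?_) rfl (by omega)
    · intro m₂ hm₂
      simp only [Expr.eval]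
      rw [hm₂ 2 (by decide)]
      simp [hF 2 (by decide), h2]
    · intro a ha
      have h1 : y ^ a < (2 + y) ^ (r + 1) := by
        calc y ^ a ≤ (2 + y) ^ a := Nat.pow_le_pow_left (by omega) _
          _ < (2 + y) ^ (r + 1) := Nat.pow_lt_pow_right (by omega) (by omega)
      omega
    obtain ⟨h20, hF2⟩ := hm₂
    have h18' : m₂ 18 = 2 ^ g := by rw [hF2 18 (by decide)]; simp
    have h17' : m₂ 17 = y := by rw [hF2 17 (by decide)]; simpa using h17
    have h19' : m₂ 19 = e := by rw [hF2 19 (by decide)]; simpa using h19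
    have hF3 : Frame [17, 18, 19, 20, 21] m m₂ :=
      ((hF.update (by decide) _).update (by decide) _).trans (hF2.mono (by decide))
    refine Ok.store_seq (y ^ r * (1 + e / 2 ^ g * y)) (by norm_num) (by decide)
      (by simp [Expr.eval, h18', h17', h19', h20]) (by omega) ?_
    refine Ok.store (e % 2 ^ g) (by norm_num) (by decide) ?_ ?_
      ⟨y ^ r * (1 + e / 2 ^ g * y), e % 2 ^ g, ?_⟩
    · simp [Expr.eval, h18', h19', sub_div_mul_eq_mod]
    · have := Nat.mod_lt e hgpos
      omega
    · rw [hgi]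
      refine ⟨by simp, by simp [h18'], by simp, Nat.mod_lt e hgpos, hleaf, hnew.trans hstep,
        (hF3.update (by decide) _).update (by decide) _⟩
  · rintro m' ⟨y, e, -, h18, -⟩
    simp [Expr.eval, h18]
  · exact ⟨t, j, by simp, by simp, by simp, by simpa using hj, rfl, by simpa using ht,
      (((Frame.refl _ _).update (by decide) _).update (by decide) _).update (by decide) _⟩
  · rintro m' ⟨y, e, h17, -, -, he, hleaf, hy, hF⟩
    rw [Nat.sub_self] at hleaf
    exact ⟨h17.trans hleaf, h17 ▸ hy, hF⟩

theorem ok_coeffProg {β N k n d h r T M : ℕ} (hf : Fits β N k n d h r T M) {m : Mem} {t v i b : ℕ}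
    (h2 : m 2 = r) (h3 : m 3 = d) (h5 : m 5 = N) (h6 : m 6 = k) (h7 : m 7 = 2 ^ h)
    (h11 : m 11 = t) (h12 : m 12 = v) (h13 : m 13 = i) (h14 : m 14 = b)
    (ht : t ≤ T) (hv : v ≤ M) (hi : i ≤ n) (hb : b < N) :
    Ok β coeffProg [] (d * (h * (3 * r + 7) + 3 * n + 3 * (N * N) + 14) + 4) m fun m' =>
      m' 22 = pointCoeff N k d h r t v i b ∧ Frame [4, 15, 16, 17, 18, 19, 20, 21, 22] m m' := by
  have hN := hf.one_lt_N
  have hdβ := hf.d_lt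
  set Y := (2 + T) ^ (r + 1) ^ h with hY
  have hY1 : 1 ≤ Y := Nat.one_le_pow _ _ (by omega)
  set W := Y ^ n * M ^ (N * N) with hW
  have hM1 : 1 ≤ M ^ (N * N) := Nat.one_le_pow _ _ hf.one_le_M
  have hYn : Y ^ n ≤ W := Nat.le_mul_of_pos_right _ hM1
  have hWβ : d * W < 2 ^ β := hf.coeff_lt
  have hNβ : N < 2 ^ β := (Nat.le_mul_of_pos_left N (by omega)).trans_lt hf.NN_lt
  refine Ok.store_seq 0 (by norm_num) (by decide) rfl (by omega) ?_
  refine Ok.store_seq 1 (by norm_num) (by decide) rfl (by omega) ?_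
  refine Ok.store_seq 0 (by norm_num) (by decide) rfl (by omega) ?_
  -- Cell `16` keeps $k^a$ reduced modulo $N$, so exponents of `v` stay below $N^2$; the bound $aW$
  -- on the partial sum keeps cell `22` within the allowed bits.
  refine (Ok.loop (by decide) (h * (3 * r + 7) + 3 * n + 3 * (N * N) + 13) d
    (fun a m' => m' 15 = a ∧ m' 16 = k ^ a % N ∧
      m' 22 = ∑ j ∈ Finset.range a, leaf r h j t ^ i * v ^ (k ^ j % N * b) ∧ m' 22 ≤ a * W ∧
      Frame [4, 15, 16, 17, 18, 19, 20, 21, 22] m m')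
    (fun _ => []) ?_ ?_ _ ?_).weaken (by simp) (Nat.le_of_eq (by ring)) fun m' h => ⟨h.2.2.1, h.2.2.2.2⟩
  · rintro a ha m' ⟨h15, h16, h22, h22', hF⟩
    refine ⟨by simp [Expr.eval, h15, hF 3 (by decide), h3]; omega, ?_⟩
    have hdW : W ≤ d * W := Nat.le_mul_of_pos_left _ (by omega)
    have hκ : k ^ a % N < N := Nat.mod_lt _ (by omega)
    have hκb : k ^ a % N * b ≤ N * N := Nat.mul_le_mul hκ.le hb.le
    refine Ok.bind (o' := []) (c' := 3 * n + 3 * (N * N) + 9) (ok_leafProg hf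
      ((hF 2 (by decide)).trans h2) ((hF 7 (by decide)).trans h7) ((hF 11 (by decide)).trans h11)
      h15 ht (ha.trans_le hf.d_le)) (fun m₁ hm₁ => ?_) rfl (by omega)
    obtain ⟨h17, h17', hF1⟩ := hm₁
    have hFm1 : Frame [4, 15, 16, 17, 18, 19, 20, 21, 22] m m₁ := hF.trans (hF1.mono (by decide))
    have hyY : leaf r h a t ≤ Y := by rw [← h17]; omega
    have hpow1 : ∀ c ≤ i, leaf r h a t ^ c ≤ Y ^ n := fun c hc =>
      (Nat.pow_le_pow_left hyY c).trans (Nat.pow_le_pow_right hY1 (hc.trans hi))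
    have hpow2 : ∀ c ≤ k ^ a % N * b, leaf r h a t ^ i * v ^ c ≤ W := fun c hc =>
      Nat.mul_le_mul (hpow1 i le_rfl) ((Nat.pow_le_pow_left hv c).trans
        (Nat.pow_le_pow_right hf.one_le_M (hc.trans hκb)))
    refine Ok.store_seq 1 (by norm_num) (by decide) rfl (by omega) ?_
    refine Ok.bind (o' := []) (c' := 3 * (N * N) + 6) (ok_powProg 1 (leaf r h a t) i (by norm_num)
      (by norm_num) (by norm_num) (by decide) ?_ (by simp) (by simpa using h17) ?_
      (hi.trans_lt hf.n_lt)) (fun m₂ hm₂ => ?_) rfl (by omega)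
    · intro m₂ hm₂
      simp only [Expr.eval]
      rw [hm₂ 13 (by decide)]
      simp [hFm1 13 (by decide), h13]
    · intro c hc
      have := hpow1 c hc
      omega
    obtain ⟨h4, hF2⟩ := hm₂
    have hF12 : Frame [4, 21] m₁ m₂ :=
      ((Frame.refl _ _).update (by decide) _).trans hF2
    have hFm2 : Frame [4, 15, 16, 17, 18, 19, 20, 21, 22] m m₂ :=
      hFm1.trans (hF12.mono (by decide))
    have h16' : m₂ 16 = k ^ a % N := by rw [hF12 16 (by decide), hF1 16 (by decide), h16]
    refine Ok.bind (o' := []) (c' := 4) (ok_powProg (leaf r h a t ^ i) v (k ^ a % N * b)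
      (by norm_num) (by norm_num) (by norm_num) (by decide) ?_ (by simpa using h4)
      ((hFm2 12 (by decide)).trans h12) ?_ (hκb.trans_lt hf.NN_lt)) (fun m₃ hm₃ => ?_) rfl (by omega)
    · intro m₃ hm₃
      simp [Expr.eval, hm₃ 16 (by decide), hm₃ 14 (by decide), h16', hFm2 14 (by decide), h14]
    · intro c hc
      have := hpow2 c hc
      omega
    obtain ⟨h4', hF3⟩ := hm₃
    have hFm3 : Frame [4, 15, 16, 17, 18, 19, 20, 21, 22] m m₃ := hFm2.trans (hF3.mono (by decide))
    have hF03 : ∀ x, x ∉ [4, 17, 18, 19, 20, 21] → m₃ x = m' x := by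
      intro x hx
      simp only [List.mem_cons, not_or] at hx
      rw [hF3 x (by simp; omega), hF12 x (by simp; omega), hF1 x (by simp; omega)]
    have h22a := (hF03 22 (by decide)).trans h22
    have h22b : m₃ 22 ≤ a * W := (hF03 22 (by decide)).trans_le h22'
    have hbound : m₃ 22 + m₃ 4 ≤ (a + 1) * W := by
      rw [h4', Nat.succ_mul]
      exact add_le_add h22b (hpow2 _ le_rfl)
    have hbound' : (a + 1) * W ≤ d * W := Nat.mul_le_mul_right W ha
    have h16'' := (hF03 16 (by decide)).trans h16
    refine Ok.store_seq (m₃ 22 + m₃ 4) (by norm_num) (by decide) rfl (by omega) ?_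
    refine Ok.store_seq (k ^ a % N * k) (by norm_num) (by decide)
      (by simp [Expr.eval, h16'', hFm3 6 (by decide), h6])
      ((Nat.mul_le_mul_right k hκ.le).trans_lt hf.Nk_lt) ?_
    refine Ok.store_seq (k ^ (a + 1) % N) (by norm_num) (by decide) ?_
      ((Nat.mod_lt _ (by omega)).trans hNβ) ?_
    · simp [Expr.eval, hFm3 5 (by decide), h5, sub_div_mul_eq_mod, pow_succ]
    refine Ok.store (a + 1) (by norm_num) (by decide)
      (by simp [Expr.eval, hF03 15 (by decide), h15]) (by omega) ⟨by simp, by simp, ?_, ?_, ?_⟩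
    · rw [Finset.sum_range_succ, ← h22a, ← h4']; simp
    · simpa using hbound
    · exact (((hFm3.update (by decide) _).update (by decide) _).update (by decide) _).update
        (by decide) _
  · rintro m' ⟨h15, -, -, -, hF⟩
    simp [Expr.eval, h15, hF 3 (by decide), h3]
  · refine ⟨by simp, ?_, by simp, by simp, ?_⟩
    -- The program starts from the constant $1$ and not from $1\bmod N$, hence the need for $N>1$.
    · rw [pow_zero, Nat.mod_eq_of_lt hN]; simp
    · exact (((Frame.refl _ _).update (by decide) _).update (by decide) _).update (by decide) _

/-- The output of `rowProg`. -/
def rowOut (N k d h r t v i : ℕ) : List ℕ :=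
  (List.range N).flatMap fun b => [1, 0, pointCoeff N k d h r t v i b, 1]

/-- The output of `pointProg`. -/
def pointOut (N k n d h r t v : ℕ) : List ℕ :=
  (List.range n).flatMap fun i => [1, 1, 0, 1, 1] ++ (rowOut N k d h r t v i ++ [0, 0, 0])

theorem ok_rowProg {β N k n d h r T M : ℕ} (hf : Fits β N k n d h r T M) {m : Mem} {t v i c : ℕ}
    (h2 : m 2 = r) (h3 : m 3 = d) (h5 : m 5 = N) (h6 : m 6 = k) (h7 : m 7 = 2 ^ h)
    (h11 : m 11 = t) (h12 : m 12 = v) (h13 : m 13 = i)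
    (ht : t ≤ T) (hv : v ≤ M) (hi : i ≤ n)
    (hc : d * (h * (3 * r + 7) + 3 * n + 3 * (N * N) + 14) + 4 ≤ c) :
    Ok β rowProg (rowOut N k d h r t v i) (N * (c + 6) + 2) m
      (Frame [4, 14, 15, 16, 17, 18, 19, 20, 21, 22] m) := by
  have hNβ : N < 2 ^ β := (Nat.le_mul_of_pos_left N
    (Nat.zero_lt_one.trans hf.one_lt_N)).trans_lt hf.NN_lt
  refine Ok.store_seq 0 (by norm_num) (by decide) rfl (by positivity) ?_
  refine (Ok.loop (by decide) (c + 5) N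
    (fun b m' => m' 14 = b ∧ Frame [4, 14, 15, 16, 17, 18, 19, 20, 21, 22] m m')
    (fun b => [1, 0, pointCoeff N k d h r t v i b, 1]) ?_ ?_ _ ?_).weaken rfl
      (Nat.le_of_eq (by ring)) fun m' h => h.2
  · rintro b hb m' ⟨h14, hF⟩
    refine ⟨by simp [Expr.eval, h14, hF 5 (by decide), h5]; omega, ?_⟩
    refine Ok.bind (o' := [1, 0, pointCoeff N k d h r t v i b, 1]) (c' := 5) (ok_coeffProg hf
      ((hF 2 (by decide)).trans h2) ((hF 3 (by decide)).trans h3) ((hF 5 (by decide)).trans h5)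
      ((hF 6 (by decide)).trans h6) ((hF 7 (by decide)).trans h7) ((hF 11 (by decide)).trans h11)
      ((hF 12 (by decide)).trans h12) ((hF 13 (by decide)).trans h13) h14 ht hv hi hb)
      (fun m₁ hm₁ => ?_) rfl (by omega)
    obtain ⟨h22, hF1⟩ := hm₁
    refine Ok.write_seq 1 (by decide) rfl <| Ok.write_seq 0 (by decide) rfl <|
      Ok.write_seq _ (by decide) h22 <| Ok.write_seq 1 (by decide) rfl <|
      Ok.store (b + 1) (by norm_num) (by decide)
        (by simp [Expr.eval, hF1 14 (by decide), h14]) (by omega) ⟨by simp, ?_⟩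
    exact (hF.trans (hF1.mono (by decide))).update (by decide) _
  · rintro m' ⟨h14, hF⟩
    simp [Expr.eval, h14, hF 5 (by decide), h5]
  · exact ⟨by simp, (Frame.refl _ _).update (by decide) _⟩

theorem ok_pointProg {β N k n d h r T M : ℕ} (hf : Fits β N k n d h r T M) {m : Mem} {t v c : ℕ}
    (h1 : m 1 = n) (h2 : m 2 = r) (h3 : m 3 = d) (h5 : m 5 = N) (h6 : m 6 = k) (h7 : m 7 = 2 ^ h)
    (h11 : m 11 = t) (h12 : m 12 = v) (ht : t ≤ T) (hv : v ≤ M)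
    (hc : d * (h * (3 * r + 7) + 3 * n + 3 * (N * N) + 14) + 4 ≤ c) :
    Ok β pointProg (pointOut N k n d h r t v) (n * (N * (c + 6) + 12) + 2) m
      (Frame [4, 13, 14, 15, 16, 17, 18, 19, 20, 21, 22] m) := by
  have hnβ := hf.n_lt
  refine Ok.store_seq 0 (by norm_num) (by decide) rfl (by omega) ?_
  refine (Ok.loop (by decide) (N * (c + 6) + 11) n
    (fun i m' => m' 13 = i ∧ Frame [4, 13, 14, 15, 16, 17, 18, 19, 20, 21, 22] m m')
    (fun i => [1, 1, 0, 1, 1] ++ (rowOut N k d h r t v i ++ [0, 0, 0])) ?_ ?_ _ ?_).weaken rfl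
      (Nat.le_of_eq (by ring)) fun m' h => h.2
  · rintro i hi m' ⟨h13, hF⟩
    refine ⟨by simp [Expr.eval, h13, hF 1 (by decide), h1]; omega, ?_⟩
    refine Ok.write_seq 1 (by decide) rfl <| Ok.write_seq 1 (by decide) rfl <|
      Ok.write_seq 0 (by decide) rfl <| Ok.write_seq 1 (by decide) rfl <|
      Ok.write_seq 1 (by decide) rfl <| ?_
    refine Ok.bind (o' := [0, 0, 0]) (c' := 4) (ok_rowProg hf
      ((hF 2 (by decide)).trans h2) ((hF 3 (by decide)).trans h3) ((hF 5 (by decide)).trans h5)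
      ((hF 6 (by decide)).trans h6) ((hF 7 (by decide)).trans h7) ((hF 11 (by decide)).trans h11)
      ((hF 12 (by decide)).trans h12) h13 ht hv hi.le hc)
      (fun m₁ hF1 => ?_) rfl (by omega)
    refine Ok.write_seq 0 (by decide) rfl <| Ok.write_seq 0 (by decide) rfl <|
      Ok.write_seq 0 (by decide) rfl <|
      Ok.store (i + 1) (by norm_num) (by decide)
        (by simp [Expr.eval, hF1 13 (by decide), h13]) (by omega) ⟨by simp, ?_⟩
    exact (hF.trans (hF1.mono (by decide))).update (by decide) _
  · rintro m' ⟨h13, hF⟩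
    simp [Expr.eval, h13, hF 1 (by decide), h1]
  · exact ⟨by simp, (Frame.refl _ _).update (by decide) _⟩

theorem ok_listProg {β N k n d h r T M : ℕ} (hf : Fits β N k n d h r T M) {m : Mem} {c : ℕ}
    (h1 : m 1 = n) (h2 : m 2 = r) (h3 : m 3 = d) (h5 : m 5 = N) (h6 : m 6 = k) (h7 : m 7 = 2 ^ h)
    (h8 : m 8 = T * M) (h9 : m 9 = M)
    (hc : d * (h * (3 * r + 7) + 3 * n + 3 * (N * N) + 14) + 4 ≤ c) :
    Ok β listProg (((List.range (T * M)).flatMap fun a =>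
        1 :: (pointOut N k n d h r (a / M) (a % M) ++ [0])) ++ [0])
      (T * M * (n * (N * (c + 6) + 12) + 8) + 3) m fun _ => True := by
  have hTM := hf.TM_lt
  have hM := hf.one_le_M
  have hMβ : T * M ≠ 0 → M ≤ T * M := fun h => Nat.le_mul_of_pos_left _
    (Nat.pos_of_ne_zero fun h0 => h (by rw [h0, zero_mul]))
  refine Ok.store_seq 0 (by norm_num) (by decide) rfl (by omega) ?_
  refine Ok.bind (c := T * M * (n * (N * (c + 6) + 12) + 7 + 1) + 1) (c' := 1)
    (Ok.loop (by decide) _ (T * M)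
    (fun a m' => m' 10 = a ∧ Frame [4, 10, 11, 12, 13, 14, 15, 16, 17, 18, 19, 20, 21, 22] m m')
    (fun a => 1 :: (pointOut N k n d h r (a / M) (a % M) ++ [0])) ?_ ?_ _ ?_)
    (fun m' _ => Ok.write 0 (by decide) rfl trivial) rfl (Nat.le_of_eq (by ring))
  · rintro a ha m' ⟨h10, hF⟩
    refine ⟨by simp [Expr.eval, h10, hF 8 (by decide), h8]; omega, ?_⟩
    have hMβ := hMβ (by omega)
    have haM : a / M < T := Nat.div_lt_of_lt_mul (by rwa [mul_comm])
    have hmod : a % M < M := Nat.mod_lt _ hM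
    refine Ok.write_seq 1 (by decide) rfl <| Ok.store_seq (a / M) (by norm_num) (by decide)
      (by simp [Expr.eval, h10, hF 9 (by decide), h9]) (haM.trans hf.T_lt) <|
      Ok.store_seq (a % M) (by norm_num) (by decide) ?_ (by omega) ?_
    · simp [Expr.eval, h10, hF 9 (by decide), h9, sub_div_mul_eq_mod]
    have hF0 := (hF.update (x := 11) (by decide) (a / M)).update (x := 12) (by decide) (a % M)
    refine Ok.bind (o' := [0]) (c' := 2) (ok_pointProg hf ((hF0 1 (by decide)).trans h1)
      ((hF0 2 (by decide)).trans h2) ((hF0 3 (by decide)).trans h3) ((hF0 5 (by decide)).trans h5)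
      ((hF0 6 (by decide)).trans h6) ((hF0 7 (by decide)).trans h7) (t := a / M) (v := a % M)
      (by simp) (by simp) haM.le hmod.le hc)
      (fun m₁ hF1 => ?_) rfl (by omega)
    refine Ok.write_seq 0 (by decide) rfl <|
      Ok.store (a + 1) (by norm_num) (by decide)
        (by simp [Expr.eval, hF1 10 (by decide), h10]) (by omega) ⟨by simp, ?_⟩
    exact (hF0.trans (hF1.mono (by decide))).update (by decide) _
  · rintro m' ⟨h10, hF⟩
    simp [Expr.eval, h10, hF 8 (by decide), h8]
  · exact ⟨by simp, (Frame.refl _ _).update (by decide) _⟩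

/-! ### Output format and the main program -/

/-- The list of all points with parameters below `T` and `M`. -/
def points (N k d h r n T M : ℕ) : List (Fin n → AlgData) :=
  (List.range (T * M)).map fun a => point N k d h r (a / M) (a % M)

theorem encRat_natCast (c : ℕ) : encRat (c : ℚ) = [0, c, 1] := by
  have : ¬ ((c : ℚ) < 0) := not_lt.mpr (Nat.cast_nonneg c)
  simp [encRat, this]

theorem encAlg_point (N k d h r t v : ℕ) {n : ℕ} (i : Fin n) :
    1 :: encAlg (point N k d h r t v i) =
      [1, 1, 0, 1, 1] ++ (rowOut N k d h r t v i ++ [0, 0, 0]) := by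
  simp only [point, encAlg, encField, encList, List.flatMap_cons, List.flatMap_nil, List.flatMap_map,
    encRat_natCast, rowOut, List.nil_append, List.cons_append, List.append_nil, List.append_assoc]

theorem encOutput_points (N k d h r n T M : ℕ) :
    encOutput N k (points N k d h r n T M) =
      N :: k :: (((List.range (T * M)).flatMap fun a =>
        1 :: (pointOut N k n d h r (a / M) (a % M) ++ [0])) ++ [0]) := by
  have h1 : ∀ t v, encList encAlg (List.ofFn (point N k d h r t v : Fin n → AlgData)) =
      pointOut N k n d h r t v ++ [0] := by
    intro t v
    rw [encList, pointOut, ← List.map_coe_finRange_eq_range, List.ofFn_eq_map, List.flatMap_map,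
      List.flatMap_map]
    simp only [encAlg_point]
  rw [encOutput, encList, points, List.flatMap_map]
  simp only [h1]

/-- Computes the parameters from the input, and writes `N`, `k` and all points. -/
def mainProg : Prog :=
  .seq (.ifelse (.sub (reg 1) (.lit 1)) .skip (.store (.lit 3) (.lit 1))) <|
  .seq (.store (.lit 4) (.lit 1)) <|
  .seq (.loop (.sub (.add (reg 3) (.lit 1)) (reg 4)) (.store (.lit 4) (.mul (reg 4) (reg 0)))) <|
  .seq (.store (.lit 5) (.mul (.mul (reg 4) (reg 0)) (reg 0))) <|
  .seq (.store (.lit 6) (.add (.lit 1) (.mul (reg 0) (reg 0)))) <|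
  .seq (.store (.lit 7) (.lit 1)) <|
  .seq (.store (.lit 8) (reg 1)) <|
  .seq (.loop (.sub (reg 3) (reg 7)) <|
    .seq (.store (.lit 7) (.mul (.lit 2) (reg 7))) <|
    .store (.lit 8) (.mul (reg 8) (.add (.mul (.lit 2) (reg 2)) (.lit 1)))) <|
  .seq (.store (.lit 9) (.add (.mul (.mul (reg 3) (reg 5)) (reg 5)) (.lit 1))) <|
  .seq (.store (.lit 8) (.mul (reg 8) (reg 9))) <|
  .seq (.write (reg 5)) <| .seq (.write (reg 6)) listProg

/-- The program never computes logarithms: its loops multiply until the power exceeds (for `p`) or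
reaches (for `2`) the degree. The hypotheses on `L` and `h` say precisely when these loops stop. -/
theorem ok_mainProg {β p n r d d' L h N k T M c : ℕ} (hp : 2 ≤ p) (hn : 1 ≤ n)
    (hd' : d' = if n = 1 then 1 else d)
    (hL : ∀ a < L, p ^ a ≤ d') (hL' : d' < p ^ L) (hh : ∀ a < h, 2 ^ a < d')
    (hN : N = p ^ (L + 2)) (hk : k = 1 + p ^ 2) (hT : T = n * (2 * r + 1) ^ h)
    (hM : M = d' * N * N + 1) (hf : Fits β N k n d' h r T M)
    (hc : d' * (h * (3 * r + 7) + 3 * n + 3 * (N * N) + 14) + 4 ≤ c) :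
    Ok β mainProg (encOutput N k (points N k d' h r n T M))
      (T * M * (n * (N * (c + 6) + 12) + 8) + 2 * L + 3 * h + 16) (inputMem p n r d)
      fun _ => True := by
  have hN1 := hf.one_lt_N
  have hNβ : N < 2 ^ β := (Nat.le_mul_of_pos_left N (by omega)).trans_lt hf.NN_lt
  have hkβ : k < 2 ^ β := (Nat.le_mul_of_pos_left k (by omega)).trans_lt hf.Nk_lt
  have hT1 : 1 ≤ T := by
    rw [hT]; exact Nat.mul_pos hn (by positivity)
  have hMβ : M < 2 ^ β := (Nat.le_mul_of_pos_left M hT1).trans_lt hf.TM_lt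
  have hd'β := hf.d_lt
  have hpow : ∀ a ≤ L, p ^ a ≤ N := fun a ha => by
    rw [hN]; exact Nat.pow_le_pow_right (by omega) (by omega)
  -- The opening conditional replaces the degree by $1$ in the univariate case.
  refine Ok.bind (Post' := fun m => m 0 = p ∧ m 1 = n ∧ m 2 = r ∧ m 3 = d') (o := []) (c := 2)
    (o' := encOutput N k (points N k d' h r n T M))
    (c' := T * M * (n * (N * (c + 6) + 12) + 8) + 2 * L + 3 * h + 14) ?_ ?_ rfl (by omega)
  · by_cases hn1 : n = 1
    · rw [if_pos hn1] at hd'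
      refine Ok.ifelse_neg (by decide) (by simp [Expr.eval, inputMem, hn1]) ?_
      refine Ok.store 1 (by norm_num) (by decide) rfl (by omega) ?_
      simp [inputMem, hd']
    · rw [if_neg hn1] at hd'
      refine Ok.ifelse_pos (by decide) (by simp [Expr.eval, inputMem]; omega) ?_
      refine Ok.skip ?_
      simp [inputMem, hd']
  rintro m ⟨h0, h1, h2, h3⟩
  refine Ok.store_seq 1 (by norm_num) (by decide) rfl (by omega) ?_
  refine Ok.bind (o' := encOutput N k (points N k d' h r n T M))
    (c' := T * M * (n * (N * (c + 6) + 12) + 8) + 3 * h + 12)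
    (Ok.loop (by decide) 1 L (fun a m => m 0 = p ∧ m 1 = n ∧ m 2 = r ∧ m 3 = d' ∧ m 4 = p ^ a)
    (fun _ => []) ?_ ?_ _ ?_) ?_ (by simp) (by omega)
  · rintro a ha m ⟨h0, h1, h2, h3, h4⟩
    have := hL a ha
    refine ⟨by simp [Expr.eval, h3, h4]; omega, ?_⟩
    refine Ok.store (p ^ (a + 1)) (by norm_num) (by decide) (by simp [Expr.eval, h0, h4, pow_succ])
      ((hpow _ ha).trans_lt hNβ) ?_
    simp [h0, h1, h2, h3]
  · rintro m ⟨h0, h1, h2, h3, h4⟩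
    simp [Expr.eval, h3, h4]; omega
  · simp [h0, h1, h2, h3]
  clear h0 h1 h2 h3 m
  rintro m ⟨h0, h1, h2, h3, h4⟩
  refine Ok.store_seq N (by norm_num) (by decide)
    (by simp [Expr.eval, h0, h4, hN, pow_succ]) hNβ ?_
  refine Ok.store_seq k (by norm_num) (by decide) (by simp [Expr.eval, h0, hk, pow_two]) hkβ ?_
  refine Ok.store_seq 1 (by norm_num) (by decide) rfl (by omega) ?_
  refine Ok.store_seq n (by norm_num) (by decide) (by simp [Expr.eval, h1]) hf.n_lt ?_
  refine Ok.bind (o' := encOutput N k (points N k d' h r n T M))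
    (c' := T * M * (n * (N * (c + 6) + 12) + 8) + 7)
    (Ok.loop (by decide) 2 h (fun a m => m 1 = n ∧ m 2 = r ∧ m 3 = d' ∧ m 5 = N ∧ m 6 = k ∧
      m 7 = 2 ^ a ∧ m 8 = n * (2 * r + 1) ^ a)
    (fun _ => []) ?_ ?_ _ ?_) ?_ (by simp) (by omega)
  · rintro a ha m ⟨h1, h2, h3, h5, h6, h7, h8⟩
    have := hh a ha
    refine ⟨by simp [Expr.eval, h3, h7]; omega, ?_⟩
    refine Ok.store_seq (2 ^ (a + 1)) (by norm_num) (by decide)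
      (by simp [Expr.eval, h7, pow_succ, mul_comm])
      ((Nat.pow_le_pow_right two_pos ha).trans_lt hf.pow_lt) ?_
    refine Ok.store (n * (2 * r + 1) ^ (a + 1)) (by norm_num) (by decide)
      (by simp [Expr.eval, h2, h8, pow_succ, mul_assoc]) (lt_of_le_of_lt ?_ hf.T_lt) ?_
    · rw [hT]
      exact Nat.mul_le_mul_left n (Nat.pow_le_pow_right (by omega) ha)
    · simp [h1, h2, h3, h5, h6]
  · rintro m ⟨h1, h2, h3, h5, h6, h7, h8⟩
    have := hf.d_le
    simp [Expr.eval, h3, h7]; omega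
  · simp [h1, h2, h3]
  clear h0 h1 h2 h3 h4 m
  rintro m ⟨h1, h2, h3, h5, h6, h7, h8⟩
  refine Ok.store_seq M (by norm_num) (by decide) (by simp [Expr.eval, h3, h5, hM]) hMβ ?_
  refine Ok.store_seq (T * M) (by norm_num) (by decide) (by simp [Expr.eval, h8, hT]) hf.TM_lt ?_
  rw [encOutput_points]
  refine Ok.write_seq N (by decide) (by simp [Expr.eval, h5]) <|
    Ok.write_seq k (by decide) (by simp [Expr.eval, h6]) ?_
  exact ok_listProg hf (by simp [h1]) (by simp [h2]) (by simp [h3]) (by simp [h5]) (by simp [h6])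
    (by simp [h7]) (by simp) (by simp) hc

/-! ### Bit lengths and running time -/

/-- A number of bits that suffices for all numbers that occur. -/
def bits (p n r d N k h T M : ℕ) : ℕ :=
  5 + p + n + r + d + 2 ^ h + T + T * M + N * k + N * N + (2 + T) * (r + 1) ^ h * n + M * (N * N)

/-- The crude bound $x<2^x$ suffices throughout, also for the bases of the large powers: only the
exponents there need to stay quasipolynomial. -/
theorem fits_bits {p n r d d' N k h T M : ℕ} (hr : 1 ≤ r) (hn : 1 ≤ n) (hd : d' ≤ 2 ^ h)
    (hdd : d' ≤ d) (hN : 1 < N) (hM : 1 ≤ M) :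
    Fits (bits p n r d N k h T M) N k n d' h r T M := by
  have hlt : ∀ x, x ≤ bits p n r d N k h T M → x < 2 ^ bits p n r d N k h T M := fun x hx =>
    hx.trans_lt Nat.lt_two_pow_self
  set Y := (2 + T) * (r + 1) ^ h with hY
  have hYle : (2 + T) ^ (r + 1) ^ h ≤ 2 ^ Y := by
    rw [hY, pow_mul]
    exact Nat.pow_le_pow_left Nat.lt_two_pow_self.le _
  have h2h : 0 < 2 ^ h := by positivity
  have hYn : Y ≤ Y * n := Nat.le_mul_of_pos_right _ hn
  refine ⟨hr, hd, hN, hM, hlt _ ?_, hlt _ ?_, hlt _ ?_, hlt _ ?_, hlt _ ?_, hlt _ ?_, hlt _ ?_,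
    hlt _ ?_, ?_, ?_⟩
  · unfold bits; omega
  · unfold bits; omega
  · unfold bits; omega
  · unfold bits; omega
  · unfold bits; omega
  · unfold bits; omega
  · unfold bits; omega
  · unfold bits; omega
  · refine hYle.trans (Nat.pow_le_pow_right two_pos ?_)
    simp only [bits, ← hY]; omega
  · calc d' * (((2 + T) ^ (r + 1) ^ h) ^ n * M ^ (N * N))
        ≤ d * ((2 ^ Y) ^ n * (2 ^ M) ^ (N * N)) := by
          gcongr
          exact Nat.lt_two_pow_self.le
      _ < 2 ^ d * ((2 ^ Y) ^ n * (2 ^ M) ^ (N * N)) :=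
          Nat.mul_lt_mul_of_pos_right Nat.lt_two_pow_self (by positivity)
      _ = 2 ^ (d + (Y * n + M * (N * N))) := by rw [pow_add, pow_add, pow_mul 2 Y n, pow_mul 2 M (N * N)]
      _ ≤ _ := Nat.pow_le_pow_right two_pos (by simp only [bits, ← hY]; omega)

theorem bdd_inputMem (p n r d N k h T M : ℕ) :
    Bdd (bits p n r d N k h T M) (inputMem p n r d) := by
  have hlt : ∀ x, x ≤ bits p n r d N k h T M → x < 2 ^ bits p n r d N k h T M := fun x hx =>
    hx.trans_lt Nat.lt_two_pow_self
  have h2h : 0 < 2 ^ h := by positivity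
  refine ⟨by unfold bits; omega, fun i => hlt _ ?_⟩
  unfold inputMem bits
  split_ifs <;> omega

/-- All parameters, the number of points and the running time are polynomially bounded. -/
theorem time_le {U p n r d d' L h N k T M : ℕ} (hU : 8 ≤ U) (hp : p ≤ U) (hn : n ≤ U) (hr : r ≤ U)
    (hd : d ≤ U) (hdd : d' ≤ d) (hh : 2 ^ h ≤ U) (hL : L ≤ N) (hN : N ≤ U ^ 4) (hk : k ≤ U ^ 3)
    (hT : T ≤ U ^ 4) (hM : M = d' * N * N + 1) (hr' : (r + 1) ^ h ≤ U ^ 3) :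
    T * M ≤ U ^ 14 ∧
    (T * M * (n * (N * (d' * (h * (3 * r + 7) + 3 * n + 3 * (N * N) + 14) + 4 + 6) + 12) + 8) +
      2 * L + 3 * h + 16) * (500 * bits p n r d N k h T M) ≤ U ^ 60 := by
  have hU1 : 1 ≤ U := by omega
  have hmono : ∀ a b : ℕ, a ≤ b → U ^ a ≤ U ^ b := fun a b => Nat.pow_le_pow_right hU1
  -- As $U\ge8$, a constant factor up to $8$ costs one extra power of $U$; all sums below are
  -- absorbed in this way.
  have hsucc : ∀ x a b : ℕ, x ≤ 8 * U ^ a → a + 1 ≤ b → x ≤ U ^ b := fun x a b hx hab => by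
    refine hx.trans (le_trans ?_ (hmono _ _ hab))
    rw [pow_succ, mul_comm]
    exact Nat.mul_le_mul_left _ hU
  have hpos : ∀ a, 1 ≤ U ^ a := fun a => Nat.one_le_pow _ _ hU1
  have h1 : U ^ 1 = U := pow_one U
  have hNN : N * N ≤ U ^ 8 := (Nat.mul_le_mul hN hN).trans_eq (by ring)
  have hM' : M ≤ U ^ 10 := by
    have h2 : d' * N * N ≤ U ^ 9 := by
      rw [mul_assoc]
      exact (Nat.mul_le_mul (hdd.trans hd) hNN).trans_eq (by ring)
    have := hpos 9
    exact hsucc M 9 10 (by omega) le_rfl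
  have hTM : T * M ≤ U ^ 14 := (Nat.mul_le_mul hT hM').trans_eq (by ring)
  refine ⟨hTM, ?_⟩
  have hhU : h ≤ U := Nat.lt_two_pow_self.le.trans hh
  have hbits : bits p n r d N k h T M ≤ U ^ 20 := by
    have h2 : N * k ≤ U ^ 7 := (Nat.mul_le_mul hN hk).trans_eq (by ring)
    have h3 : 2 + T ≤ U ^ 5 := hsucc _ 4 5 (by have := hpos 4; omega) le_rfl
    have h4 : (2 + T) * (r + 1) ^ h * n ≤ U ^ 9 :=
      (Nat.mul_le_mul (Nat.mul_le_mul h3 hr') hn).trans_eq (by ring)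
    have h5 : M * (N * N) ≤ U ^ 18 := (Nat.mul_le_mul hM' hNN).trans_eq (by ring)
    have h6 : U ≤ U ^ 14 := (hmono 1 14 (by norm_num)).trans' h1.ge
    have h7 := hmono 4 14 (by norm_num)
    have h8 := hmono 7 14 (by norm_num)
    have h9 := hmono 8 14 (by norm_num)
    have h10 := hmono 9 14 (by norm_num)
    have h11 := hmono 17 18 (by norm_num)
    have h12 := hsucc (8 * U ^ 14) 14 15 le_rfl le_rfl
    have h13 := hsucc (8 * U ^ 15) 15 16 le_rfl le_rfl
    have h14 := hmono 16 18 (by norm_num)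
    have := hpos 14
    unfold bits
    refine hsucc _ 18 20 ?_ (by norm_num)
    omega
  have hc : d' * (h * (3 * r + 7) + 3 * n + 3 * (N * N) + 14) + 4 + 6 ≤ U ^ 12 := by
    have h2 : 3 * r + 7 ≤ U ^ 2 := hsucc _ 1 2 (by omega) le_rfl
    have h3 : h * (3 * r + 7) ≤ U ^ 8 :=
      ((Nat.mul_le_mul hhU h2).trans_eq (by ring)).trans (hmono 3 8 (by norm_num))
    have h4 : U ≤ U ^ 8 := (hmono 1 8 (by norm_num)).trans' h1.ge
    have h5 : h * (3 * r + 7) + 3 * n + 3 * (N * N) + 14 ≤ U ^ 10 := by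
      have h6 := hsucc (8 * U ^ 8) 8 9 le_rfl le_rfl
      refine hsucc _ 9 10 ?_ le_rfl
      omega
    have h6 : d' * (h * (3 * r + 7) + 3 * n + 3 * (N * N) + 14) ≤ U ^ 11 :=
      (Nat.mul_le_mul (hdd.trans hd) h5).trans_eq (by ring)
    have h7 : U ≤ U ^ 11 := (hmono 1 11 (by norm_num)).trans' h1.ge
    exact hsucc _ 11 12 (by omega) le_rfl
  generalize d' * (h * (3 * r + 7) + 3 * n + 3 * (N * N) + 14) + 4 + 6 = c at hc ⊢
  have h2 : N * c + 12 ≤ U ^ 17 := by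
    have h3 : N * c ≤ U ^ 16 := (Nat.mul_le_mul hN hc).trans_eq (by ring)
    have h4 : U ≤ U ^ 16 := (hmono 1 16 (by norm_num)).trans' h1.ge
    exact hsucc _ 16 17 (by omega) le_rfl
  have h3 : n * (N * c + 12) + 8 ≤ U ^ 19 := by
    have h4 : n * (N * c + 12) ≤ U ^ 18 := (Nat.mul_le_mul hn h2).trans_eq (by ring)
    have h5 : U ≤ U ^ 18 := (hmono 1 18 (by norm_num)).trans' h1.ge
    exact hsucc _ 18 19 (by omega) le_rfl
  have h4 : T * M * (n * (N * c + 12) + 8) ≤ U ^ 33 := (Nat.mul_le_mul hTM h3).trans_eq (by ring)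
  have h5 : T * M * (n * (N * c + 12) + 8) + 2 * L + 3 * h + 16 ≤ U ^ 35 := by
    have h6 : U ≤ U ^ 33 := (hmono 1 33 (by norm_num)).trans' h1.ge
    have h7 := hmono 4 33 (by norm_num)
    have h8 := hsucc (8 * U ^ 33) 33 34 le_rfl le_rfl
    refine hsucc _ 34 35 ?_ le_rfl
    omega
  have h6 : 500 * bits p n r d N k h T M ≤ U ^ 23 := by
    calc 500 * bits p n r d N k h T M ≤ U ^ 3 * U ^ 20 :=
          Nat.mul_le_mul ((by norm_num : 500 ≤ 8 ^ 3).trans (Nat.pow_le_pow_left hU 3)) hbits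
      _ = _ := by ring
  calc _ ≤ U ^ 35 * U ^ 23 := Nat.mul_le_mul h5 h6
    _ = U ^ 58 := by ring
    _ ≤ _ := hmono _ _ (by norm_num)

/-! ## The univariate case -/

theorem prod_ofFn_smul {R S : Type*} [CommSemiring R] [Semiring S] [Algebra R S] (x : S) :
    ∀ (d : ℕ) (c : Fin d → R), (List.ofFn fun j => c j • x).prod = (∏ j, c j) • x ^ d := by
  intro d
  induction d with
  | zero => intro c; simp
  | succ d ih =>
    intro c
    rw [List.ofFn_succ, List.prod_cons, ih fun j => c j.succ, Fin.prod_univ_succ, pow_succ',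
      smul_mul_smul_comm]

theorem exists_poly_eq_smul {E : Type*} [Field E] {r d : ℕ} (A : HomABP E 1 r d) :
    ∃ c : E, A.poly = c • FreeAlgebra.ι E 0 ^ d := by
  refine ⟨∑ π : Fin (d + 1) → Fin r with π 0 = A.source ∧ π (Fin.last d) = A.sink,
    ∏ j : Fin d, A.label j (π j.castSucc) (π j.succ) 0, ?_⟩
  rw [HomABP.poly, Finset.sum_smul]
  refine Finset.sum_congr rfl fun π _ => ?_
  rw [← prod_ofFn_smul]
  simp [linForm]

theorem pointElem_zero {N k : ℕ} (hN : 1 < N) (h r : ℕ) :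
    pointElem N k 1 h r 0 0 0 = 1 := by
  rw [pointElem, Finset.sum_eq_single 0]
  · simp [pointCoeff]
  · intro b _ hb
    simp [pointCoeff, Nat.mod_eq_of_lt hN, hb]
  · intro h0
    exact absurd (Finset.mem_range.mpr (by omega)) h0

/-- With $t=v=0$ the convention $0^0=1$ leaves only the constant coefficient, so the point is the
generator $x$. No power of $x$ vanishes because $x^\ell=z\neq0$, whatever the degree. -/
theorem lift_point_zero_ne_zero {N k h r : ℕ} (hN : 1 < N) {F : Subfield (CycFun N)}
    (σ : CycFun N ≃ₐ[F] CycFun N) {ℓ : ℕ} (hℓ : 0 < ℓ) {E : Type*} [Field E]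
    [Algebra (CycFun N) E] {d : ℕ} (A : HomABP E 1 r d) (hA : A.poly ≠ 0) :
    FreeAlgebra.lift E (fun i =>
      (AlgData.val N ℓ σ (point N k 1 h r 0 0 i)).map (algebraMap (CycFun N) E)) A.poly ≠ 0 := by
  obtain ⟨c, hc⟩ := exists_poly_eq_smul A
  have hc0 : c ≠ 0 := by
    rintro rfl
    exact hA (by rw [hc, zero_smul])
  set z := algebraMap (CycFun N) E (zvar N) with hz
  have hz0 : z ≠ 0 := (map_ne_zero _).mpr RatFunc.X_ne_zero
  have hval : (AlgData.val N ℓ σ (point N k 1 h r 0 0 (0 : Fin 1))).map (algebraMap (CycFun N) E) =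
      shiftMat ℓ z := by
    have h1 : pointElem N k 1 h r 0 0 ((0 : Fin 1) : ℕ) = 1 :=
      pointElem_zero hN h r
    rw [algData_val_point, h1, cyclicShift_eq]
    simp only [cyclicDiag, map_one, Matrix.diagonal_one, one_mul]
    exact shiftMat_map (algebraMap (CycFun N) E) ℓ (zvar N)
  rw [hc, map_smul, map_pow, FreeAlgebra.lift_ι_apply, hval]
  refine smul_ne_zero hc0 fun h0 => ?_
  have h1 : (z ^ d) • (1 : Matrix (Fin ℓ) (Fin ℓ) E) = 0 := by
    have := congrArg (· ^ d) (shiftMat_pow_self ℓ z)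
    simp only [smul_pow, one_pow] at this
    rw [← this, ← pow_mul, mul_comm, pow_mul, h0, zero_pow hℓ.ne']
  have := congrFun (congrFun h1 ⟨0, hℓ⟩) ⟨0, hℓ⟩
  simp at this
  exact hz0 this.1

/-! ## The bounds -/

theorem one_le_logb_degLog (n d : ℕ) : 1 ≤ Real.logb 2 (degLog n d) := by
  rw [Real.le_logb_iff_rpow_le one_lt_two (by unfold degLog; positivity)]
  simp [degLog]

theorem le_degLog {n d : ℕ} (hn : 2 ≤ n) : (d : ℝ) ≤ degLog n d := by
  have h1 : 1 ≤ Real.logb 2 n := by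
    rw [Real.le_logb_iff_rpow_le one_lt_two (by positivity)]
    simpa using hn
  calc (d : ℝ) = d * 1 := (mul_one _).symm
    _ ≤ d * Real.logb 2 n := by gcongr
    _ ≤ _ := le_max_right _ _

/-- From $p\le2^p$ one gets $1\le p\log_p2$. This is why the factor $p$ in the bound absorbs
rounding of the logarithm to base `p`. -/
theorem one_le_mul_logb_degLog {p : ℕ} (hp : 2 ≤ p) (n d : ℕ) :
    1 ≤ p * Real.logb p (degLog n d) := by
  have hp1 : (1 : ℝ) < p := by exact_mod_cast hp
  have h1 : Real.logb p p ≤ Real.logb p ((2 : ℝ) ^ p) :=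
    Real.logb_le_logb_of_le hp1 (by positivity) (by exact_mod_cast Nat.lt_two_pow_self.le)
  rw [Real.logb_self_eq_one hp1, Real.logb_pow] at h1
  refine h1.trans ?_
  gcongr
  exact le_max_left _ _

theorem log_add_one_le {p n d d' : ℕ} (hp : 2 ≤ p) (hd : 1 ≤ d)
    (hd' : d' = if n = 1 then 1 else d) (hn : 1 ≤ n) :
    ((Nat.log p d' + 1 : ℕ) : ℝ) ≤ 300 * p * Real.logb p (degLog n d) := by
  have hp1 : (1 : ℝ) < p := by exact_mod_cast hp
  have h1 := one_le_mul_logb_degLog hp n d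
  have h2 : ((Nat.log p d' : ℕ) : ℝ) ≤ p * Real.logb p (degLog n d) := by
    by_cases hn1 : n = 1
    · rw [hd', if_pos hn1, Nat.log_one_right]
      push_cast; linarith
    · rw [hd', if_neg hn1]
      refine (Real.natLog_le_logb d p).trans ?_
      have h3 : Real.logb p d ≤ Real.logb p (degLog n d) :=
        Real.logb_le_logb_of_le hp1 (by positivity) (le_degLog (by omega))
      have h4 : 0 ≤ Real.logb p d := Real.logb_nonneg hp1 (by exact_mod_cast hd)
      nlinarith
  push_cast
  linarith

theorem clog_le {n d d' : ℕ} (hd : 1 ≤ d) (hd' : d' = if n = 1 then 1 else d) (hn : 1 ≤ n) :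
    ((Nat.clog 2 d' : ℕ) : ℝ) ≤ 1 + Real.logb 2 (degLog n d) := by
  have h1 := one_le_logb_degLog n d
  by_cases h : Nat.clog 2 d' = 0
  · rw [h]; push_cast; linarith
  have hn1 : n ≠ 1 := by
    rintro rfl
    apply h
    rw [hd', if_pos rfl]; simp
  rw [if_neg hn1] at hd'
  subst hd'
  have h2 : 2 ^ (Nat.clog 2 d' - 1) < d' := Nat.pow_lt_of_lt_clog (by omega)
  have h3 : ((Nat.clog 2 d' - 1 : ℕ) : ℝ) ≤ Real.logb 2 (degLog n d') := by
    rw [Real.le_logb_iff_rpow_le one_lt_two (by unfold degLog; positivity), Real.rpow_natCast]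
    refine le_trans ?_ (le_degLog (by omega))
    exact_mod_cast h2.le
  rw [Nat.cast_sub (by omega)] at h3
  push_cast at h3
  linarith

/-- With $\lambda=\log_2 m\ge1$ and $p\ge2$, one has $p+h+1\le p+2+\lambda\le\frac52p\lambda$; sixty
times this is below $300p\lambda$. -/
theorem pow_le_quasiBound {p n r d h x : ℕ} (hp : 2 ≤ p)
    (hh : (h : ℝ) ≤ 1 + Real.logb 2 (degLog n d))
    (hx : x ≤ ((max 2 (n * r * d)) ^ (p + h + 1)) ^ 60) :
    (x : ℝ) ≤ quasiBound 300 p n r d := by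
  have h1 := one_le_logb_degLog n d
  have hp' : (2 : ℝ) ≤ p := by exact_mod_cast hp
  have hs : (1 : ℝ) ≤ max 2 ((n : ℝ) * r * d) := le_trans (by norm_num) (le_max_left _ _)
  calc (x : ℝ) ≤ (max 2 ((n : ℝ) * r * d)) ^ ((p + h + 1) * 60) := by
        rw [pow_mul]; exact_mod_cast hx
    _ = (max 2 ((n : ℝ) * r * d)) ^ ((((p + h + 1) * 60 : ℕ)) : ℝ) := (Real.rpow_natCast _ _).symm
    _ ≤ _ := by
        unfold quasiBound
        refine Real.rpow_le_rpow_of_exponent_le hs ?_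
        push_cast
        nlinarith

end HittingSet

/-! ### Choice of parameters and conclusion -/

theorem mainTheorem7 :
    ∃ (C : ℝ) (P : HittingSet.Prog),
      ∀ p n d : ℕ, p.Prime → 1 ≤ n → 1 ≤ d →
      ∃ L : ℕ, (L : ℝ) ≤ C * p * Real.logb p (HittingSet.degLog n d) ∧
      ∀ r : ℕ, 1 ≤ r →
      ∃ (N k : ℕ) (H : List (Fin n → HittingSet.AlgData)) (t : ℕ)
        (F : Subfield (HittingSet.CycFun N)) (hz : HittingSet.zvar N ∈ F)
        (σ : HittingSet.CycFun N ≃ₐ[F] HittingSet.CycFun N),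
        -- the program outputs the hitting set, within the claimed time
        HittingSet.RunsTo P p n r d (HittingSet.encOutput N k H) t ∧
        (t : ℝ) ≤ HittingSet.quasiBound C p n r d ∧
        (H.length : ℝ) ≤ HittingSet.quasiBound C p n r d ∧
        -- `(ℚ(ω, z)/F, σ, z)` is a cyclic division algebra of index `p ^ L`
        1 ≤ N ∧ σ (HittingSet.omega N) = HittingSet.omega N ^ k ∧
        HittingSet.IsCyclicDivisionAlgebra (p ^ L) σ (⟨HittingSet.zvar N, hz⟩ : F) ∧
        -- the points lie in it
        (∀ q ∈ H, ∀ i, HittingSet.AlgData.val N (p ^ L) σ (q i) ∈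
          HittingSet.cyclicAlgebra (p ^ L) σ (⟨HittingSet.zvar N, hz⟩ : F)) ∧
        -- and they hit every nonzero polynomial of the class
        ∀ (E : Type*) [Field E] [Algebra (HittingSet.CycFun N) E],
          HittingSet.Hits E r d
            {x | ∃ q ∈ H, x = fun i => HittingSet.AlgData.val N (p ^ L) σ (q i)} := by
  open HittingSet in
  refine ⟨300, mainProg, fun p n d hp hn hd => ?_⟩
  -- For $n=1$ the bound on $L$ is $Cp\log_p2$ regardless of the degree, so $L$ cannot be allowed to
  -- grow with `d`.
  obtain ⟨d', hd'⟩ : ∃ d', d' = if n = 1 then 1 else d := ⟨_, rfl⟩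
  have hdd : d' ≤ d := by rw [hd']; split_ifs <;> omega
  have hd1 : 1 ≤ d' := by rw [hd']; split_ifs <;> omega
  have hp2 := hp.two_le
  refine ⟨Nat.log p d' + 1, log_add_one_le hp2 hd hd' hn, fun r hr => ?_⟩
  set L := Nat.log p d' + 1 with hL
  have hL1 : ∀ a < L, p ^ a ≤ d' := fun a ha =>
    (Nat.pow_le_pow_right (by omega) (by omega)).trans (Nat.pow_log_le_self p (by omega))
  have hL2 : d' < p ^ L := Nat.lt_pow_succ_log_self (by omega) d'
  set h := Nat.clog 2 d' with hh
  have hh1 : ∀ a < h, 2 ^ a < d' := fun a ha => Nat.pow_lt_of_lt_clog ha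
  have hh2 : d' ≤ 2 ^ h := Nat.le_pow_clog (by omega) d'
  obtain ⟨N, hN⟩ : ∃ N, N = p ^ (L + 2) := ⟨_, rfl⟩
  obtain ⟨k, hk⟩ : ∃ k, k = 1 + p ^ 2 := ⟨_, rfl⟩
  have hN1 : 1 < N := by rw [hN]; exact Nat.one_lt_pow (by omega) (by omega)
  have hcop : k.Coprime N := by rw [hk, hN]; exact coprime_one_add_sq L
  have hord : orderOf (k : ZMod N) = p ^ L := by
    subst hN hk; exact orderOf_one_add_sq hp L
  obtain ⟨F, hz, σ, hω, hdiv⟩ := exists_cyclicDivisionAlgebra (by omega)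
    (pow_pos (by omega) L) hcop hord
  set T := n * (2 * r + 1) ^ h with hT
  set M := d' * N * N + 1 with hM
  have hT0 : (n - 1) * (2 * r + 1) ^ h < T :=
    Nat.mul_lt_mul_of_pos_right (by omega) (by positivity)
  have hfits := fits_bits (p := p) (T := T) (M := M) (k := k) hr hn hh2 hdd hN1 (by omega)
  obtain ⟨m', t, hexec, ht, -, -⟩ := ok_mainProg (r := r) (T := T) (M := M) hp2 hn hd' hL1 hL2 hh1
    hN hk hT hM hfits le_rfl (bdd_inputMem p n r d N k h T M)
  set S := max 2 (n * r * d) with hS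
  have hS2 : 2 ≤ S := le_max_left _ _
  have hnrd : n * r * d ≤ S := le_max_right _ _
  have hnS : n ≤ S := by
    calc n = n * 1 * 1 := by ring
      _ ≤ n * r * d := by gcongr
      _ ≤ S := hnrd
  have hrS : r ≤ S := by
    calc r = 1 * r * 1 := by ring
      _ ≤ n * r * d := by gcongr
      _ ≤ S := hnrd
  have hdS : d ≤ S := by
    calc d = 1 * 1 * d := by ring
      _ ≤ n * r * d := by gcongr
      _ ≤ S := hnrd
  -- One quantity dominating everything: $p\le2^p\le S^p$, $2^h\le S^h$, $2r+1\le S^3$, and $8\le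
  -- S^3$ because $p\ge2$. All parameters are then bounded by fixed powers of $U$.
  set U := S ^ (p + h + 1) with hU
  have hpowU : ∀ a, a ≤ p + h + 1 → S ^ a ≤ U := fun a ha => Nat.pow_le_pow_right (by omega) ha
  have hSU : S ≤ U := by simpa using hpowU 1 (by omega)
  have hU8 : 8 ≤ U := (Nat.pow_le_pow_left hS2 3).trans (hpowU 3 (by omega))
  have hpU : p ≤ U := (Nat.lt_two_pow_self.le.trans (Nat.pow_le_pow_left hS2 p)).trans
    (hpowU p (by omega))
  have hNU : N ≤ U ^ 4 := by
    calc N = p ^ (Nat.log p d') * p ^ 3 := by rw [hN, hL, ← pow_add]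
      _ ≤ d' * p ^ 3 := Nat.mul_le_mul_right _ (Nat.pow_log_le_self p (by omega))
      _ ≤ U * U ^ 3 := Nat.mul_le_mul (by omega) (Nat.pow_le_pow_left hpU 3)
      _ = U ^ 4 := by ring
  have hkU : k ≤ U ^ 3 := by
    have h1 : p ^ 2 ≤ U ^ 2 := Nat.pow_le_pow_left hpU 2
    have h2 : 1 ≤ U ^ 2 := Nat.one_le_pow _ _ (by omega)
    calc k ≤ 8 * U ^ 2 := by omega
      _ ≤ U * U ^ 2 := Nat.mul_le_mul_right _ hU8
      _ = U ^ 3 := by ring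
  have hrU : (2 * r + 1) ^ h ≤ U ^ 3 := by
    have h1 : 2 * r + 1 ≤ S ^ 3 := by
      have : S ^ 3 = S * S * S := by ring
      have : 4 ≤ S * S := Nat.mul_le_mul hS2 hS2
      have : 4 * S ≤ S * S * S := Nat.mul_le_mul_right S this
      omega
    calc (2 * r + 1) ^ h ≤ (S ^ 3) ^ h := Nat.pow_le_pow_left h1 h
      _ = (S ^ h) ^ 3 := by rw [← pow_mul, ← pow_mul, mul_comm]
      _ ≤ U ^ 3 := Nat.pow_le_pow_left (hpowU h (by omega)) 3
  have hTU : T ≤ U ^ 4 := (Nat.mul_le_mul (hnS.trans hSU) hrU).trans_eq (by ring)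
  have hLN : L ≤ N := by
    rw [hN]
    exact (Nat.lt_pow_self (by omega)).le.trans (Nat.pow_le_pow_right (by omega) (by omega))
  obtain ⟨hTM, htime⟩ := time_le (L := L) hU8 hpU (hnS.trans hSU) (hrS.trans hSU) (hdS.trans hSU) hdd
    ((Nat.pow_le_pow_left hS2 h).trans (hpowU h (by omega))) hLN hNU hkU hTU hM
    ((Nat.pow_le_pow_left (by omega) h).trans hrU)
  have hhle := clog_le hd hd' hn
  refine ⟨N, k, points N k d' h r n T M, t, F, hz, σ, ⟨m', hexec⟩,
    pow_le_quasiBound hp2 hhle (ht.trans htime), pow_le_quasiBound hp2 hhle ?_, by omega, hω, hdiv,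
    ?_, ?_⟩
  · rw [points, List.length_map, List.length_range]
    exact hTM.trans (Nat.pow_le_pow_right (by omega) (by norm_num))
  · intro q hq i
    obtain ⟨a, -, rfl⟩ := List.mem_map.mp hq
    exact algData_val_point_mem _ σ hz _ _ _ _ _ _ i
  · intro E _ _ A hA
    have hmem : ∀ t < T, ∀ v < M, point N k d' h r t v ∈ points N k d' h r n T M := by
      intro t ht v hv
      refine List.mem_map.mpr ⟨t * M + v, ?_, ?_⟩
      · rw [List.mem_range]
        calc t * M + v < t * M + M := by omega
          _ = (t + 1) * M := by ring
          _ ≤ T * M := Nat.mul_le_mul_right _ ht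
      · rw [show t * M + v = v + M * t by ring, Nat.add_mul_div_left _ _ (by omega),
          Nat.add_mul_mod_self_left, Nat.div_eq_of_lt hv, Nat.mod_eq_of_lt hv, zero_add]
    by_cases hn1 : n = 1
    · subst hn1
      rw [if_pos rfl] at hd'
      subst hd'
      exact ⟨_, ⟨_, hmem 0 (by omega) 0 (by omega), rfl⟩,
        lift_point_zero_ne_zero hN1 σ (pow_pos (by omega) L) A hA⟩
    · rw [if_neg hn1] at hd'
      subst hd'
      have : NeZero n := ⟨by omega⟩
      -- The order $p^L$ of `k` exceeds the degree, so the exponents needed for orthogonality are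
      -- distinct.
      have hinj : ∀ j < d', ∀ j' < d', k ^ j ≡ k ^ j' [MOD N] → j = j' := by
        intro j hj j' hj' hjj
        rw [← ZMod.natCast_eq_natCast_iff] at hjj
        push_cast at hjj
        exact pow_injOn_Iio_orderOf (by rw [Set.mem_Iio, hord]; omega)
          (by rw [Set.mem_Iio, hord]; omega) hjj
      obtain ⟨t, ht, v, hv, hne⟩ := exists_point_lift_ne_zero σ (by omega) hω hL2 hh2 hT0 hinj A hA
      exact ⟨_, ⟨_, hmem t ht v hv, rfl⟩, hne⟩
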